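/- **Conventions.** An affine reflection of a finite-dimensional complex inner product space $V$ is a non-identity affine isometry fixing an affine hyperplane (its reflecting hyperplane) pointwise. A crystallographic reflection group on $V$ is a group $W$ of invertible affine transformations of $V$ that is generated by affine reflections, acts discretely, and has compact orbit space $V/W$. $W$ has the *Steinberg property* if the set of points of $V$ fixed by some non-identity element of $W$ is the union of the reflecting hyperplanes of the reflections in $W$. Two groups of affine transformations are identified ("$W$ is $W'$") if some $\mathbb{C}$-affine isomorphism of the underlying spaces conjugates one onto the other. For $p\mid r$, $G(r,p,n)$ is the group of $n\times n$ monomial matrices whose nonzero entries are $r$-th roots of unity with product $c$ satisfying $c^{r/p}=1$. $W(A_{n-1})$ is the symmetric group $\mathfrak S_n$ permuting coordinates on the sum-zero hyperplane $V'_n\subset\mathbb{C}^n$. Let $$\Omega=\{z\in\mathbb{C}: -\tfrac12\le \operatorname{Re} z<\tfrac12,\ |z|\ge 1 \text{ if } \operatorname{Re}z\le 0,\ |z|>1\text{ if }\operatorname{Re}z>0\}.$$ For $\alpha\in\Omega$ put - $[W(A_{n-1})]^\alpha_1=W(A_{n-1})\ltimes\sum_{j=2}^n(\mathbb{Z}+\mathbb{Z}\alpha)(e_{j-1}-e_j)$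 on $V'_n$, for $n\ge2$; - $[G(2,1,n)]^\alpha_1=G(2,1,n)\ltimes\big((\mathbb{Z}+\mathbb{Z}\alpha)e_1+\sum_{j=2}^n(\mathbb{Z}+\mathbb{Z}\alpha)(e_{j-1}-e_j)\big)$ on $\mathbb{C}^n$, for $n\ge1$; - $[G(2,2,3)]^\alpha_1=G(2,2,3)\ltimes\big((\mathbb{Z}+\mathbb{Z}\alpha)(-e_1-e_2)+\sum_{j=2}^3(\mathbb{Z}+\mathbb{Z}\alpha)(e_{j-1}-e_j)\big)$ on $\mathbb{C}^3$. **Theorem.** Let $W=G\ltimes\Lambda$ be a crystallographic reflection group, where $\Lambda$ is a $G$-invariant lattice and either $G=W(A_{n-1})$ acting on $V'_n$ with $n\ge2$, or $G=G(r,p,n)$ acting on $\mathbb{C}^n$ with $r,n\ge1$ and $p\mid r$, where $G(r,p,n)$ acts irreducibly and is, after a change of basis of $\mathbb{C}^n$, the complexification of a finite Coxeter group (a finite group of real orthogonal matrices generated by reflections). Then $W$ has the Steinberg property if and only if $W$ is $[W(A_{m-1})]^\alpha_1$ for some $m\ge2$, or $[G(2,1,m)]^\alpha_1$ for some $m\ge1$,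 or $[G(2,2,3)]^\alpha_1$, for some $\alpha\in\Omega$. -/

import Mathlib

noncomputable section

namespace CrystRefl

section General

variable {V : Type*} [NormedAddCommGroup V] [InnerProductSpace ℂ V]
variable {V' : Type*} [NormedAddCommGroup V'] [InnerProductSpace ℂ V']

/-- `s` is an affine reflection with reflecting hyperplane `H`: a non-identity affine isometry
fixing the affine hyperplane `H` pointwise. -/
def IsReflectionAbout (s : V ≃ᵃ[ℂ] V) (H : AffineSubspace ℂ V) : Prop :=
  s ≠ 1 ∧ Isometry s ∧
    (H : Set V).Nonempty ∧ Module.finrank ℂ H.direction + 1 = Module.finrank ℂ V ∧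
    ∀ x ∈ H, s x = x

/-- `s` is an affine reflection. -/
def IsReflection (s : V ≃ᵃ[ℂ] V) : Prop :=
  ∃ H : AffineSubspace ℂ V, IsReflectionAbout s H

/-- The reflecting hyperplanes of a group `W` of affine transformations. -/
def IsReflectingHyperplane (W : Subgroup (V ≃ᵃ[ℂ] V)) (H : AffineSubspace ℂ V) : Prop :=
  ∃ s ∈ W, IsReflectionAbout s H

/-- `W` acts discretely: only finitely many elements of `W` move a given compact set
so that it meets itself. -/
def ActsDiscretely (W : Subgroup (V ≃ᵃ[ℂ] V)) : Prop :=
  ∀ K : Set V, IsCompact K → {w : V ≃ᵃ[ℂ] V | w ∈ W ∧ (w '' K ∩ K).Nonempty}.Finite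

/-- An affine reflection group: acts discretely and is generated by the affine reflections
it contains. -/
def IsAffineReflectionGroup (W : Subgroup (V ≃ᵃ[ℂ] V)) : Prop :=
  Subgroup.closure {s : V ≃ᵃ[ℂ] V | s ∈ W ∧ IsReflection s} = W ∧ ActsDiscretely W

/-- The equivalence relation on `V` whose classes are the `W`-orbits. -/
def orbitSetoid (W : Subgroup (V ≃ᵃ[ℂ] V)) : Setoid V where
  r u v := ∃ w ∈ W, w u = v
  iseqv :=
    { refl := fun u => ⟨1, W.one_mem, rfl⟩
      symm := by
        rintro u v ⟨w, hw, rfl⟩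
        exact ⟨w⁻¹, W.inv_mem hw, w.symm_apply_apply u⟩
      trans := by
        rintro u v x ⟨w, hw, rfl⟩ ⟨w', hw', rfl⟩
        exact ⟨w' * w, W.mul_mem hw' hw, rfl⟩ }

/-- A crystallographic reflection group: an affine reflection group whose space of orbits
`V / W` (with the quotient topology) is compact. -/
def IsCrystallographic (W : Subgroup (V ≃ᵃ[ℂ] V)) : Prop :=
  IsAffineReflectionGroup W ∧ CompactSpace (Quotient (orbitSetoid W))

/-- The Steinberg property: the set of nonregular points (points fixed by some non-identity
element of `W`) is the union of the reflecting hyperplanes of `W`. -/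
def HasSteinbergProperty (W : Subgroup (V ≃ᵃ[ℂ] V)) : Prop :=
  {v : V | ∃ w ∈ W, w ≠ 1 ∧ w v = v} =
    ⋃ H ∈ {H : AffineSubspace ℂ V | IsReflectingHyperplane W H}, (H : Set V)

/-- Equivalence of groups of affine transformations: conjugacy under an affine isomorphism. -/
def Equivalent (W : Subgroup (V ≃ᵃ[ℂ] V)) (W' : Subgroup (V' ≃ᵃ[ℂ] V')) : Prop :=
  ∃ f : V ≃ᵃ[ℂ] V', ∀ w : V ≃ᵃ[ℂ] V, w ∈ W ↔ (f.symm.trans w).trans f ∈ W'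

/-- The set `Λ` of vectors is stable under the linear group `G`. -/
def IsInvariant (G : Subgroup (V ≃ₗ[ℂ] V)) (Λ : AddSubgroup V) : Prop :=
  ∀ g ∈ G, ∀ t ∈ Λ, g t ∈ Λ

/-- The group `G ⋉ Λ` of affine transformations, generated by the elements of `G` and the
translations by elements of `Λ`. When `Λ` is `G`-invariant it consists of the maps
`v ↦ g v + t` with `g ∈ G`, `t ∈ Λ`, see `mem_semidirect`. -/
def semidirect (G : Subgroup (V ≃ₗ[ℂ] V)) (Λ : AddSubgroup V) : Subgroup (V ≃ᵃ[ℂ] V) :=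
  Subgroup.closure {w : V ≃ᵃ[ℂ] V |
    (∃ g ∈ G, ∀ v, w v = g v) ∨ (∃ t ∈ Λ, ∀ v, w v = v + t)}

theorem mem_semidirect {G : Subgroup (V ≃ₗ[ℂ] V)} {Λ : AddSubgroup V}
    (h : IsInvariant G Λ) (w : V ≃ᵃ[ℂ] V) :
    w ∈ semidirect G Λ ↔ ∃ g ∈ G, ∃ t ∈ Λ, ∀ v, w v = g v + t := by
  constructor
  · intro hw
    induction hw using Subgroup.closure_induction with
    | mem x hx =>
      rcases hx with ⟨g, hg, hx⟩ | ⟨t, ht, hx⟩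
      · exact ⟨g, hg, 0, Λ.zero_mem, fun v => by rw [hx, add_zero]⟩
      · exact ⟨1, G.one_mem, t, ht, fun v => by rw [hx]; rfl⟩
    | one => exact ⟨1, G.one_mem, 0, Λ.zero_mem, fun v => by rw [add_zero]; rfl⟩
    | mul x y _ _ hx hy =>
      obtain ⟨g, hg, t, ht, hx⟩ := hx
      obtain ⟨k, hk, u, hu, hy⟩ := hy
      refine ⟨g * k, G.mul_mem hg hk, g u + t, Λ.add_mem (h g hg u hu) ht, fun v => ?_⟩
      change x (y v) = _
      rw [hy, hx, map_add, add_assoc]; rfl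
    | inv x _ hx =>
      obtain ⟨g, hg, t, ht, hx⟩ := hx
      refine ⟨g⁻¹, G.inv_mem hg, -(g⁻¹ t), Λ.neg_mem (h _ (G.inv_mem hg) t ht), fun v => ?_⟩
      apply x.injective
      have h1 : x (x⁻¹ v) = v := x.apply_symm_apply v
      have h2 : ∀ y, g (g⁻¹ y) = y := fun y => g.apply_symm_apply y
      rw [h1, hx, map_add, map_neg, h2, h2, neg_add_cancel_right]
  · rintro ⟨g, hg, t, ht, hw⟩
    have h1 : AffineEquiv.constVAdd ℂ V t ∈ semidirect G Λ :=
      Subgroup.subset_closure (Or.inr ⟨t, ht, fun v => by simp [add_comm]⟩)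
    have h2 : g.toAffineEquiv ∈ semidirect G Λ :=
      Subgroup.subset_closure (Or.inl ⟨g, hg, fun v => rfl⟩)
    have h3 : w = AffineEquiv.constVAdd ℂ V t * g.toAffineEquiv := by
      ext v
      rw [hw]
      change _ = AffineEquiv.constVAdd ℂ V t (g v)
      simp [add_comm]
    rw [h3]
    exact Subgroup.mul_mem _ h1 h2

/-- The linear group `G` acts irreducibly on `V`. -/
def ActsIrreducibly (G : Subgroup (V ≃ₗ[ℂ] V)) : Prop :=
  Nontrivial V ∧
    ∀ U : Submodule ℂ V, (∀ g ∈ G, ∀ u ∈ U, g u ∈ U) → U = ⊥ ∨ U = ⊤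

/-- `G` is the complexification of a finite Coxeter group: in a suitable basis of `V`, the
matrices of the elements of `G` are exactly the elements, viewed as complex matrices, of a finite
group `C` of real orthogonal matrices generated by reflections. (An orthogonal matrix `A` is a
reflection exactly when `A - 1` has rank one.) -/
def IsCoxeterComplexification (G : Subgroup (V ≃ₗ[ℂ] V)) : Prop :=
  ∃ (m : ℕ) (C : Subgroup (Matrix.orthogonalGroup (Fin m) ℝ)) (b : Module.Basis (Fin m) ℂ V),
    (C : Set (Matrix.orthogonalGroup (Fin m) ℝ)).Finite ∧
    Subgroup.closure {s : Matrix.orthogonalGroup (Fin m) ℝ |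
      s ∈ C ∧ ((s : Matrix (Fin m) (Fin m) ℝ) - 1).rank = 1} = C ∧
    ∀ g : V ≃ₗ[ℂ] V, g ∈ G ↔ ∃ A ∈ C,
      LinearMap.toMatrix b b (g : V →ₗ[ℂ] V) =
        (A : Matrix (Fin m) (Fin m) ℝ).map (fun x : ℝ => (x : ℂ))

end General

/-- `ℂ^n` with its standard inner product. -/
abbrev E (n : ℕ) : Type := EuclideanSpace ℂ (Fin n)

/-- The standard basis vectors of `ℂ^n` (indexed from `0`). -/
def e {n : ℕ} (i : Fin n) : E n := EuclideanSpace.single i (1 : ℂ)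

/-- The group `G(r,p,n)` (for `p ∣ r`): the monomial transformations
`e_j ↦ c_{σ(j)} e_{σ(j)}` of `ℂ^n` whose nonzero entries `c_i` are `r`-th roots of unity and
satisfy `(∏ c_i)^(r/p) = 1`. -/
def G (r p n : ℕ) : Subgroup (E n ≃ₗ[ℂ] E n) where
  carrier := {g | ∃ (σ : Equiv.Perm (Fin n)) (c : Fin n → ℂˣ),
    (∀ i, c i ^ r = 1) ∧ (∏ i, c i) ^ (r / p) = 1 ∧ ∀ v i, g v i = c i * v (σ.symm i)}
  one_mem' := ⟨1, 1, by simp, by simp, fun v i => (one_mul (v i)).symm⟩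
  mul_mem' := by
    rintro g h ⟨σ, c, hc, hc', hg⟩ ⟨τ, d, hd, hd', hh⟩
    refine ⟨σ * τ, fun i => c i * d (σ.symm i), fun i => by rw [mul_pow, hc, hd, one_mul],
      ?_, fun v i => ?_⟩
    · rw [Finset.prod_mul_distrib, Equiv.prod_comp σ.symm d, mul_pow, hc', hd', one_mul]
    · rw [LinearEquiv.mul_apply, hg, hh, Units.val_mul, mul_assoc]; rfl
  inv_mem' := by
    rintro g ⟨σ, c, hc, hc', hg⟩
    refine ⟨σ⁻¹, fun i => (c (σ i))⁻¹, fun i => by rw [inv_pow, hc, inv_one], ?_,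
      fun v i => ?_⟩
    · rw [Equiv.prod_comp σ (fun i => (c i)⁻¹), Finset.prod_inv_distrib, inv_pow, hc', inv_one]
    · have h1 : g (g⁻¹ v) = v := g.apply_symm_apply v
      have h2 := hg (g⁻¹ v) (σ i)
      rw [h1, σ.symm_apply_apply] at h2
      change (g⁻¹ v) i = ((c (σ i))⁻¹ : ℂˣ) * v (σ i)
      rw [h2, Units.inv_mul_cancel_left]

/-- The subspace of `ℂ^n` spanned by the vectors `e_i - e_j`, i.e. the vectors with coordinate
sum zero; it carries the irreducible reflection representation of the symmetric group. -/
def sumZero (n : ℕ) : Submodule ℂ (E n) where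
  carrier := {v | ∑ i, v i = 0}
  add_mem' := by
    intro a b ha hb
    simp only [Set.mem_ofPred_eq] at ha hb ⊢
    simp [Finset.sum_add_distrib, ha, hb]
  zero_mem' := by simp
  smul_mem' := by
    intro c a ha
    simp only [Set.mem_ofPred_eq] at ha ⊢
    simp [← Finset.mul_sum, ha]

/-- The Weyl group `W(A_{n-1})`: the symmetric group `𝔖_n` acting on `sumZero n` by permuting
coordinates. -/
def weylA (n : ℕ) : Subgroup (sumZero n ≃ₗ[ℂ] sumZero n) where
  carrier := {g | ∃ σ : Equiv.Perm (Fin n), ∀ v i, (g v : E n) i = (v : E n) (σ.symm i)}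
  one_mem' := ⟨1, fun v i => rfl⟩
  mul_mem' := by
    rintro g h ⟨σ, hg⟩ ⟨τ, hh⟩
    exact ⟨σ * τ, fun v i => by rw [LinearEquiv.mul_apply, hg, hh]; rfl⟩
  inv_mem' := by
    rintro g ⟨σ, hg⟩
    refine ⟨σ⁻¹, fun v i => ?_⟩
    have h1 : g (g⁻¹ v) = v := g.apply_symm_apply v
    have h2 := hg (g⁻¹ v) (σ i)
    rw [h1, σ.symm_apply_apply] at h2
    exact h2.symm

/-- The modular strip `Ω`. -/
def modularStrip : Set ℂ :=
  {z | -(1 / 2) ≤ z.re ∧ z.re < 1 / 2 ∧ (z.re ≤ 0 → 1 ≤ ‖z‖) ∧ (0 < z.re → 1 < ‖z‖)}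

/-- The additive subgroup `ℤ + ℤα` of `ℂ`. -/
def zPlus (α : ℂ) : AddSubgroup ℂ := AddSubgroup.closure {1, α}

/-- The lattice `∑_{j=2}^n (ℤ+ℤα)(e_{j-1} - e_j)` in `sumZero n`. -/
def latticeA (n : ℕ) (α : ℂ) : AddSubgroup (sumZero n) :=
  AddSubgroup.closure {v | ∃ β ∈ zPlus α, ∃ i j : Fin n,
    (j : ℕ) = i + 1 ∧ (v : E n) = β • (e i - e j)}

/-- The lattice `(ℤ+ℤα) e_1 + ∑_{j=2}^n (ℤ+ℤα)(e_{j-1} - e_j)` in `ℂ^n`. -/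
def latticeB (n : ℕ) (α : ℂ) : AddSubgroup (E n) :=
  AddSubgroup.closure
    ({v | ∃ β ∈ zPlus α, ∃ i : Fin n, (i : ℕ) = 0 ∧ v = β • e i} ∪
      {v | ∃ β ∈ zPlus α, ∃ i j : Fin n, (j : ℕ) = i + 1 ∧ v = β • (e i - e j)})

/-- The lattice `(ℤ+ℤα)(-e_1 - e_2) + ∑_{j=2}^3 (ℤ+ℤα)(e_{j-1} - e_j)` in `ℂ^3`. -/
def latticeD3 (α : ℂ) : AddSubgroup (E 3) :=
  AddSubgroup.closure
    ({v | ∃ β ∈ zPlus α, v = β • (-e 0 - e 1)} ∪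
      {v | ∃ β ∈ zPlus α, ∃ i j : Fin 3, (j : ℕ) = i + 1 ∧ v = β • (e i - e j)})

/-- `W` is, up to equivalence, one of the groups `[W(A_{n-1})]^α_1` (`n ≥ 2`),
`[G(2,1,n)]^α_1` (`n ≥ 1`), `[G(2,2,3)]^α_1`, with `α` in the modular strip. -/
def IsListed {V : Type*} [NormedAddCommGroup V] [InnerProductSpace ℂ V]
    (W : Subgroup (V ≃ᵃ[ℂ] V)) : Prop :=
  (∃ n : ℕ, 2 ≤ n ∧ ∃ α ∈ modularStrip, Equivalent W (semidirect (weylA n) (latticeA n α))) ∨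
  (∃ n : ℕ, 1 ≤ n ∧ ∃ α ∈ modularStrip, Equivalent W (semidirect (G 2 1 n) (latticeB n α))) ∨
  (∃ α ∈ modularStrip, Equivalent W (semidirect (G 2 2 3) (latticeD3 α)))

end CrystRefl

end

/-!
Write an element of `W = G ⋉ Λ` as `w v = g v + t`. It fixes `v` exactly when `v - g v = t`, and it
is an affine reflection exactly when it has a fixed point and `g` is a linear reflection. So the
Steinberg property says (`hasSteinbergProperty_iff`): if `v - g v ∈ Λ` for some `g ≠ 1` in `G`, then
`v - g v ∈ Λ` for some linear reflection `g` in `G`. Likewise, `W` being crystallographic makes `Λ`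
discrete and relatively dense and generated by translation parts of reflections
(`isReflectionLattice_of_isCrystallographic`). For a reflection `g` with `v - g v = f(v) a`, the
numbers `m` with `m a ∈ Λ` contain `f(Λ)`, so they form a lattice in `ℂ`, and such a lattice is
homothetic to `ℤ + ℤα` with `α` in the modular strip (`IsPlaneLattice.exists_modularStrip`).

**Type A.** `Λ` consists of the sum-zero vectors with coordinates in a lattice `M`, so `W` is always
listed. If a nontrivial permutation with translation part in `Λ` fixes `v` and moves `j` to `i`,
then `v_i - v_j ∈ M`, and `v` lies on a hyperplane of a transposition.

**Types B and D.** Let `M` and `L` belong to the roots `e_i ± e_j` and `e_i`. Then `2M ≤ L ≤ M`, and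
`Λ` consists of the vectors with coordinates in `M` and coordinate sum in `L` (with `L = 2M` in
type D). The case `L = M` of type B and the case `n = 3` of type D are listed and have the Steinberg
property by the argument of type A, diagonal linear parts being treated separately. Type `B_2` with
`L = 2M` becomes `L = M` after exchanging long and short roots. In all other cases some `t ∈ Λ`
supported on a set `S` of coordinates has entries there that are pairwise incongruent modulo `2M`,
and, in type B, not in `L`; the point equal to `t / 2` on `S` and generic elsewhere is fixed by a
sign change on `S` combined with a translation, but lies on no reflecting hyperplane
(`not_isSteinbergLattice`).

**Which groups occur.** A group that is real in some basis has real traces. With irreducibility this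
leaves, for `n ≥ 2`, only `G(2,1,n)`, `G(2,2,n)` with `n ≥ 3`, and the dihedral groups `G(r,r,2)`
with `r ≥ 3` (`real_cases`). A product of two reflections of `G(r,r,2)` forces `2 + 2 cos(2π/r)` to
be an integer (`dihedral_order`), so `r` is `3`, `4` or `6`. For `r = 3` and `r = 4` a change of
basis turns the group into `W(A_2)` and `G(2,1,2)`. For `r = 6`, type `G_2`, the Steinberg property
always fails, again at half a lattice vector, which is fixed by a point inversion.
-/

noncomputable section

namespace CrystRefl

/-! ### Reduction to linear data -/

section Reduction

variable {V : Type*} [NormedAddCommGroup V] [InnerProductSpace ℂ V]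
variable {V' : Type*} [NormedAddCommGroup V'] [InnerProductSpace ℂ V']

/-- A linear reflection: a non-identity linear automorphism fixing a linear hyperplane pointwise.
The hyperplane is given as the kernel of a nonzero functional. -/
def IsLinearReflection (g : V ≃ₗ[ℂ] V) : Prop :=
  g ≠ 1 ∧ ∃ f : V →ₗ[ℂ] ℂ, f ≠ 0 ∧ ∀ d, f d = 0 → g d = d

/-- Every element of the linear group `G` is an isometry. -/
def ActsIsometrically (G : Subgroup (V ≃ₗ[ℂ] V)) : Prop :=
  ∀ g ∈ G, ∀ v, ‖g v‖ = ‖v‖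

/-- The Steinberg property of `G ⋉ Λ` in terms of linear parts: a point `v` is fixed by an affine
transformation in `G ⋉ Λ` with linear part `g ∈ G` exactly when `v - g v ∈ Λ`. -/
def IsSteinbergLattice (G : Subgroup (V ≃ₗ[ℂ] V)) (Λ : AddSubgroup V) : Prop :=
  ∀ v, (∃ g ∈ G, g ≠ 1 ∧ v - g v ∈ Λ) → ∃ g ∈ G, IsLinearReflection g ∧ v - g v ∈ Λ

/-- The lattices `Λ` for which `G ⋉ Λ` is a crystallographic reflection group, in terms of linear
data: `Λ` is `G`-invariant, discrete, relatively dense, and generated as a `G`-invariant group by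
the translation parts of the affine reflections in `G ⋉ Λ`. -/
structure IsReflectionLattice (G : Subgroup (V ≃ₗ[ℂ] V)) (Λ : AddSubgroup V) : Prop where
  inv : IsInvariant G Λ
  finite : ∀ R : ℝ, {t : V | t ∈ Λ ∧ ‖t‖ ≤ R}.Finite
  dense : ∃ R : ℝ, ∀ v, ∃ t ∈ Λ, ‖v - t‖ ≤ R
  gen : ∀ N : AddSubgroup V, IsInvariant G N →
    (∀ g ∈ G, IsLinearReflection g → ∀ v, v - g v ∈ Λ → v - g v ∈ N) → Λ ≤ N

theorem IsLinearReflection.exists_sub_eq {g : V ≃ₗ[ℂ] V} (h : IsLinearReflection g) :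
    ∃ (f : V →ₗ[ℂ] ℂ) (a : V), ∀ v, v - g v = f v • a := by
  obtain ⟨-, f, hf, hd⟩ := h
  obtain ⟨x, hx⟩ : ∃ x, f x ≠ 0 := by
    by_contra! h
    exact hf (LinearMap.ext h)
  refine ⟨f, (f x)⁻¹ • (x - g x), fun v => ?_⟩
  have h1 := hd (v - (f v * (f x)⁻¹) • x) (by simp [hx])
  rw [map_sub, map_smul] at h1
  rw [sub_eq_sub_iff_sub_eq_sub, ← smul_sub] at h1
  rw [smul_smul, ← neg_sub (g v), ← neg_sub (g x), smul_neg, h1]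

section Finite

variable [FiniteDimensional ℂ V] [FiniteDimensional ℂ V']

theorem IsReflectionAbout.isLinearReflection {s : V ≃ᵃ[ℂ] V} {H : AffineSubspace ℂ V}
    (h : IsReflectionAbout s H) {g : V ≃ₗ[ℂ] V} {t : V} (hs : ∀ v, s v = g v + t) :
    IsLinearReflection g := by
  obtain ⟨h1, -, ⟨x, hx⟩, hr, hfix⟩ := h
  have hlt : H.direction < ⊤ := by
    rw [lt_top_iff_ne_top]
    intro h
    rw [h, finrank_top] at hr
    omega
  obtain ⟨f, hf, hle⟩ := Submodule.exists_le_ker_of_lt_top _ hlt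
  have hker : Module.finrank ℂ (LinearMap.ker f) + 1 = Module.finrank ℂ V := by
    rw [← LinearMap.finrank_range_add_finrank_ker f,
      LinearMap.range_eq_top.2 (LinearMap.surjective hf), finrank_top, Module.finrank_self,
      add_comm]
  have heq : H.direction = LinearMap.ker f :=
    Submodule.eq_of_le_of_finrank_eq hle (by omega)
  refine ⟨?_, f, hf, fun d hd => ?_⟩
  · rintro rfl
    apply h1
    have h2 := hfix x hx
    rw [hs] at h2
    have ht : t = 0 := by simpa using h2
    ext v
    rw [hs, ht, add_zero]
    rfl
  · have hd' : d ∈ H.direction := by rw [heq]; exact hd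
    have h2 := hfix _ (AffineSubspace.vadd_mem_of_mem_direction hd' hx)
    have h3 := hfix x hx
    rw [hs] at h2 h3
    rw [vadd_eq_add, map_add, add_assoc, h3] at h2
    exact add_right_cancel h2

theorem IsLinearReflection.isReflectionAbout {g : V ≃ₗ[ℂ] V} (h : IsLinearReflection g)
    (hg : ∀ v, ‖g v‖ = ‖v‖) {s : V ≃ᵃ[ℂ] V} {t : V} (hs : ∀ v, s v = g v + t) {v : V}
    (hv : s v = v) : ∃ H : AffineSubspace ℂ V, IsReflectionAbout s H ∧ v ∈ H := by
  obtain ⟨h1, f, hf, hd⟩ := h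
  refine ⟨AffineSubspace.mk' v (LinearMap.ker f), ⟨?_, ?_, ⟨v, AffineSubspace.self_mem_mk' _ _⟩,
    ?_, ?_⟩, AffineSubspace.self_mem_mk' _ _⟩
  · rintro rfl
    apply h1
    have h2 : t = 0 := by
      have := hs 0
      simpa using this.symm
    ext v
    have := hs v
    rw [h2, add_zero] at this
    exact this.symm
  · apply Isometry.of_dist_eq
    intro x y
    rw [hs, hs, dist_add_right, dist_eq_norm, dist_eq_norm, ← map_sub, hg]
  · rw [AffineSubspace.direction_mk', ← LinearMap.finrank_range_add_finrank_ker f,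
      LinearMap.range_eq_top.2 (LinearMap.surjective hf), finrank_top, Module.finrank_self,
      add_comm]
  · intro x hx
    have h2 := hd _ (AffineSubspace.mem_mk'.1 hx)
    rw [vsub_eq_sub, map_sub] at h2
    rw [hs] at hv ⊢
    rw [← sub_add_cancel (g x) (g v), add_assoc, hv, h2, sub_add_cancel]

theorem hasSteinbergProperty_iff {G : Subgroup (V ≃ₗ[ℂ] V)} {Λ : AddSubgroup V}
    (hG : ActsIsometrically G) (hΛ : IsInvariant G Λ) :
    HasSteinbergProperty (semidirect G Λ) ↔ IsSteinbergLattice G Λ := by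
  have key : ∀ g ∈ G, ∀ t ∈ Λ, ∃ w ∈ semidirect G Λ, ∀ v, w v = g v + t := by
    intro g hg t ht
    refine ⟨g.toAffineEquiv.trans (AffineEquiv.constVAdd ℂ V t), ?_, fun v => ?_⟩
    · rw [mem_semidirect hΛ]
      exact ⟨g, hg, t, ht, fun v => by simp [add_comm]⟩
    · simp [add_comm]
  constructor
  · rintro h v ⟨g, hg, hg1, hv⟩
    obtain ⟨w, hw, hw'⟩ := key g hg _ hv
    have hmem : v ∈ {v : V | ∃ w ∈ semidirect G Λ, w ≠ 1 ∧ w v = v} := by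
      refine ⟨w, hw, ?_, by rw [hw']; abel⟩
      rintro rfl
      apply hg1
      have h0 : v - g v = 0 := by simpa using (hw' 0).symm
      ext u
      have h2 := hw' u
      rw [h0, add_zero] at h2
      exact h2.symm
    rw [h] at hmem
    simp only [Set.mem_iUnion] at hmem
    obtain ⟨H, ⟨s, hs, hsH⟩, hvH⟩ := hmem
    obtain ⟨k, hk, t, ht, hst⟩ := (mem_semidirect hΛ s).1 hs
    refine ⟨k, hk, hsH.isLinearReflection hst, ?_⟩
    have h3 := hsH.2.2.2.2 v hvH
    rw [hst] at h3
    convert ht using 1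
    rw [sub_eq_iff_eq_add', h3]
  · intro h
    apply Set.Subset.antisymm
    · rintro v ⟨w, hw, hw1, hwv⟩
      obtain ⟨g, hg, t, ht, hwt⟩ := (mem_semidirect hΛ w).1 hw
      have hgt : v - g v = t := by
        rw [sub_eq_iff_eq_add', ← hwt, hwv]
      obtain ⟨k, hk, hkr, hkv⟩ := h v ⟨g, hg, by
        rintro rfl
        apply hw1
        have h0 : t = 0 := by rw [← hgt]; exact sub_self v
        ext u
        rw [hwt, h0, add_zero]
        rfl, by rwa [hgt]⟩
      obtain ⟨s, hs, hs'⟩ := key k hk _ hkv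
      obtain ⟨H, hH, hvH⟩ := hkr.isReflectionAbout (hG k hk) hs'
        (show s v = v by rw [hs']; abel)
      simp only [Set.mem_iUnion]
      exact ⟨H, ⟨s, hs, hH⟩, hvH⟩
    · intro v hv
      simp only [Set.mem_iUnion] at hv
      obtain ⟨H, ⟨s, hs, hsH⟩, hvH⟩ := hv
      exact ⟨s, hs, hsH.1, hsH.2.2.2.2 v hvH⟩

theorem isReflectionLattice_of_isCrystallographic {G : Subgroup (V ≃ₗ[ℂ] V)} {Λ : AddSubgroup V}
    (hG : ActsIsometrically G) (hΛ : IsInvariant G Λ) (h : IsCrystallographic (semidirect G Λ)) :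
    IsReflectionLattice G Λ := by
  obtain ⟨⟨hgen, hdisc⟩, hcomp⟩ := h
  refine ⟨hΛ, fun R => ?_, ?_, fun N hN hN' t ht => ?_⟩
  · have hfin := hdisc (Metric.closedBall 0 R)
      (by have := FiniteDimensional.proper ℂ V; exact isCompact_closedBall 0 R)
    refine (hfin.preimage (f := fun t : V => AffineEquiv.constVAdd ℂ V t) ?_).subset ?_
    · intro a _ b _ hab
      have := congrArg (fun w : V ≃ᵃ[ℂ] V => w 0) hab
      simpa using this
    · rintro t ⟨ht, htR⟩
      have hR : 0 ≤ R := (norm_nonneg t).trans htR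
      refine ⟨?_, t, ⟨0, by simpa using hR, by simp⟩, by simpa using htR⟩
      rw [mem_semidirect hΛ]
      exact ⟨1, G.one_mem, t, ht, fun v => by simp [add_comm]⟩
  · -- The images of the balls around `0` form an increasing open cover of the orbit space.
    let U : ℕ → Set (Quotient (orbitSetoid (semidirect G Λ))) :=
      fun n => Quotient.mk _ '' Metric.ball 0 n
    have hopen : ∀ n, IsOpen (U n) := by
      intro n
      change IsOpen (Quotient.mk _ ⁻¹' (U n))
      have heq : Quotient.mk (orbitSetoid (semidirect G Λ)) ⁻¹' (U n) =
          ⋃ w ∈ semidirect G Λ, (w : V → V) ⁻¹' Metric.ball 0 n := by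
        ext v
        simp only [Set.mem_preimage, Set.mem_iUnion, U, Set.mem_image]
        constructor
        · rintro ⟨x, hx, hxv⟩
          obtain ⟨w, hw, hwx⟩ := Quotient.exact hxv.symm
          exact ⟨w, hw, by rw [hwx]; exact hx⟩
        · rintro ⟨w, hw, hwv⟩
          exact ⟨w v, hwv, Quotient.sound ((orbitSetoid (semidirect G Λ)).symm ⟨w, hw, rfl⟩)⟩
      rw [heq]
      refine isOpen_biUnion fun w hw => Metric.isOpen_ball.preimage ?_
      exact AffineMap.continuous_of_finiteDimensional (w : V →ᵃ[ℂ] V)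
    have hcov : (Set.univ : Set (Quotient (orbitSetoid (semidirect G Λ)))) ⊆ ⋃ n, U n := by
      intro q _
      induction q using Quotient.inductionOn with
      | h v =>
        obtain ⟨n, hn⟩ := exists_nat_gt ‖v‖
        exact Set.mem_iUnion.2 ⟨n, v, by simpa using hn, rfl⟩
    obtain ⟨n, hn⟩ := isCompact_univ.elim_directed_cover U hopen hcov
      (directed_of_isDirected_le fun a b hab => Set.image_mono
        (Metric.ball_subset_ball (by exact_mod_cast hab)))
    refine ⟨n, fun v => ?_⟩
    obtain ⟨x, hx, hxv⟩ := hn (Set.mem_univ (Quotient.mk _ v))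
    obtain ⟨w, hw, hwx⟩ := Quotient.exact hxv.symm
    obtain ⟨g, hg, t, ht, hwt⟩ := (mem_semidirect hΛ w).1 hw
    refine ⟨-(g⁻¹ t), Λ.neg_mem (hΛ _ (G.inv_mem hg) t ht), ?_⟩
    have h2 : g (g⁻¹ t) = t := g.apply_symm_apply t
    rw [sub_neg_eq_add, ← hG g hg, map_add, h2, ← hwt, hwx]
    exact (mem_ball_zero_iff.1 hx).le
  · have hmem : ∀ w ∈ semidirect G Λ, w 0 ∈ N := by
      intro w hw
      rw [← hgen] at hw
      suffices h : w ∈ semidirect G Λ ∧ w 0 ∈ N from h.2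
      induction hw using Subgroup.closure_induction with
      | mem s hs =>
        refine ⟨hs.1, ?_⟩
        obtain ⟨hs, H, hH⟩ := hs
        obtain ⟨g, hg, u, hu, hst⟩ := (mem_semidirect hΛ s).1 hs
        obtain ⟨x, hx⟩ := hH.2.2.1
        have h3 := hH.2.2.2.2 x hx
        rw [hst] at h3
        have h4 : x - g x = u := by rw [sub_eq_iff_eq_add', h3]
        rw [hst, map_zero, zero_add, ← h4]
        exact hN' g hg (hH.isLinearReflection hst) x (by rwa [h4])
      | one => exact ⟨one_mem _, N.zero_mem⟩
      | mul x y _ _ hx hy =>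
        refine ⟨mul_mem hx.1 hy.1, ?_⟩
        obtain ⟨g, hg, u, hu, hst⟩ := (mem_semidirect hΛ x).1 hx.1
        have h0 : x 0 = u := by rw [hst, map_zero, zero_add]
        change x (y 0) ∈ N
        rw [hst, ← h0]
        exact N.add_mem (hN g hg _ hy.2) hx.2
      | inv x _ hx =>
        refine ⟨inv_mem hx.1, ?_⟩
        obtain ⟨g, hg, u, hu, hst⟩ := (mem_semidirect hΛ x).1 hx.1
        have h0 : x 0 = u := by rw [hst, map_zero, zero_add]
        have h1 : x⁻¹ 0 = -(g⁻¹ u) := by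
          apply x.injective
          have h1 : x (x⁻¹ 0) = 0 := x.apply_symm_apply 0
          have h2 : g (g⁻¹ u) = u := g.apply_symm_apply u
          rw [h1, hst, map_neg, h2, neg_add_cancel]
        rw [h1, ← h0]
        exact N.neg_mem (hN _ (G.inv_mem hg) _ hx.2)
    have := hmem (AffineEquiv.constVAdd ℂ V t) (by
      rw [mem_semidirect hΛ]
      exact ⟨1, G.one_mem, t, ht, fun v => by simp [add_comm]⟩)
    simpa using this

end Finite

/-- The Steinberg property is an affine invariant within groups of isometries. -/
theorem HasSteinbergProperty.of_equivalent {W : Subgroup (V ≃ᵃ[ℂ] V)}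
    {W' : Subgroup (V' ≃ᵃ[ℂ] V')} (h : Equivalent W W') (hW : ∀ w ∈ W, Isometry w)
    (h' : HasSteinbergProperty W') : HasSteinbergProperty W := by
  obtain ⟨f, hf⟩ := h
  apply Set.Subset.antisymm
  · rintro v ⟨w, hw, hw1, hwv⟩
    have hmem : f v ∈ {v : V' | ∃ w ∈ W', w ≠ 1 ∧ w v = v} := by
      refine ⟨_, (hf w).1 hw, fun h1 => hw1 ?_, by simp [hwv]⟩
      ext u
      have := congrArg (fun w : V' ≃ᵃ[ℂ] V' => w (f u)) h1
      simpa using this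
    rw [h'] at hmem
    simp only [Set.mem_iUnion] at hmem ⊢
    obtain ⟨H, ⟨s, hs, hs1, -, hne, hr, hfix⟩, hvH⟩ := hmem
    have hs' : (f.trans s).trans f.symm ∈ W := by
      rw [hf]
      convert hs using 1
      ext u
      simp
    refine ⟨H.comap (f : V →ᵃ[ℂ] V'), ⟨_, hs', fun h1 => hs1 ?_, hW _ hs', ⟨v, hvH⟩, ?_, ?_⟩, hvH⟩
    · ext u
      have := congrArg (fun w : V ≃ᵃ[ℂ] V => f (w (f.symm u))) h1
      simpa using this
    · have h1 : H.comap (f : V →ᵃ[ℂ] V') = H.map (f.symm : V' →ᵃ[ℂ] V) :=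
        (AffineSubspace.comap_symm f.symm H)
      rw [h1, AffineSubspace.map_direction, f.linear.finrank_eq, ← hr]
      congr 1
      exact LinearEquiv.finrank_map_eq f.symm.linear _
    · intro x hx
      have h2 := hfix (f x) hx
      simp [h2]
  · intro v hv
    simp only [Set.mem_iUnion] at hv
    obtain ⟨H, ⟨s, hs, hsH⟩, hvH⟩ := hv
    exact ⟨s, hs, hsH.1, hsH.2.2.2.2 v hvH⟩

theorem ActsIsometrically.isometry_of_mem {G : Subgroup (V ≃ₗ[ℂ] V)} {Λ : AddSubgroup V}
    (hG : ActsIsometrically G) (hΛ : IsInvariant G Λ) {w : V ≃ᵃ[ℂ] V}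
    (hw : w ∈ semidirect G Λ) : Isometry w := by
  obtain ⟨g, hg, t, -, hwt⟩ := (mem_semidirect hΛ w).1 hw
  apply Isometry.of_dist_eq
  intro x y
  rw [hwt, hwt, dist_add_right, dist_eq_norm, dist_eq_norm, ← map_sub, hG g hg]

theorem equivalent_semidirect {G : Subgroup (V ≃ₗ[ℂ] V)} {Λ : AddSubgroup V}
    {G' : Subgroup (V' ≃ₗ[ℂ] V')} {Λ' : AddSubgroup V'} (hΛ : IsInvariant G Λ)
    (hΛ' : IsInvariant G' Λ') (φ : V ≃ₗ[ℂ] V')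
    (hG : ∀ g, g ∈ G ↔ (φ.symm.trans g).trans φ ∈ G') (hφ : ∀ t, t ∈ Λ ↔ φ t ∈ Λ') :
    Equivalent (semidirect G Λ) (semidirect G' Λ') := by
  refine ⟨φ.toAffineEquiv, fun w => ?_⟩
  rw [mem_semidirect hΛ, mem_semidirect hΛ']
  constructor
  · rintro ⟨g, hg, t, ht, hw⟩
    refine ⟨_, (hG g).1 hg, φ t, (hφ t).1 ht, fun v => ?_⟩
    change φ (w (φ.symm v)) = φ (g (φ.symm v)) + φ t
    rw [hw, map_add]
  · rintro ⟨g, hg, t, ht, hw⟩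
    have h1 : (φ.symm.trans ((φ.trans g).trans φ.symm)).trans φ = g := by
      ext v
      simp
    refine ⟨(φ.trans g).trans φ.symm, (hG _).2 (by rwa [h1]), φ.symm t,
      (hφ _).2 (by simpa using ht), fun v => ?_⟩
    apply φ.injective
    have h2 : φ (w (φ.symm (φ v))) = _ := hw (φ v)
    rw [φ.symm_apply_apply] at h2
    rw [h2]
    simp

/-- A group `G ⋉ Λ` only changes by a homothety when the lattice `Λ` is rescaled. -/
theorem equivalent_smul {G : Subgroup (V ≃ₗ[ℂ] V)} {Λ Λ' : AddSubgroup V} (hΛ : IsInvariant G Λ)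
    (hΛ' : IsInvariant G Λ') {ω : ℂ} (hω : ω ≠ 0) (h : ∀ t, t ∈ Λ ↔ ω⁻¹ • t ∈ Λ') :
    Equivalent (semidirect G Λ) (semidirect G Λ') := by
  let φ : V ≃ₗ[ℂ] V := LinearEquiv.smulOfNeZero ℂ V ω⁻¹ (inv_ne_zero hω)
  refine equivalent_semidirect hΛ hΛ' φ (fun g => ?_) h
  have h1 : (φ.symm.trans g).trans φ = g := by
    ext v
    have h2 : ω⁻¹ • φ.symm v = v := φ.apply_symm_apply v
    change ω⁻¹ • g (φ.symm v) = g v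
    rw [← map_smul, h2]
  rw [h1]

section Transfer

theorem IsLinearReflection.conj {g : V ≃ₗ[ℂ] V} (h : IsLinearReflection g) (φ : V ≃ₗ[ℂ] V') :
    IsLinearReflection ((φ.symm.trans g).trans φ) := by
  obtain ⟨h1, f, hf, hd⟩ := h
  refine ⟨fun h2 => h1 ?_, f ∘ₗ φ.symm.toLinearMap, fun h2 => hf ?_, fun d hd' => ?_⟩
  · ext v
    have := congrArg (fun k : V' ≃ₗ[ℂ] V' => φ.symm (k (φ v))) h2
    simpa using this
  · ext v
    simpa using LinearMap.congr_fun h2 (φ v)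
  · have h2 : g (φ.symm d) = φ.symm d := hd _ hd'
    simp [h2]

variable {G : Subgroup (V ≃ₗ[ℂ] V)} {Λ : AddSubgroup V} {G' : Subgroup (V' ≃ₗ[ℂ] V')}
  {Λ' : AddSubgroup V'}

theorem IsInvariant.transfer (h : IsInvariant G Λ) (φ : V ≃ₗ[ℂ] V')
    (hG : ∀ g, g ∈ G ↔ (φ.symm.trans g).trans φ ∈ G') (hφ : ∀ t, t ∈ Λ ↔ φ t ∈ Λ') :
    IsInvariant G' Λ' := by
  intro g hg t ht
  have h1 : (φ.symm.trans ((φ.trans g).trans φ.symm)).trans φ = g := by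
    ext v
    simp
  have h2 := h ((φ.trans g).trans φ.symm) ((hG _).2 (by rwa [h1])) (φ.symm t)
    ((hφ _).2 (by simpa using ht))
  simpa [hφ] using h2

theorem IsReflectionLattice.transfer [FiniteDimensional ℂ V] [FiniteDimensional ℂ V']
    (h : IsReflectionLattice G Λ) (φ : V ≃ₗ[ℂ] V')
    (hG : ∀ g, g ∈ G ↔ (φ.symm.trans g).trans φ ∈ G') (hφ : ∀ t, t ∈ Λ ↔ φ t ∈ Λ') :
    IsReflectionLattice G' Λ' := by
  refine ⟨h.inv.transfer φ hG hφ, fun R => ?_, ?_, fun N hN hN' => ?_⟩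
  · have hC := (LinearMap.toContinuousLinearMap φ.symm.toLinearMap).le_opNorm
    set C := ‖LinearMap.toContinuousLinearMap φ.symm.toLinearMap‖
    refine ((h.finite (C * R)).image φ).subset ?_
    rintro t ⟨ht, htR⟩
    refine ⟨φ.symm t, ⟨(hφ _).2 (by simpa using ht), (hC t).trans ?_⟩, by simp⟩
    exact mul_le_mul_of_nonneg_left htR (norm_nonneg _)
  · obtain ⟨R, hR⟩ := h.dense
    have hC := (LinearMap.toContinuousLinearMap φ.toLinearMap).le_opNorm
    set C := ‖LinearMap.toContinuousLinearMap φ.toLinearMap‖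
    refine ⟨C * R, fun v => ?_⟩
    obtain ⟨t, ht, htR⟩ := hR (φ.symm v)
    refine ⟨φ t, (hφ t).1 ht, ?_⟩
    have h1 : v - φ t = φ (φ.symm v - t) := by simp
    rw [h1]
    exact (hC _).trans (mul_le_mul_of_nonneg_left htR (norm_nonneg _))
  · have h1 := h.gen (N.comap φ.toLinearMap.toAddMonoidHom) (fun g hg t ht => ?_)
      (fun g hg hgr v hv => ?_)
    · intro t ht
      have := h1 ((hφ (φ.symm t)).2 (by simpa using ht))
      simpa using this
    · have := hN _ ((hG g).1 hg) (φ t) ht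
      simpa using this
    · have := hN' _ ((hG g).1 hg) (hgr.conj φ) (φ v) (by simpa [hφ] using hv)
      simpa using this

theorem IsSteinbergLattice.transfer (h : IsSteinbergLattice G Λ) (φ : V ≃ₗ[ℂ] V')
    (hG : ∀ g, g ∈ G ↔ (φ.symm.trans g).trans φ ∈ G') (hφ : ∀ t, t ∈ Λ ↔ φ t ∈ Λ') :
    IsSteinbergLattice G' Λ' := by
  rintro v ⟨g, hg, hg1, hv⟩
  have h1 : (φ.symm.trans ((φ.trans g).trans φ.symm)).trans φ = g := by
    ext v
    simp
  obtain ⟨k, hk, hkr, hkv⟩ := h (φ.symm v) ⟨(φ.trans g).trans φ.symm, (hG _).2 (by rwa [h1]),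
    fun h2 => hg1 (by rw [← h1, h2]; ext v; simp), by simpa [hφ] using hv⟩
  exact ⟨_, (hG k).1 hk, hkr.conj φ, by simpa [hφ] using hkv⟩

theorem Equivalent.trans {V'' : Type*} [NormedAddCommGroup V''] [InnerProductSpace ℂ V'']
    {W : Subgroup (V ≃ᵃ[ℂ] V)} {W' : Subgroup (V' ≃ᵃ[ℂ] V')} {W'' : Subgroup (V'' ≃ᵃ[ℂ] V'')}
    (h : Equivalent W W') (h' : Equivalent W' W'') : Equivalent W W'' := by
  obtain ⟨f, hf⟩ := h
  obtain ⟨f', hf'⟩ := h'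
  exact ⟨f.trans f', fun w => (hf w).trans (hf' _)⟩

theorem IsListed.of_equivalent {W : Subgroup (V ≃ᵃ[ℂ] V)} {W' : Subgroup (V' ≃ᵃ[ℂ] V')}
    (h : Equivalent W W') (h' : IsListed W') : IsListed W := by
  obtain ⟨n, hn, α, hα, h'⟩ | ⟨n, hn, α, hα, h'⟩ | ⟨α, hα, h'⟩ := h'
  · exact Or.inl ⟨n, hn, α, hα, h.trans h'⟩
  · exact Or.inr (Or.inl ⟨n, hn, α, hα, h.trans h'⟩)
  · exact Or.inr (Or.inr ⟨α, hα, h.trans h'⟩)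

end Transfer

end Reduction

/-! ### Lattices in the complex plane -/

/-- A discrete and relatively dense subgroup of the complex plane. -/
def IsPlaneLattice (M : AddSubgroup ℂ) : Prop :=
  (∀ R : ℝ, {m : ℂ | m ∈ M ∧ ‖m‖ ≤ R}.Finite) ∧ ∃ R : ℝ, ∀ z, ∃ m ∈ M, ‖z - m‖ ≤ R

theorem mem_zPlus {α z : ℂ} : z ∈ zPlus α ↔ ∃ a b : ℤ, z = a + b * α := by
  rw [zPlus, AddSubgroup.mem_closure_pair]
  simp only [zsmul_eq_mul, mul_one, eq_comm]

theorem im_ne_zero_of_mem_modularStrip {α : ℂ} (h : α ∈ modularStrip) : α.im ≠ 0 := by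
  obtain ⟨h1, h2, h3, h4⟩ := h
  intro h0
  have hn : |α.re| = ‖α‖ := Complex.abs_re_eq_norm.2 h0
  have : |α.re| ≤ 1 / 2 := abs_le.2 ⟨h1, h2.le⟩
  rcases le_or_gt α.re 0 with h | h
  · linarith [h3 h]
  · linarith [h4 h]

/-- The coordinates of a point of `ℝ + ℝα` are unique when `α` is not real. -/
theorem int_coords_of_mem_zPlus {α : ℂ} (hα : α.im ≠ 0) {x y : ℝ} (h : (x + y * α : ℂ) ∈ zPlus α) :
    ∃ a b : ℤ, x = a ∧ y = b := by
  obtain ⟨a, b, hab⟩ := mem_zPlus.1 h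
  have h1 := congrArg Complex.im hab
  simp at h1
  obtain h1 | h1 := h1
  · have h2 := congrArg Complex.re hab
    simp [h1] at h2
    exact ⟨a, b, h2, h1⟩
  · exact absurd h1 hα

theorem IsPlaneLattice.exists_min {M : AddSubgroup ℂ} (h : IsPlaneLattice M) (P : ℂ → Prop)
    (hP : ∃ m ∈ M, P m) : ∃ m ∈ M, P m ∧ ∀ k ∈ M, P k → ‖m‖ ≤ ‖k‖ := by
  obtain ⟨m0, hm0, hP0⟩ := hP
  obtain ⟨m, ⟨⟨hm, hmn⟩, hmP⟩, hmin⟩ :=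
    Set.exists_min_image ({m : ℂ | m ∈ M ∧ ‖m‖ ≤ ‖m0‖} ∩ {m | P m}) (fun m => ‖m‖)
      ((h.1 _).inter_of_left _) ⟨m0, ⟨hm0, le_rfl⟩, hP0⟩
  refine ⟨m, hm, hmP, fun k hk hkP => ?_⟩
  rcases le_total ‖k‖ ‖m0‖ with h1 | h1
  · exact hmin k ⟨⟨hk, h1⟩, hkP⟩
  · exact hmn.trans h1

/-- If `1` is a shortest nonzero vector of `M` and `β` a shortest vector of `M` off the real axis,
then `M = ℤ + ℤβ`. -/
theorem eq_zPlus_of_shortest {M : AddSubgroup ℂ} (h1 : (1 : ℂ) ∈ M)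
    (hmin : ∀ m ∈ M, m ≠ 0 → 1 ≤ ‖m‖) {β : ℂ} (hβ : β ∈ M) (hβ0 : β.im ≠ 0)
    (hβmin : ∀ m ∈ M, m.im ≠ 0 → ‖β‖ ≤ ‖m‖) :
    1 ≤ Complex.normSq β ∧ |β.re| ≤ 1 / 2 ∧ M = zPlus β := by
  have hsq : ∀ m ∈ M, m.im ≠ 0 → Complex.normSq β ≤ Complex.normSq m := by
    intro m hm hm0
    rw [Complex.normSq_eq_norm_sq, Complex.normSq_eq_norm_sq]
    exact pow_le_pow_left₀ (norm_nonneg _) (hβmin m hm hm0) 2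
  have hβ1 : 1 ≤ Complex.normSq β := by
    rw [Complex.normSq_eq_norm_sq]
    exact one_le_pow₀ (hmin β hβ fun h => hβ0 (by simp [h]))
  have hre : |β.re| ≤ 1 / 2 := by
    have e1 := hsq (β + 1) (M.add_mem hβ h1) (by simpa using hβ0)
    have e2 := hsq (β - 1) (M.sub_mem hβ h1) (by simpa using hβ0)
    simp only [Complex.normSq_apply, Complex.add_re, Complex.add_im, Complex.sub_re,
      Complex.sub_im, Complex.one_re, Complex.one_im] at e1 e2
    rw [abs_le]
    constructor <;> nlinarith
  refine ⟨hβ1, hre, le_antisymm (fun z hz => ?_) ?_⟩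
  · have hint : ∀ a b : ℤ, (a + b * β : ℂ) ∈ M := by
      intro a b
      have := M.add_mem (M.zsmul_mem h1 a) (M.zsmul_mem hβ b)
      simpa using this
    obtain ⟨y, hy⟩ : ∃ y : ℝ, z.im = y * β.im := ⟨z.im / β.im, by field_simp⟩
    obtain ⟨x, hx⟩ : ∃ x : ℝ, z.re = x + y * β.re := ⟨z.re - y * β.re, by ring⟩
    have hr1 := abs_le.1 (abs_sub_round x)
    have hr2 := abs_le.1 (abs_sub_round y)
    have hw := M.sub_mem hz (hint (round x) (round y))
    set w := z - ((round x : ℤ) + (round y : ℤ) * β : ℂ) with hwdef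
    have hwre : w.re = (x - round x) + (y - round y) * β.re := by
      simp [hwdef, hx]; ring
    have hwim : w.im = (y - round y) * β.im := by
      simp [hwdef, hy]; ring
    set p := x - round x
    set q := y - round y
    obtain ⟨hb1, hb2⟩ := abs_le.1 hre
    have hw0 : w.im = 0 := by
      by_contra hne
      have h2 := hsq w hw hne
      rw [Complex.normSq_apply] at h2 hβ1
      rw [Complex.normSq_apply, hwre, hwim] at h2
      -- `|p + qβ|² ≤ 1/4 + 1/4 + |β|²/4 < |β|²` when `|p|, |q|, |Re β| ≤ 1/2` and `|β| ≥ 1`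
      have hpq : |p * q * β.re| ≤ 1 / 8 := by
        rw [abs_mul, abs_mul]
        have a1 : |p| ≤ 1 / 2 := abs_le.2 hr1
        have a2 : |q| ≤ 1 / 2 := abs_le.2 hr2
        calc |p| * |q| * |β.re| ≤ 1 / 2 * (1 / 2) * (1 / 2) := by gcongr
          _ = 1 / 8 := by norm_num
      have hp2 : p * p ≤ 1 / 4 := by nlinarith
      have hq2 : q * q ≤ 1 / 4 := by nlinarith
      have h3 := (abs_le.1 hpq).2
      nlinarith
    have hq0 : q = 0 := by
      rw [hwim] at hw0
      exact (mul_eq_zero.1 hw0).resolve_right hβ0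
    have hwz : w = 0 := by
      by_contra hne
      have h2 := hmin w hw hne
      rw [← Complex.abs_re_eq_norm.2 hw0, hwre, hq0, zero_mul, add_zero] at h2
      have : |p| ≤ 1 / 2 := abs_le.2 hr1
      linarith
    exact mem_zPlus.2 ⟨round x, round y, sub_eq_zero.1 hwz⟩
  · intro z hz
    obtain ⟨a, b, rfl⟩ := mem_zPlus.1 hz
    have := M.add_mem (M.zsmul_mem h1 a) (M.zsmul_mem hβ b)
    simpa using this

/-- A reduced basis `1, β` can be replaced by one with second vector in the modular strip. -/
theorem exists_modularStrip_of_reduced {β : ℂ} (hβ0 : β.im ≠ 0) (h1 : 1 ≤ Complex.normSq β)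
    (hre : |β.re| ≤ 1 / 2) :
    ∃ ω : ℂ, ω ≠ 0 ∧ ∃ α ∈ modularStrip, ∀ z, z ∈ zPlus β ↔ ω⁻¹ * z ∈ zPlus α := by
  obtain ⟨hb1, hb2⟩ := abs_le.1 hre
  have hn : ∀ z : ℂ, 1 ≤ ‖z‖ ↔ 1 ≤ Complex.normSq z := fun z => by
    rw [Complex.normSq_eq_norm_sq, one_le_sq_iff₀ (norm_nonneg _)]
  have hn' : ∀ z : ℂ, 1 < ‖z‖ ↔ 1 < Complex.normSq z := fun z => by
    rw [Complex.normSq_eq_norm_sq, one_lt_sq_iff₀ (norm_nonneg _)]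
  have hβ : β ≠ 0 := fun h => hβ0 (by simp [h])
  rcases hb2.lt_or_eq with hlt | heq
  · by_cases hc : Complex.normSq β = 1 ∧ 0 < β.re
    · refine ⟨β, hβ, -β⁻¹, ⟨?_, ?_, ?_, ?_⟩, fun z => ?_⟩
      · simp [hc.1]; linarith
      · simp [hc.1]; linarith
      · intro _
        rw [hn]; simp [hc.1]
      · simp [hc.1]; intro h; linarith [hc.2]
      · rw [mem_zPlus, mem_zPlus]
        constructor
        · rintro ⟨a, b, rfl⟩
          exact ⟨b, -a, by push_cast; field_simp; ring⟩
        · rintro ⟨a, b, hab⟩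
          refine ⟨-b, a, ?_⟩
          rw [inv_mul_eq_iff_eq_mul₀ hβ] at hab
          rw [hab]; push_cast; field_simp; ring
    · refine ⟨1, one_ne_zero, β, ⟨by linarith, hlt, fun _ => (hn β).2 h1, fun h => ?_⟩,
        fun z => by simp⟩
      rw [hn']
      exact lt_of_le_of_ne h1 fun h2 => hc ⟨h2.symm, h⟩
  · refine ⟨1, one_ne_zero, β - 1, ⟨?_, ?_, fun _ => ?_, fun h => ?_⟩, fun z => ?_⟩
    · simp [heq]; norm_num
    · simp [heq]
    · rw [hn]
      rw [Complex.normSq_apply, heq] at h1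
      simp [Complex.normSq_apply, heq]
      norm_num at h1 ⊢
      linarith
    · simp [heq] at h; norm_num at h
    · rw [mem_zPlus, mem_zPlus, inv_one, one_mul]
      constructor
      · rintro ⟨a, b, rfl⟩
        exact ⟨a + b, b, by push_cast; ring⟩
      · rintro ⟨a, b, rfl⟩
        exact ⟨a - b, b, by push_cast; ring⟩

/-- Every lattice in the complex plane is homothetic to `ℤ + ℤα` for some `α` in the modular
strip. -/
theorem IsPlaneLattice.exists_modularStrip {M : AddSubgroup ℂ} (h : IsPlaneLattice M) :
    ∃ ω : ℂ, ω ≠ 0 ∧ ∃ α ∈ modularStrip, ∀ z, z ∈ M ↔ ω⁻¹ * z ∈ zPlus α := by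
  obtain ⟨R, hR⟩ := h.2
  have hR0 : 0 ≤ R := by
    obtain ⟨m, -, hm⟩ := hR 0
    exact (norm_nonneg _).trans hm
  obtain ⟨ω, hω, hω0, hωmin⟩ := h.exists_min (fun m => m ≠ 0) (by
    obtain ⟨m, hm, hmR⟩ := hR ((R + 1 : ℝ) : ℂ)
    refine ⟨m, hm, ?_⟩
    rintro rfl
    rw [sub_zero, Complex.norm_real, Real.norm_of_nonneg (by linarith)] at hmR
    linarith)
  have hωn : 0 < ‖ω‖ := norm_pos_iff.2 hω0
  obtain ⟨β', hβ', hβ0, hβmin⟩ := h.exists_min (fun m => (ω⁻¹ * m).im ≠ 0) (by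
    obtain ⟨m, hm, hmR⟩ := hR (ω * (((R + 1) / ‖ω‖ : ℝ) * Complex.I))
    refine ⟨m, hm, fun h0 => ?_⟩
    have h1 : ω * (((R + 1) / ‖ω‖ : ℝ) * Complex.I) - m =
        ω * ((((R + 1) / ‖ω‖ : ℝ) * Complex.I) - ω⁻¹ * m) := by
      field_simp
    rw [h1, norm_mul] at hmR
    have h2 := Complex.abs_im_le_norm ((((R + 1) / ‖ω‖ : ℝ) * Complex.I) - ω⁻¹ * m)
    have h3 : ((((R + 1) / ‖ω‖ : ℝ) * Complex.I) - ω⁻¹ * m).im = (R + 1) / ‖ω‖ := by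
      rw [Complex.sub_im, h0, sub_zero, Complex.im_ofReal_mul, Complex.I_im, mul_one]
    rw [h3, abs_of_nonneg (by positivity)] at h2
    have h4 := mul_le_mul_of_nonneg_left h2 hωn.le
    rw [mul_div_cancel₀ _ hωn.ne'] at h4
    linarith)
  let M' : AddSubgroup ℂ := M.comap (AddMonoidHom.mulLeft ω)
  have hM' : ∀ z, z ∈ M' ↔ ω * z ∈ M := fun z => Iff.rfl
  have hc : ∀ z, ω⁻¹ * (ω * z) = z := fun z => by field_simp
  have hc' : ∀ z, ω * (ω⁻¹ * z) = z := fun z => by field_simp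
  have hle : ∀ x y, ‖ω * x‖ ≤ ‖ω * y‖ → ‖x‖ ≤ ‖y‖ := fun x y hxy => by
    rw [norm_mul, norm_mul] at hxy
    exact le_of_mul_le_mul_left hxy hωn
  obtain ⟨h1, h2, h3⟩ := eq_zPlus_of_shortest (M := M') (β := ω⁻¹ * β')
    (by rw [hM', mul_one]; exact hω)
    (fun m hm hm0 => by
      have := hle 1 m (by rw [mul_one]; exact hωmin _ hm (mul_ne_zero hω0 hm0))
      simpa using this)
    (by rw [hM', hc']; exact hβ') hβ0
    (fun m hm hm0 => hle _ _ (by rw [hc']; exact hβmin _ hm (by rwa [hc])))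
  obtain ⟨ω', hω', α, hα, hz⟩ := exists_modularStrip_of_reduced hβ0 h1 h2
  refine ⟨ω * ω', mul_ne_zero hω0 hω', α, hα, fun z => ?_⟩
  rw [← hc' z, ← hM', h3, hz, mul_inv_rev, hc', mul_assoc]

section Coeff

variable {V : Type*} [NormedAddCommGroup V] [InnerProductSpace ℂ V]

/-- The complex numbers `m` with `m • a ∈ Λ`. -/
def coeff (Λ : AddSubgroup V) (a : V) : AddSubgroup ℂ :=
  Λ.comap (LinearMap.toSpanSingleton ℂ V a).toAddMonoidHom

theorem mem_coeff {Λ : AddSubgroup V} {a : V} {m : ℂ} : m ∈ coeff Λ a ↔ m • a ∈ Λ := Iff.rfl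

/-- If `1 - g` has rank one with image `ℂ a`, then `Λ ∩ ℂ a` is a lattice in the line `ℂ a`: it
contains the image of `Λ` under `1 - g`. -/
theorem IsReflectionLattice.isPlaneLattice_coeff [FiniteDimensional ℂ V]
    {G : Subgroup (V ≃ₗ[ℂ] V)} {Λ : AddSubgroup V} (h : IsReflectionLattice G Λ) {g : V ≃ₗ[ℂ] V}
    (hg : g ∈ G) {a : V} (ha : a ≠ 0) {f : V →ₗ[ℂ] ℂ} (hf : f ≠ 0)
    (hgf : ∀ v, v - g v = f v • a) : IsPlaneLattice (coeff Λ a) := by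
  constructor
  · intro R
    refine ((h.finite (R * ‖a‖)).preimage (f := fun m : ℂ => m • a) ?_).subset ?_
    · intro x _ y _ hxy
      exact smul_left_injective ℂ ha hxy
    · rintro m ⟨hm, hmR⟩
      refine ⟨hm, ?_⟩
      rw [norm_smul]
      exact mul_le_mul_of_nonneg_right hmR (norm_nonneg _)
  · obtain ⟨R, hR⟩ := h.dense
    have hC := (LinearMap.toContinuousLinearMap f).le_opNorm
    set C := ‖LinearMap.toContinuousLinearMap f‖
    refine ⟨C * R, fun z => ?_⟩
    obtain ⟨v, rfl⟩ := LinearMap.surjective hf z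
    obtain ⟨t, ht, htR⟩ := hR v
    refine ⟨f t, ?_, ?_⟩
    · rw [mem_coeff, ← hgf]
      exact Λ.sub_mem ht (h.inv g hg t ht)
    · rw [← map_sub]
      exact (hC _).trans (mul_le_mul_of_nonneg_left htR (norm_nonneg _))

end Coeff

/-! ### Monomial and permutation reflections -/

section Monomial

variable {n : ℕ}

/-- The monomial transformation `e_j ↦ c_{σ(j)} e_{σ(j)}` of `ℂ^n`. -/
def monomial (σ : Equiv.Perm (Fin n)) (c : Fin n → ℂˣ) : E n ≃ₗ[ℂ] E n where
  toFun v := WithLp.toLp 2 fun i => c i * v (σ.symm i)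
  invFun v := WithLp.toLp 2 fun i => ((c (σ i))⁻¹ : ℂˣ) * v (σ i)
  map_add' u v := by ext i; simp [mul_add]
  map_smul' a v := by ext i; simp [mul_left_comm]
  left_inv v := by ext i; simp
  right_inv v := by ext i; simp

theorem monomial_apply (σ : Equiv.Perm (Fin n)) (c : Fin n → ℂˣ) (v : E n) (i : Fin n) :
    monomial σ c v i = c i * v (σ.symm i) := rfl

theorem one_symm_apply (i : Fin n) : (1 : Equiv.Perm (Fin n)).symm i = i := rfl

theorem mem_G {r p : ℕ} {g : E n ≃ₗ[ℂ] E n} :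
    g ∈ G r p n ↔ ∃ (σ : Equiv.Perm (Fin n)) (c : Fin n → ℂˣ),
      (∀ i, c i ^ r = 1) ∧ (∏ i, c i) ^ (r / p) = 1 ∧ g = monomial σ c := by
  constructor
  · rintro ⟨σ, c, h1, h2, h3⟩
    exact ⟨σ, c, h1, h2, by ext v i; exact h3 v i⟩
  · rintro ⟨σ, c, h1, h2, rfl⟩
    exact ⟨σ, c, h1, h2, fun v i => rfl⟩

theorem actsIsometrically_G {r p : ℕ} (hr : 1 ≤ r) : ActsIsometrically (G r p n) := by
  rintro g hg v
  obtain ⟨σ, c, h1, -, rfl⟩ := mem_G.1 hg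
  have hc : ∀ i, ‖(c i : ℂ)‖ = 1 := fun i =>
    Complex.norm_eq_one_of_pow_eq_one (n := r)
      (by rw [← Units.val_pow_eq_pow_val, h1, Units.val_one]) (by omega)
  rw [EuclideanSpace.norm_eq, EuclideanSpace.norm_eq]
  simp only [monomial_apply, norm_mul, hc, one_mul]
  rw [Equiv.sum_comp σ.symm fun i => ‖v i‖ ^ 2]

theorem e_apply (i k : Fin n) : (e i : E n) k = if k = i then 1 else 0 := by
  simp [e]

/-- The transformation exchanging `e_i` and `e_j` up to the factor `c`: for `i ≠ j` it is the
reflection with `e_i ↦ c⁻¹ e_j` and `e_j ↦ c e_i`. -/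
def exchange (i j : Fin n) (c : ℂˣ) : E n ≃ₗ[ℂ] E n :=
  monomial (Equiv.swap i j) (Function.update (Function.update 1 j c⁻¹) i c)

/-- The diagonal transformation multiplying the `i`-th coordinate by `c`. -/
def scaleCoord (i : Fin n) (c : ℂˣ) : E n ≃ₗ[ℂ] E n :=
  monomial 1 (Function.update 1 i c)

theorem sub_exchange {i j : Fin n} (hij : i ≠ j) (c : ℂˣ) (v : E n) :
    v - exchange i j c v = (v i - c * v j) • (e i - ((c⁻¹ : ℂˣ) : ℂ) • e j) := by
  ext k
  have hc : (c : ℂ) * ((c⁻¹ : ℂˣ) : ℂ) = 1 := c.mul_inv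
  simp only [exchange, PiLp.sub_apply, PiLp.smul_apply, monomial_apply, e_apply, smul_eq_mul,
    Equiv.symm_swap]
  by_cases h1 : k = i
  · subst h1
    simp [hij]
  · by_cases h2 : k = j
    · subst h2
      rw [Function.update_of_ne h1, Function.update_self, Equiv.swap_apply_right]
      simp only [h1, if_false, if_true]
      linear_combination -(v k) * hc
    · rw [Function.update_of_ne h1, Function.update_of_ne h2, Equiv.swap_apply_of_ne_of_ne h1 h2]
      simp [h1, h2]

theorem sub_scaleCoord (i : Fin n) (c : ℂˣ) (v : E n) :
    v - scaleCoord i c v = ((1 - c) * v i) • e i := by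
  ext k
  simp only [scaleCoord, PiLp.sub_apply, PiLp.smul_apply, monomial_apply, e_apply, smul_eq_mul,
    one_symm_apply]
  by_cases h1 : k = i
  · subst h1
    simp; ring
  · simp [h1]

theorem exchange_mem_G {r p : ℕ} {i j : Fin n} (hij : i ≠ j) {c : ℂˣ} (hc : c ^ r = 1) :
    exchange i j c ∈ G r p n := by
  refine mem_G.2 ⟨_, _, fun k => ?_, ?_, rfl⟩
  · by_cases h1 : k = i
    · subst h1; simpa using hc
    · by_cases h2 : k = j
      · subst h2; simp [h1, hc]
      · simp [h1, h2]
  · rw [Finset.prod_update_of_mem (Finset.mem_univ _),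
      Finset.prod_update_of_mem (by simp [hij.symm])]
    simp

theorem scaleCoord_mem_G {r p : ℕ} (i : Fin n) {c : ℂˣ} (hc : c ^ r = 1) (hc' : c ^ (r / p) = 1) :
    scaleCoord i c ∈ G r p n := by
  refine mem_G.2 ⟨_, _, fun k => ?_, ?_, rfl⟩
  · by_cases h1 : k = i
    · subst h1; simpa using hc
    · simp [h1]
  · rw [Finset.prod_update_of_mem (Finset.mem_univ _)]
    simpa using hc'

theorem isLinearReflection_of_sub_eq {V : Type*} [NormedAddCommGroup V] [InnerProductSpace ℂ V]
    {g : V ≃ₗ[ℂ] V} {f : V →ₗ[ℂ] ℂ} {a : V} (hf : f ≠ 0) (ha : a ≠ 0)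
    (h : ∀ v, v - g v = f v • a) : IsLinearReflection g := by
  refine ⟨?_, f, hf, fun d hd => ?_⟩
  · rintro rfl
    apply hf
    ext v
    have h1 := h v
    rw [show (1 : V ≃ₗ[ℂ] V) v = v from rfl, sub_self] at h1
    exact (smul_eq_zero.1 h1.symm).resolve_right ha
  · have h1 := h d
    rw [hd, zero_smul] at h1
    exact (sub_eq_zero.1 h1).symm

/-- The functional `v ↦ v_i - c v_j`. -/
def coordSub (i j : Fin n) (c : ℂ) : E n →ₗ[ℂ] ℂ :=
  (EuclideanSpace.proj i : E n →L[ℂ] ℂ).toLinearMap -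
    c • (EuclideanSpace.proj j : E n →L[ℂ] ℂ).toLinearMap

theorem coordSub_apply (i j : Fin n) (c : ℂ) (v : E n) : coordSub i j c v = v i - c * v j := rfl

theorem coordSub_ne_zero {i j : Fin n} (hij : i ≠ j) (c : ℂ) : coordSub i j c ≠ 0 := by
  intro h
  have := LinearMap.congr_fun h (e i)
  simp [coordSub_apply, e_apply, hij.symm] at this

theorem e_sub_ne_zero {i j : Fin n} (hij : i ≠ j) (c : ℂ) : (e i - c • e j : E n) ≠ 0 := by
  intro h
  have := congrArg (fun v : E n => v i) h
  simp [e_apply, hij] at this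

theorem isLinearReflection_exchange {i j : Fin n} (hij : i ≠ j) (c : ℂˣ) :
    IsLinearReflection (exchange i j c) :=
  isLinearReflection_of_sub_eq (coordSub_ne_zero hij c) (e_sub_ne_zero hij _) (sub_exchange hij c)

/-- The functional `v ↦ x v_i`. -/
def coordMul (i : Fin n) (x : ℂ) : E n →ₗ[ℂ] ℂ :=
  x • (EuclideanSpace.proj i : E n →L[ℂ] ℂ).toLinearMap

theorem coordMul_ne_zero (i : Fin n) {x : ℂ} (hx : x ≠ 0) : coordMul i x ≠ 0 := by
  intro h
  have := LinearMap.congr_fun h (e i)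
  simp [coordMul, e_apply, hx] at this

theorem e_ne_zero (i : Fin n) : (e i : E n) ≠ 0 := by
  intro h
  have := congrArg (fun v : E n => v i) h
  simp [e_apply] at this

theorem isLinearReflection_scaleCoord (i : Fin n) {c : ℂˣ} (hc : c ≠ 1) :
    IsLinearReflection (scaleCoord i c) := by
  have h1 : (1 - c : ℂ) ≠ 0 := by
    rw [sub_ne_zero]
    exact fun h => hc (Units.ext h.symm)
  exact isLinearReflection_of_sub_eq (f := coordMul i (1 - c)) (coordMul_ne_zero i h1)
    (e_ne_zero i) (sub_scaleCoord i c)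

/-- The monomial reflections: `1 - g` has rank one, so all `2 × 2` minors of its matrix vanish,
which leaves only exchanges of two coordinates and dilations of one coordinate. -/
theorem IsLinearReflection.monomial_cases {σ : Equiv.Perm (Fin n)} {c : Fin n → ℂˣ}
    (h : IsLinearReflection (monomial σ c)) :
    (∃ i j, i ≠ j ∧ σ = Equiv.swap i j ∧ monomial σ c = exchange i j (c i)) ∨
      (∃ i, c i ≠ 1 ∧ (∀ k, k ≠ i → c k = 1) ∧ monomial σ c = scaleCoord i (c i)) := by
  obtain ⟨f, a, hf⟩ := h.exists_sub_eq
  have hP : ∀ (u : E n) i, u i - c i * u (σ.symm i) = f u * a i := by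
    intro u i
    have := congrArg (fun v : E n => v i) (hf u)
    simpa [monomial_apply] using this
  have minor : ∀ (u w : E n) i j, (u i - c i * u (σ.symm i)) * (w j - c j * w (σ.symm j)) =
      (u j - c j * u (σ.symm j)) * (w i - c i * w (σ.symm i)) := by
    intro u w i j
    rw [hP, hP, hP, hP]
    ring
  by_cases hσ : ∃ i, σ.symm i ≠ i
  · obtain ⟨i, hi⟩ := hσ
    set j := σ.symm i with hj
    have hfix : ∀ k, k ≠ i → k ≠ j → σ.symm k = k ∧ (c k : ℂ) = 1 := by
      intro k hki hkj
      have h1 := minor (e i) (e k) i k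
      have hki' : σ.symm k ≠ j := fun h => hki (σ.symm.injective h)
      simp only [e_apply, ← hj, hki, hki.symm, hkj.symm, hi, if_false, if_true, mul_zero,
        sub_zero, one_mul] at h1
      by_cases hk : σ.symm k = k
      · rw [hk] at h1
        simp only [if_true, mul_one] at h1
        exact ⟨hk, (sub_eq_zero.1 h1).symm⟩
      · simp [hk] at h1
    have hji : σ.symm j = i := by
      by_contra hne
      by_cases h2 : σ.symm j = j
      · exact hi (σ.symm.injective (h2.trans hj))
      · exact h2 (σ.symm.injective (hfix _ hne h2).1)
    have hcc : (c i : ℂ) * c j = 1 := by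
      have h1 := minor (e i) (e j) i j
      simp only [e_apply, ← hj, hji, hi, hi.symm, if_false, if_true, mul_zero, mul_one,
        sub_zero, zero_sub] at h1
      linear_combination -h1
    have hswap : σ = Equiv.swap i j := by
      rw [← Equiv.symm_symm σ, ← Equiv.symm_swap]
      congr 1
      ext1 k
      by_cases h1 : k = i
      · rw [h1, Equiv.swap_apply_left]
      · by_cases h2 : k = j
        · rw [h2, hji, Equiv.swap_apply_right]
        · rw [Equiv.swap_apply_of_ne_of_ne h1 h2, (hfix k h1 h2).1]
    refine Or.inl ⟨i, j, hi.symm, hswap, ?_⟩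
    rw [exchange, ← hswap]
    congr 1
    ext1 k
    by_cases h1 : k = i
    · rw [h1, Function.update_self]
    · by_cases h2 : k = j
      · rw [h2, Function.update_of_ne hi, Function.update_self]
        exact eq_inv_of_mul_eq_one_right (Units.ext hcc)
      · rw [Function.update_of_ne h1, Function.update_of_ne h2]
        exact Units.ext (hfix k h1 h2).2
  · push Not at hσ
    have hσ1 : σ = 1 := by
      ext1 k
      exact (σ.symm_apply_eq.1 (hσ k)).symm
    subst hσ1
    obtain ⟨i, hi⟩ : ∃ i, c i ≠ 1 := by
      by_contra! hc
      exact h.1 (by ext v i; simp [monomial_apply, hc, one_symm_apply])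
    have hi' : (1 - c i : ℂ) ≠ 0 := by
      rw [sub_ne_zero]
      exact fun h => hi (Units.ext h.symm)
    have hk : ∀ k, k ≠ i → c k = 1 := by
      intro k hk
      have h1 := minor (e i) (e k) i k
      simp only [e_apply, hσ, hk, hk.symm, if_false, if_true, mul_zero, mul_one, sub_zero] at h1
      exact Units.ext (sub_eq_zero.1 ((mul_eq_zero.1 h1).resolve_left hi')).symm
    refine Or.inr ⟨i, hi, hk, ?_⟩
    rw [scaleCoord]
    congr 1
    ext1 k
    by_cases h1 : k = i
    · rw [h1, Function.update_self]
    · rw [Function.update_of_ne h1, hk k h1, Pi.one_apply]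

/-- The reflections of `G(r,p,n)`. -/
theorem IsLinearReflection.cases_of_mem_G {r p : ℕ} {g : E n ≃ₗ[ℂ] E n} (h : IsLinearReflection g)
    (hg : g ∈ G r p n) :
    (∃ i j, i ≠ j ∧ ∃ c : ℂˣ, c ^ r = 1 ∧ g = exchange i j c) ∨
      (∃ i, ∃ c : ℂˣ, c ≠ 1 ∧ c ^ r = 1 ∧ c ^ (r / p) = 1 ∧ g = scaleCoord i c) := by
  obtain ⟨σ, c, h1, h2, rfl⟩ := mem_G.1 hg
  obtain ⟨i, j, hij, -, h3⟩ | ⟨i, hi, hk, h3⟩ := h.monomial_cases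
  · exact Or.inl ⟨i, j, hij, c i, h1 i, h3⟩
  · refine Or.inr ⟨i, c i, hi, h1 i, ?_, h3⟩
    rwa [Finset.prod_eq_single i (fun k _ => hk k) (by simp)] at h2

end Monomial

section Symmetric

variable {n : ℕ}

/-- The permutation of coordinates by `σ` on the sum-zero hyperplane. -/
def permute (σ : Equiv.Perm (Fin n)) : sumZero n ≃ₗ[ℂ] sumZero n where
  toFun v := ⟨WithLp.toLp 2 fun i => (v : E n) (σ.symm i), by
    change ∑ i, (v : E n) (σ.symm i) = 0
    rw [Equiv.sum_comp σ.symm fun i => (v : E n) i]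
    exact v.2⟩
  invFun v := ⟨WithLp.toLp 2 fun i => (v : E n) (σ i), by
    change ∑ i, (v : E n) (σ i) = 0
    rw [Equiv.sum_comp σ fun i => (v : E n) i]
    exact v.2⟩
  map_add' u v := by ext i; simp
  map_smul' a v := by ext i; simp
  left_inv v := by ext i; simp
  right_inv v := by ext i; simp

theorem permute_apply (σ : Equiv.Perm (Fin n)) (v : sumZero n) (i : Fin n) :
    (permute σ v : E n) i = (v : E n) (σ.symm i) := rfl

theorem mem_weylA {g : sumZero n ≃ₗ[ℂ] sumZero n} : g ∈ weylA n ↔ ∃ σ, g = permute σ := by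
  constructor
  · rintro ⟨σ, h⟩
    exact ⟨σ, by ext v i; exact h v i⟩
  · rintro ⟨σ, rfl⟩
    exact ⟨σ, fun v i => rfl⟩

theorem actsIsometrically_weylA : ActsIsometrically (V := sumZero n) (weylA n) := by
  rintro g hg v
  obtain ⟨σ, rfl⟩ := mem_weylA.1 hg
  change ‖(permute σ v : E n)‖ = ‖(v : E n)‖
  rw [EuclideanSpace.norm_eq, EuclideanSpace.norm_eq]
  simp only [permute_apply]
  rw [Equiv.sum_comp σ.symm fun i => ‖(v : E n) i‖ ^ 2]

/-- The vector `e_i - e_j` of the sum-zero hyperplane. -/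
def rootA (i j : Fin n) : sumZero n :=
  ⟨e i - e j, by
    change ∑ k, (e i - e j : E n) k = 0
    simp [e_apply]⟩

theorem coe_rootA (i j : Fin n) : (rootA i j : E n) = e i - e j := rfl

theorem sub_permute_swap {i j : Fin n} (hij : i ≠ j) (v : sumZero n) :
    v - permute (Equiv.swap i j) v = ((v : E n) i - (v : E n) j) • rootA i j := by
  have h := sub_exchange hij 1 (v : E n)
  have h1 : (permute (Equiv.swap i j) v : E n) = exchange i j 1 v := by
    ext k
    rw [permute_apply, exchange, inv_one, monomial_apply]
    simp [Function.update_apply]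
  apply Subtype.ext
  rw [Submodule.coe_sub, h1, h, Submodule.coe_smul, coe_rootA]
  simp

theorem rootA_ne_zero {i j : Fin n} (hij : i ≠ j) : rootA i j ≠ 0 := by
  intro h
  have := congrArg (fun v : sumZero n => (v : E n)) h
  exact e_sub_ne_zero hij 1 (by simpa [coe_rootA] using this)

theorem coordSub_domRestrict_ne_zero {i j : Fin n} (hij : i ≠ j) :
    (coordSub i j 1).domRestrict (sumZero n) ≠ 0 := by
  intro h
  have := LinearMap.congr_fun h (rootA i j)
  simp [coordSub_apply, coe_rootA, e_apply, hij, hij.symm] at this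

theorem isLinearReflection_permute_swap {i j : Fin n} (hij : i ≠ j) :
    IsLinearReflection (V := sumZero n) (permute (Equiv.swap i j)) :=
  isLinearReflection_of_sub_eq (coordSub_domRestrict_ne_zero hij) (rootA_ne_zero hij) fun v => by
    rw [sub_permute_swap hij, LinearMap.domRestrict_apply, coordSub_apply, one_mul]

/-- The reflections of the symmetric group are the transpositions: a reflection of the sum-zero
hyperplane extends to `ℂ^n` by fixing the vector `(1, …, 1)`. -/
theorem IsLinearReflection.eq_swap {σ : Equiv.Perm (Fin n)}
    (h : IsLinearReflection (V := sumZero n) (permute σ)) :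
    ∃ i j, i ≠ j ∧ σ = Equiv.swap i j := by
  obtain ⟨h1, f, hf, hd⟩ := h
  have hn : (n : ℂ) ≠ 0 := by
    rintro hn
    have hn : n = 0 := by exact_mod_cast hn
    subst hn
    exact h1 (by ext v i; exact i.elim0)
  let π : E n →ₗ[ℂ] sumZero n :=
    { toFun := fun v => ⟨WithLp.toLp 2 fun i => v i - (∑ k, v k) / n, by
        change ∑ i, (v i - (∑ k, v k) / n) = 0
        simp [mul_div_cancel₀ _ hn]⟩
      map_add' := fun u v => by ext i; simp [Finset.sum_add_distrib]; ring
      map_smul' := fun a v => by ext i; simp [← Finset.mul_sum]; ring }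
  have hπ : ∀ v i, (π v : E n) i = v i - (∑ k, v k) / n := fun v i => rfl
  have hπ' : ∀ v : sumZero n, π v = v := fun v => by
    ext i
    rw [hπ, show ∑ k, (v : E n) k = 0 from v.2]
    simp
  have hr : IsLinearReflection (monomial σ 1) := by
    refine ⟨fun h2 => h1 ?_, f ∘ₗ π, fun h2 => hf ?_, fun d hd' => ?_⟩
    · ext v i
      have := congrArg (fun g : E n ≃ₗ[ℂ] E n => g v i) h2
      simp only [monomial_apply, Pi.one_apply, Units.val_one, one_mul] at this
      exact this
    · ext v
      have := LinearMap.congr_fun h2 (v : E n)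
      simpa [hπ'] using this
    · have h2 := hd (π d) hd'
      ext i
      have h3 := congrArg (fun v : sumZero n => (v : E n) i) h2
      simpa [permute_apply, hπ, monomial_apply] using h3
  obtain ⟨i, j, hij, h2, -⟩ | ⟨i, hi, -⟩ := hr.monomial_cases
  · exact ⟨i, j, hij, h2⟩
  · exact absurd rfl hi

end Symmetric

/-! ### Type A -/

section TypeA

variable {n : ℕ}

theorem exists_perm_pair {i j k l : Fin n} (hij : i ≠ j) (hkl : k ≠ l) :
    ∃ σ : Equiv.Perm (Fin n), σ i = k ∧ σ j = l := by
  refine ⟨Equiv.swap (Equiv.swap i k j) l * Equiv.swap i k, ?_, ?_⟩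
  · rw [Equiv.Perm.mul_apply, Equiv.swap_apply_left]
    refine Equiv.swap_apply_of_ne_of_ne (fun h => hij ?_) hkl
    exact (Equiv.swap i k).injective (by rw [Equiv.swap_apply_left, ← h])
  · rw [Equiv.Perm.mul_apply, Equiv.swap_apply_left]

theorem permute_rootA (σ : Equiv.Perm (Fin n)) (i j : Fin n) :
    permute σ (rootA i j) = rootA (σ i) (σ j) := by
  ext k
  simp [permute_apply, coe_rootA, e_apply, Equiv.symm_apply_eq]

theorem coeff_rootA_eq {Λ : AddSubgroup (sumZero n)} (hΛ : IsInvariant (weylA n) Λ)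
    {i j k l : Fin n} (hij : i ≠ j) (hkl : k ≠ l) {m : ℂ} (h : m • rootA i j ∈ Λ) :
    m • rootA k l ∈ Λ := by
  obtain ⟨σ, rfl, rfl⟩ := exists_perm_pair hij hkl
  rw [← permute_rootA, ← map_smul]
  exact hΛ _ (mem_weylA.2 ⟨σ, rfl⟩) _ h

theorem eq_sum_smul_rootA (v : sumZero n) (i₀ : Fin n) :
    v = ∑ i, (v : E n) i • rootA i i₀ := by
  have hs : ∑ i, (v : E n) i = 0 := v.2
  apply Subtype.ext
  ext k
  rw [Submodule.coe_sum]
  simp [coe_rootA, e_apply, mul_sub, Finset.sum_sub_distrib, hs]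

/-- The vectors of the sum-zero hyperplane with all coordinates in `M`. -/
def coordLatticeA (n : ℕ) (M : AddSubgroup ℂ) : AddSubgroup (sumZero n) where
  carrier := {v | ∀ i, (v : E n) i ∈ M}
  zero_mem' := fun i => by simp
  add_mem' := fun hu hv i => by simpa using M.add_mem (hu i) (hv i)
  neg_mem' := fun hu i => by simpa using hu i

theorem mem_coordLatticeA {M : AddSubgroup ℂ} {v : sumZero n} :
    v ∈ coordLatticeA n M ↔ ∀ i, (v : E n) i ∈ M := Iff.rfl

theorem smul_rootA_mem {M : AddSubgroup ℂ} {m : ℂ} (hm : m ∈ M) (i j : Fin n) :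
    m • rootA i j ∈ coordLatticeA n M := by
  intro k
  by_cases h1 : k = i <;> by_cases h2 : k = j <;> simp [coe_rootA, e_apply, h1, h2]
  all_goals split_ifs <;> simp [hm]

theorem isInvariant_coordLatticeA (M : AddSubgroup ℂ) :
    IsInvariant (V := sumZero n) (weylA n) (coordLatticeA n M) := by
  intro g hg t ht i
  obtain ⟨σ, rfl⟩ := mem_weylA.1 hg
  exact ht _

/-- A lattice making `W(A_{n-1}) ⋉ Λ` a reflection group is the root lattice tensored with a
lattice in `ℂ`. -/
theorem IsReflectionLattice.eq_coordLatticeA {Λ : AddSubgroup (sumZero n)}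
    (h : IsReflectionLattice (V := sumZero n) (weylA n) Λ) {i j : Fin n} (hij : i ≠ j) :
    Λ = coordLatticeA n (coeff Λ (rootA i j)) := by
  apply le_antisymm
  · apply h.gen _ (isInvariant_coordLatticeA _)
    intro g hg hgr v hv
    obtain ⟨σ, rfl⟩ := mem_weylA.1 hg
    obtain ⟨k, l, hkl, rfl⟩ := hgr.eq_swap
    rw [sub_permute_swap hkl] at hv ⊢
    exact smul_rootA_mem (coeff_rootA_eq h.inv hkl hij hv) k l
  · intro v hv
    rw [eq_sum_smul_rootA v j]
    refine Λ.sum_mem fun k _ => ?_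
    by_cases hk : k = j
    · have h0 : rootA k j = 0 := by
        subst hk
        ext
        simp [coe_rootA]
      rw [h0, smul_zero]
      exact Λ.zero_mem
    · exact coeff_rootA_eq h.inv hij hk (hv k)

theorem latticeA_eq (hn : 2 ≤ n) (α : ℂ) : latticeA n α = coordLatticeA n (zPlus α) := by
  apply le_antisymm
  · rw [latticeA, AddSubgroup.closure_le]
    rintro v ⟨β, hβ, i, j, -, hv⟩
    have h1 : v = β • rootA i j := Subtype.ext hv
    rw [h1]
    exact smul_rootA_mem hβ i j
  · intro v hv
    have key : ∀ (k : ℕ) (hk : k < n) (β : ℂ), β ∈ zPlus α →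
        β • rootA (⟨k, hk⟩ : Fin n) ⟨0, by omega⟩ ∈ latticeA n α := by
      intro k
      induction k with
      | zero =>
        intro hk β hβ
        have h0 : rootA (⟨0, hk⟩ : Fin n) ⟨0, by omega⟩ = 0 := by
          ext
          simp [coe_rootA]
        rw [h0, smul_zero]
        exact AddSubgroup.zero_mem _
      | succ k ih =>
        intro hk β hβ
        have h1 := ih (by omega) β hβ
        have h2 : β • rootA (⟨k, by omega⟩ : Fin n) ⟨k + 1, hk⟩ ∈ latticeA n α :=
          AddSubgroup.subset_closure ⟨β, hβ, _, _, rfl, rfl⟩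
        convert AddSubgroup.sub_mem _ h1 h2 using 1
        rw [← smul_sub]
        congr 1
        ext
        simp [coe_rootA]
    rw [eq_sum_smul_rootA v ⟨0, by omega⟩]
    exact AddSubgroup.sum_mem _ fun k _ => key k k.2 _ (hv k)

/-- If a nontrivial permutation moves `i` to `j` then a point fixed by `v ↦ σ v + t` satisfies
`v_j - v_i ∈ M`, so it lies on a reflecting hyperplane of the transposition of `i` and `j`. -/
theorem isSteinbergLattice_coordLatticeA (M : AddSubgroup ℂ) :
    IsSteinbergLattice (V := sumZero n) (weylA n) (coordLatticeA n M) := by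
  rintro v ⟨g, hg, hg1, hv⟩
  obtain ⟨σ, rfl⟩ := mem_weylA.1 hg
  obtain ⟨i, hi⟩ : ∃ i, σ.symm i ≠ i := by
    by_contra! h
    exact hg1 (by ext v i; rw [permute_apply, h]; rfl)
  refine ⟨_, mem_weylA.2 ⟨Equiv.swap i (σ.symm i), rfl⟩,
    isLinearReflection_permute_swap hi.symm, ?_⟩
  rw [sub_permute_swap hi.symm]
  exact smul_rootA_mem (hv i) _ _

theorem isListed_weylA (hn : 2 ≤ n) {Λ : AddSubgroup (sumZero n)}
    (h : IsReflectionLattice (V := sumZero n) (weylA n) Λ) :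
    IsListed (V := sumZero n) (semidirect (weylA n) Λ) := by
  have hij : (⟨0, by omega⟩ : Fin n) ≠ ⟨1, by omega⟩ := by simp
  have hM : IsPlaneLattice (coeff Λ (rootA ⟨0, by omega⟩ ⟨1, by omega⟩)) :=
    h.isPlaneLattice_coeff (mem_weylA.2 ⟨Equiv.swap _ _, rfl⟩) (rootA_ne_zero hij)
      (coordSub_domRestrict_ne_zero hij) fun v => by
        rw [sub_permute_swap hij, LinearMap.domRestrict_apply, coordSub_apply, one_mul]
  obtain ⟨ω, hω, α, hα, hz⟩ := hM.exists_modularStrip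
  refine Or.inl ⟨n, hn, α, hα, ?_⟩
  rw [latticeA_eq hn]
  refine equivalent_smul (V := sumZero n) h.inv (isInvariant_coordLatticeA _) hω fun t => ?_
  rw [h.eq_coordLatticeA hij, mem_coordLatticeA, mem_coordLatticeA]
  exact forall_congr' fun i => hz _

end TypeA

/-! ### Types B and D: lattices and the Steinberg property -/

section TypeBD

variable {n : ℕ}

theorem units_sq_eq_one {c : ℂˣ} (hc : c ^ 2 = 1) : c = 1 ∨ c = -1 := by
  have h : (c : ℂ) ^ 2 = 1 := by rw [← Units.val_pow_eq_pow_val, hc, Units.val_one]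
  rw [sq] at h
  rcases mul_self_eq_one_iff.1 h with h | h
  · exact Or.inl (Units.ext h)
  · exact Or.inr (Units.ext (by simpa using h))

theorem unit_mul_mem {M : AddSubgroup ℂ} {c : ℂˣ} (hc : c ^ 2 = 1) {m : ℂ} (hm : m ∈ M) :
    (c : ℂ) * m ∈ M := by
  rcases units_sq_eq_one hc with rfl | rfl <;> simpa using hm

/-- The subgroup `2M` of `M`. -/
def double (M : AddSubgroup ℂ) : AddSubgroup ℂ := M.map (AddMonoidHom.mulLeft 2)

theorem mem_double {M : AddSubgroup ℂ} {z : ℂ} : z ∈ double M ↔ ∃ m ∈ M, 2 * m = z := Iff.rfl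

theorem two_mul_mem_double {M : AddSubgroup ℂ} {m : ℂ} (hm : m ∈ M) : 2 * m ∈ double M :=
  ⟨m, hm, rfl⟩

theorem double_le (M : AddSubgroup ℂ) : double M ≤ M := by
  rintro _ ⟨m, hm, rfl⟩
  change 2 * m ∈ M
  rw [two_mul]
  exact M.add_mem hm hm

theorem mem_of_two_mul_mem_double {M : AddSubgroup ℂ} {m : ℂ} (h : 2 * m ∈ double M) : m ∈ M := by
  obtain ⟨k, hk, hkm⟩ := mem_double.1 h
  rwa [← mul_left_cancel₀ two_ne_zero hkm]

/-- The vectors of `ℂ^n` with all coordinates in `M` and coordinate sum in `L`. -/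
def sumLattice (n : ℕ) (M L : AddSubgroup ℂ) : AddSubgroup (E n) where
  carrier := {v | (∀ i, v i ∈ M) ∧ ∑ i, v i ∈ L}
  zero_mem' := by simp
  add_mem' := fun hu hv => ⟨fun i => by simpa using M.add_mem (hu.1 i) (hv.1 i), by
    simpa [Finset.sum_add_distrib] using L.add_mem hu.2 hv.2⟩
  neg_mem' := fun hu => ⟨fun i => by simpa using hu.1 i, by simpa using hu.2⟩

theorem mem_sumLattice {M L : AddSubgroup ℂ} {v : E n} :
    v ∈ sumLattice n M L ↔ (∀ i, v i ∈ M) ∧ ∑ i, v i ∈ L := Iff.rfl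

theorem mem_sumLattice_self {M : AddSubgroup ℂ} {v : E n} :
    v ∈ sumLattice n M M ↔ ∀ i, v i ∈ M :=
  ⟨fun h => h.1, fun h => ⟨h, M.sum_mem fun i _ => h i⟩⟩

theorem smul_e_sub_mem {M L : AddSubgroup ℂ} (hL : double M ≤ L) {m : ℂ} (hm : m ∈ M)
    (i j : Fin n) {c : ℂˣ} (hc : c ^ 2 = 1) : m • (e i - (c : ℂ) • e j) ∈ sumLattice n M L := by
  refine ⟨fun k => ?_, ?_⟩
  · have h2 := unit_mul_mem hc hm
    rw [mul_comm] at h2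
    simp only [PiLp.smul_apply, PiLp.sub_apply, e_apply, smul_eq_mul, mul_sub]
    refine M.sub_mem ?_ ?_
    · split_ifs <;> simp [hm]
    · split_ifs <;> simp [h2]
  · have h1 : ∑ k, (m • (e i - (c : ℂ) • e j) : E n) k = m * (1 - c) := by
      simp [e_apply, ← Finset.mul_sum]
    rw [h1]
    rcases units_sq_eq_one hc with rfl | rfl
    · simp
    · apply hL
      convert two_mul_mem_double hm using 1
      simp; ring

theorem smul_e_mem {M L : AddSubgroup ℂ} (hL : L ≤ M) {m : ℂ} (hm : m ∈ L) (i : Fin n) :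
    m • e i ∈ sumLattice n M L := by
  refine ⟨fun k => ?_, ?_⟩
  · simp only [PiLp.smul_apply, e_apply, smul_eq_mul]
    split_ifs <;> simp [hL hm]
  · simpa [e_apply] using hm

theorem isInvariant_sumLattice {p : ℕ} {M L : AddSubgroup ℂ} (hL : double M ≤ L) :
    IsInvariant (G 2 p n) (sumLattice n M L) := by
  intro g hg t ht
  obtain ⟨σ, c, hc, -, rfl⟩ := mem_G.1 hg
  refine ⟨fun i => unit_mul_mem (hc i) (ht.1 _), ?_⟩
  have h1 : ∑ i, monomial σ c t i =
      ∑ i, t i + ∑ i, ((c i : ℂ) * t (σ.symm i) - t (σ.symm i)) := by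
    rw [Finset.sum_sub_distrib, Equiv.sum_comp σ.symm fun i => t i]
    simp [monomial_apply]
  rw [h1]
  refine L.add_mem ht.2 (L.sum_mem fun i _ => hL ?_)
  rcases units_sq_eq_one (hc i) with h | h
  · simp [h]
  · convert two_mul_mem_double (M.neg_mem (ht.1 (σ.symm i))) using 1
    simp [h]; ring

/-- The permutation matrices in `G(r,p,n)`. -/
theorem monomial_one_mem_G {r p : ℕ} (σ : Equiv.Perm (Fin n)) : monomial σ 1 ∈ G r p n :=
  mem_G.2 ⟨σ, 1, by simp, by simp, rfl⟩

theorem monomial_one_e (σ : Equiv.Perm (Fin n)) (i : Fin n) : monomial σ 1 (e i) = e (σ i) := by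
  ext k
  simp [monomial_apply, e_apply, Equiv.symm_apply_eq]

theorem smul_e_sub_mem_of_sign {p : ℕ} (hp : p = 1 ∨ 3 ≤ n) {Λ : AddSubgroup (E n)}
    (hΛ : IsInvariant (G 2 p n) Λ) {i j : Fin n} (hij : i ≠ j) {s : ℂˣ}
    {m : ℂ} (h : m • (e i - (s : ℂ) • e j) ∈ Λ) : m • (e i - ((-s : ℂˣ) : ℂ) • e j) ∈ Λ := by
  rcases hp with rfl | hn
  · have h1 := hΛ _ (scaleCoord_mem_G j (by simp) (by simp : (-1 : ℂˣ) ^ (2 / 1) = 1)) _ h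
    convert h1 using 1
    rw [← sub_sub_cancel (m • (e i - (s : ℂ) • e j)) (scaleCoord j (-1) _), sub_scaleCoord]
    have h2 : (m • (e i - (s : ℂ) • e j) : E n) j = -(m * s) := by simp [e_apply, hij.symm]
    rw [h2, Units.val_neg, Units.val_neg, Units.val_one]
    module
  · obtain ⟨k, hki, hkj⟩ : ∃ k, k ≠ i ∧ k ≠ j := by
      have := Finset.exists_mem_notMem_of_card_lt_card (s := {i, j}) (t := Finset.univ)
        (by rw [Finset.card_pair hij, Finset.card_univ, Fintype.card_fin]; omega)
      obtain ⟨k, -, hk⟩ := this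
      simp at hk
      exact ⟨k, hk⟩
    -- exchanging `e_j` with `e_k` and then `e_j` with `-e_k` changes the sign of `e_j`
    have h1 := hΛ _ (exchange_mem_G (p := p) hkj.symm (one_pow 2)) _ h
    have h2 := hΛ _ (exchange_mem_G (p := p) hkj.symm (c := -1) (by simp)) _ h1
    have e1 : exchange j k 1 (m • (e i - (s : ℂ) • e j)) = m • (e i - (s : ℂ) • e k) := by
      rw [← sub_sub_cancel (m • (e i - (s : ℂ) • e j)) (exchange j k 1 _), sub_exchange hkj.symm]
      have h3 : (m • (e i - (s : ℂ) • e j) : E n) j = -(m * s) := by simp [e_apply, hij.symm]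
      have h4 : (m • (e i - (s : ℂ) • e j) : E n) k = 0 := by simp [e_apply, hki, hkj]
      rw [h3, h4, inv_one, Units.val_one]
      module
    convert h2 using 1
    rw [e1, ← sub_sub_cancel (m • (e i - (s : ℂ) • e k)) (exchange j k (-1) _),
      sub_exchange hkj.symm]
    have h3 : (m • (e i - (s : ℂ) • e k) : E n) j = 0 := by simp [e_apply, hij.symm, hkj.symm]
    have h4 : (m • (e i - (s : ℂ) • e k) : E n) k = -(m * s) := by simp [e_apply, hki]
    rw [h3, h4, inv_neg, inv_one, Units.val_neg, Units.val_neg, Units.val_one]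
    module

/-- The roots `e_i ± e_j` are all equivalent. -/
theorem smul_e_sub_mem_of_mem {p : ℕ} (hp : p = 1 ∨ 3 ≤ n) {Λ : AddSubgroup (E n)}
    (hΛ : IsInvariant (G 2 p n) Λ) {i j k l : Fin n} (hij : i ≠ j) (hkl : k ≠ l) {s s' : ℂˣ}
    (hs : s ^ 2 = 1) (hs' : s' ^ 2 = 1) {m : ℂ} (h : m • (e i - (s : ℂ) • e j) ∈ Λ) :
    m • (e k - (s' : ℂ) • e l) ∈ Λ := by
  obtain ⟨σ, rfl, rfl⟩ := exists_perm_pair hij hkl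
  have h1 := hΛ _ (monomial_one_mem_G σ) _ h
  rw [map_smul, map_sub, map_smul, monomial_one_e, monomial_one_e] at h1
  rcases units_sq_eq_one hs with rfl | rfl <;> rcases units_sq_eq_one hs' with rfl | rfl
  · exact h1
  · exact smul_e_sub_mem_of_sign hp hΛ hkl h1
  · simpa using smul_e_sub_mem_of_sign hp hΛ hkl h1
  · exact h1

theorem smul_e_mem_of_mem {r p : ℕ} {Λ : AddSubgroup (E n)} (hΛ : IsInvariant (G r p n) Λ)
    {i : Fin n} (k : Fin n) {m : ℂ} (h : m • e i ∈ Λ) : m • e k ∈ Λ := by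
  have h1 := hΛ _ (monomial_one_mem_G (Equiv.swap i k)) _ h
  rwa [map_smul, monomial_one_e, Equiv.swap_apply_left] at h1

theorem eq_sum_smul_e (v : E n) (i₀ : Fin n) :
    v = ∑ i, v i • (e i - e i₀) + (∑ i, v i) • e i₀ := by
  ext k
  simp [e_apply, mul_sub, Finset.sum_sub_distrib]

/-- The simple roots of type `A` generate all differences `e_k - e_0`. -/
theorem smul_e_sub_e_zero_mem {Λ : AddSubgroup (E n)} {M : AddSubgroup ℂ}
    (h : ∀ β ∈ M, ∀ i j : Fin n, (j : ℕ) = i + 1 → β • (e i - e j) ∈ Λ)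
    {β : ℂ} (hβ : β ∈ M) (k : ℕ) (hk : k < n) :
    β • (e (⟨k, hk⟩ : Fin n) - e ⟨0, by omega⟩) ∈ Λ := by
  induction k with
  | zero => simp
  | succ k ih =>
    convert Λ.sub_mem (ih (by omega)) (h β hβ ⟨k, by omega⟩ ⟨k + 1, hk⟩ rfl) using 1
    rw [← smul_sub, sub_sub_sub_cancel_left]

theorem sumLattice_le {M L : AddSubgroup ℂ} {Λ : AddSubgroup (E n)} {i₀ : Fin n}
    (hM : ∀ m ∈ M, ∀ i, m • (e i - e i₀) ∈ Λ) (hL : ∀ m ∈ L, m • e i₀ ∈ Λ) :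
    sumLattice n M L ≤ Λ := by
  intro v hv
  rw [eq_sum_smul_e v i₀]
  exact Λ.add_mem (Λ.sum_mem fun i _ => hM _ (hv.1 i) i) (hL _ hv.2)

theorem latticeB_eq (hn : 1 ≤ n) (α : ℂ) : latticeB n α = sumLattice n (zPlus α) (zPlus α) := by
  apply le_antisymm
  · rw [latticeB, AddSubgroup.closure_le]
    rintro v (⟨β, hβ, i, -, rfl⟩ | ⟨β, hβ, i, j, -, rfl⟩)
    · exact smul_e_mem le_rfl hβ i
    · simpa using smul_e_sub_mem (double_le _) hβ i j (one_pow 2)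
  · refine sumLattice_le (i₀ := ⟨0, by omega⟩) (fun m hm i => ?_) fun m hm => ?_
    · exact smul_e_sub_e_zero_mem (fun β hβ i j hij =>
        AddSubgroup.subset_closure (Or.inr ⟨β, hβ, i, j, hij, rfl⟩)) hm i i.2
    · exact AddSubgroup.subset_closure (Or.inl ⟨m, hm, _, rfl, rfl⟩)

theorem latticeD3_eq (α : ℂ) : latticeD3 α = sumLattice 3 (zPlus α) (double (zPlus α)) := by
  apply le_antisymm
  · rw [latticeD3, AddSubgroup.closure_le]
    rintro v (⟨β, hβ, rfl⟩ | ⟨β, hβ, i, j, -, rfl⟩)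
    · have h1 := smul_e_sub_mem le_rfl ((zPlus α).neg_mem hβ) (0 : Fin 3) 1 (c := -1) (by simp)
      rw [Units.val_neg, Units.val_one] at h1
      rw [SetLike.mem_coe]
      convert h1 using 1
      module
    · simpa using smul_e_sub_mem le_rfl hβ i j (one_pow 2)
  · have h1 : ∀ β ∈ zPlus α, ∀ i j : Fin 3, (j : ℕ) = i + 1 → β • (e i - e j) ∈ latticeD3 α :=
      fun β hβ i j hij => AddSubgroup.subset_closure (Or.inr ⟨β, hβ, i, j, hij, rfl⟩)
    refine sumLattice_le (i₀ := 0) (fun m hm i => smul_e_sub_e_zero_mem h1 hm i i.2) ?_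
    rintro _ ⟨m, hm, rfl⟩
    have h2 : (-m) • (-e 0 - e 1) ∈ latticeD3 α :=
      AddSubgroup.subset_closure (Or.inl ⟨-m, (zPlus α).neg_mem hm, rfl⟩)
    convert AddSubgroup.add_mem _ h2 (h1 m hm 0 1 rfl) using 1
    change (2 * m) • e 0 = _
    module

/-- If the linear part is not diagonal then, as in type `A`, the fixed point satisfies
`v_i - c v_j ∈ M` for some `i ≠ j` and a sign `c`. -/
theorem exchange_of_not_diagonal {p : ℕ} {M L : AddSubgroup ℂ} (hL : double M ≤ L) {v : E n}
    {σ : Equiv.Perm (Fin n)} {c : Fin n → ℂˣ} (hc : ∀ i, c i ^ 2 = 1) (hσ : σ ≠ 1)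
    (hv : v - monomial σ c v ∈ sumLattice n M L) :
    ∃ g ∈ G 2 p n, IsLinearReflection g ∧ v - g v ∈ sumLattice n M L := by
  obtain ⟨i, hi⟩ : ∃ i, σ.symm i ≠ i := by
    by_contra! h
    exact hσ (by ext1 k; exact (σ.symm_apply_eq.1 (h k)).symm)
  refine ⟨_, exchange_mem_G hi.symm (hc i), isLinearReflection_exchange hi.symm _, ?_⟩
  rw [sub_exchange hi.symm]
  exact smul_e_sub_mem hL (hv.1 i) _ _ (by rw [inv_pow, hc, inv_one])

theorem isSteinbergLattice_typeB (M : AddSubgroup ℂ) :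
    IsSteinbergLattice (G 2 1 n) (sumLattice n M M) := by
  rintro v ⟨g, hg, hg1, hv⟩
  obtain ⟨σ, c, hc, -, rfl⟩ := mem_G.1 hg
  by_cases hσ : σ = 1
  · subst hσ
    obtain ⟨i, hi⟩ : ∃ i, c i ≠ 1 := by
      by_contra! h
      exact hg1 (by ext v i; simp [monomial_apply, h, one_symm_apply])
    refine ⟨scaleCoord i (c i), scaleCoord_mem_G i (hc i) (hc i),
      isLinearReflection_scaleCoord i hi, ?_⟩
    rw [sub_scaleCoord]
    refine smul_e_mem le_rfl ?_ i
    have := hv.1 i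
    simp only [PiLp.sub_apply, monomial_apply, one_symm_apply] at this
    convert this using 1
    ring
  · exact exchange_of_not_diagonal (double_le M) hc hσ hv

/-- A diagonal element of `G(2,2,3)` other than `1` changes exactly two signs, say at `i` and `j`;
then the third coordinate of `v - g v` vanishes, and `2v_i + 2v_j ∈ 2M`. -/
theorem isSteinbergLattice_typeD3 (M : AddSubgroup ℂ) :
    IsSteinbergLattice (G 2 2 3) (sumLattice 3 M (double M)) := by
  rintro v ⟨g, hg, hg1, hv⟩
  obtain ⟨σ, c, hc, hc', rfl⟩ := mem_G.1 hg
  by_cases hσ : σ = 1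
  · subst hσ
    have hsum := hv.2
    simp only [PiLp.sub_apply, monomial_apply, one_symm_apply, Fin.sum_univ_three] at hsum
    rw [Fin.prod_univ_three] at hc'
    have key : ∀ i j : Fin 3, i ≠ j → 2 * v i + 2 * v j ∈ double M →
        ∃ g ∈ G 2 2 3, IsLinearReflection g ∧ v - g v ∈ sumLattice 3 M (double M) := by
      intro i j hij h
      refine ⟨_, exchange_mem_G hij (c := -1) (by simp), isLinearReflection_exchange hij _, ?_⟩
      rw [sub_exchange hij]
      refine smul_e_sub_mem le_rfl (mem_of_two_mul_mem_double ?_) i j (by simp)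
      convert h using 1
      simp; ring
    rcases units_sq_eq_one (hc 0) with h0 | h0 <;> rcases units_sq_eq_one (hc 1) with h1 | h1 <;>
      rcases units_sq_eq_one (hc 2) with h2 | h2
    · refine absurd ?_ hg1
      ext v i
      fin_cases i <;> simp [monomial_apply, h0, h1, h2, one_symm_apply]
    · simp [h0, h1, h2] at hc'
    · simp [h0, h1, h2] at hc'
    · refine key 1 2 (by decide) ?_
      convert hsum using 1
      simp [h0, h1, h2]; ring
    · simp [h0, h1, h2] at hc'
    · refine key 0 2 (by decide) ?_
      convert hsum using 1
      simp [h0, h1, h2]; ring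
    · refine key 0 1 (by decide) ?_
      convert hsum using 1
      simp [h0, h1, h2]; ring
    · simp [h0, h1, h2] at hc'
  · exact exchange_of_not_diagonal le_rfl hc hσ hv

theorem IsReflectionLattice.eq_sumLattice_typeB {Λ : AddSubgroup (E n)}
    (h : IsReflectionLattice (G 2 1 n) Λ) {i j : Fin n} (hij : i ≠ j) :
    double (coeff Λ (e i - e j)) ≤ coeff Λ (e i) ∧ coeff Λ (e i) ≤ coeff Λ (e i - e j) ∧
      Λ = sumLattice n (coeff Λ (e i - e j)) (coeff Λ (e i)) := by
  have hML : double (coeff Λ (e i - e j)) ≤ coeff Λ (e i) := by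
    rintro _ ⟨m, hm, rfl⟩
    have h1 : m • (e i - ((1 : ℂˣ) : ℂ) • e j) ∈ Λ := by
      simpa [mem_coeff] using hm
    have h2 := smul_e_sub_mem_of_sign (Or.inl rfl) h.inv hij h1
    change (2 * m) • e i ∈ Λ
    convert Λ.add_mem h1 h2 using 1
    rw [Units.val_neg, Units.val_one]
    module
  have hLM : coeff Λ (e i) ≤ coeff Λ (e i - e j) := by
    intro m hm
    have h1 := smul_e_mem_of_mem h.inv j hm
    rw [mem_coeff, smul_sub]
    exact Λ.sub_mem hm h1
  refine ⟨hML, hLM, le_antisymm ?_ ?_⟩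
  · apply h.gen _ (isInvariant_sumLattice hML)
    intro g hg hgr v hv
    obtain ⟨k, l, hkl, c, hc, rfl⟩ | ⟨k, c, -, -, -, rfl⟩ := hgr.cases_of_mem_G hg
    · rw [sub_exchange hkl] at hv ⊢
      have hc' : (c⁻¹) ^ 2 = 1 := by rw [inv_pow, hc, inv_one]
      refine smul_e_sub_mem hML ?_ k l hc'
      simpa [mem_coeff] using smul_e_sub_mem_of_mem (Or.inl rfl) h.inv hkl hij hc' (one_pow 2) hv
    · rw [sub_scaleCoord] at hv ⊢
      exact smul_e_mem hLM (smul_e_mem_of_mem h.inv i hv) k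
  · refine sumLattice_le (i₀ := i) (fun m hm k => ?_) fun m hm => hm
    by_cases hk : k = i
    · rw [hk, sub_self, smul_zero]; exact Λ.zero_mem
    · simpa using smul_e_sub_mem_of_mem (Or.inl rfl) h.inv hij hk (one_pow 2) (one_pow 2)
        (by simpa [mem_coeff] using hm : m • (e i - ((1 : ℂˣ) : ℂ) • e j) ∈ Λ)

theorem IsReflectionLattice.eq_sumLattice_typeD (hn : 3 ≤ n) {Λ : AddSubgroup (E n)}
    (h : IsReflectionLattice (G 2 2 n) Λ) {i j : Fin n} (hij : i ≠ j) :
    Λ = sumLattice n (coeff Λ (e i - e j)) (double (coeff Λ (e i - e j))) := by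
  apply le_antisymm
  · apply h.gen _ (isInvariant_sumLattice le_rfl)
    intro g hg hgr v hv
    obtain ⟨k, l, hkl, c, hc, rfl⟩ | ⟨k, c, hc, -, hc', rfl⟩ := hgr.cases_of_mem_G hg
    · rw [sub_exchange hkl] at hv ⊢
      have hc' : (c⁻¹) ^ 2 = 1 := by rw [inv_pow, hc, inv_one]
      refine smul_e_sub_mem le_rfl ?_ k l hc'
      simpa [mem_coeff] using smul_e_sub_mem_of_mem (Or.inr hn) h.inv hkl hij hc' (one_pow 2) hv
    · exact absurd (by simpa using hc') hc
  · refine sumLattice_le (i₀ := i) (fun m hm k => ?_) ?_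
    · by_cases hk : k = i
      · rw [hk, sub_self, smul_zero]; exact Λ.zero_mem
      · simpa using smul_e_sub_mem_of_mem (Or.inr hn) h.inv hij hk (one_pow 2) (one_pow 2)
          (by simpa [mem_coeff] using hm : m • (e i - ((1 : ℂˣ) : ℂ) • e j) ∈ Λ)
    · rintro _ ⟨m, hm, rfl⟩
      have h1 : m • (e i - ((1 : ℂˣ) : ℂ) • e j) ∈ Λ := by simpa [mem_coeff] using hm
      have h2 := smul_e_sub_mem_of_sign (Or.inr hn) h.inv hij h1
      convert Λ.add_mem h1 h2 using 1
      change (2 * m) • e i = _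
      rw [Units.val_neg, Units.val_one]
      module

end TypeBD

/-! ### Types B and D: classification -/

section NonSteinberg

variable {n : ℕ}

/-- The diagonal transformation changing the signs of the coordinates in `S`. -/
def flip (S : Finset (Fin n)) : E n ≃ₗ[ℂ] E n :=
  monomial 1 fun i => if i ∈ S then -1 else 1

theorem sub_flip_apply (S : Finset (Fin n)) (v : E n) (i : Fin n) :
    (v - flip S v) i = if i ∈ S then 2 * v i else 0 := by
  simp only [flip, PiLp.sub_apply, monomial_apply, one_symm_apply]
  split_ifs
  · simp; ring
  · simp

theorem flip_mem_G {p : ℕ} {S : Finset (Fin n)} (h : ((-1 : ℂˣ) ^ S.card) ^ (2 / p) = 1) :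
    flip S ∈ G 2 p n := by
  refine mem_G.2 ⟨1, _, fun i => ?_, ?_, rfl⟩
  · split_ifs <;> simp
  · rw [Finset.prod_ite_mem_eq]
    simpa using h

/-- Let `t ∈ Λ` be supported on `S`, with coordinates in `M` pairwise incongruent modulo `2M`.
The point with coordinates `t_i / 2` on `S` and generic coordinates elsewhere is fixed by the
transformation in `G(2,p,n) ⋉ Λ` changing the signs on `S`, but by no reflection unless
`t_i e_i ∈ Λ` for some `i ∈ S`. The coordinates off `S` are distinct fractions `ω/(i+3)` of a
primitive vector `ω` of `M`. -/
theorem not_isSteinbergLattice {p : ℕ} {Λ : AddSubgroup (E n)} {M : AddSubgroup ℂ}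
    (hM : ∀ v ∈ Λ, ∀ i, v i ∈ M) {ω : ℂ} (hω : ∀ x : ℝ, x * ω ∈ M → ∃ k : ℤ, x = k)
    {S : Finset (Fin n)} (hS : S.Nonempty) (hSG : flip S ∈ G 2 p n) {t : E n} (ht : t ∈ Λ)
    (hsupp : ∀ i, i ∉ S → t i = 0)
    (hdist : ∀ i ∈ S, ∀ j ∈ S, i ≠ j → t i - t j ∉ double M)
    (hL : (-1 : ℂˣ) ^ (2 / p) = 1 → ∀ i ∈ S, t i • e i ∉ Λ) : ¬ IsSteinbergLattice (G 2 p n) Λ := by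
  intro hst
  let q : Fin n → ℝ := fun i => ((i : ℕ) + 3 : ℝ)⁻¹
  have hq0 : ∀ i, 0 < q i := fun i => by positivity
  have hq1 : ∀ i, q i < 1 / 2 := fun i => by
    simp only [q, one_div]
    have : (0 : ℝ) ≤ (i : ℕ) := Nat.cast_nonneg _
    exact inv_strictAnti₀ (by norm_num) (by linarith)
  have hqinj : ∀ i j, q i = q j → i = j := fun i j h => by
    simp only [q, inv_inj, add_left_inj, Nat.cast_inj] at h
    exact Fin.ext h
  have hfrac : ∀ x : ℝ, x * ω ∈ M → -1 < x → x < 1 → x = 0 := by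
    intro x hx h1 h2
    obtain ⟨k, rfl⟩ := hω x hx
    have h1' : -1 < k := by exact_mod_cast h1
    have h2' : k < 1 := by exact_mod_cast h2
    have : k = 0 := by omega
    simp [this]
  have h2q : ∀ i, 2 * (q i * ω) ∉ M := by
    intro i hi
    have h1 := hfrac (2 * q i) (by push_cast; rwa [mul_assoc]) (by linarith [hq0 i])
      (by linarith [hq1 i])
    linarith [hq0 i]
  let v : E n := WithLp.toLp 2 fun i => if i ∈ S then t i / 2 else q i * ω
  have hvS : ∀ i ∈ S, 2 * v i = t i := fun i hi => by
    simp [v, hi, mul_div_cancel₀]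
  have hvS' : ∀ i, i ∉ S → v i = q i * ω := fun i hi => by simp [v, hi]
  have hsub : v - flip S v = t := by
    ext i
    rw [sub_flip_apply]
    split_ifs with h
    · exact hvS i h
    · exact (hsupp i h).symm
  obtain ⟨i₀, hi₀⟩ := hS
  have hne : flip S ≠ 1 := by
    intro h
    have h1 := sub_flip_apply S (e i₀) i₀
    rw [h] at h1
    have h2 : (e i₀ - (1 : E n ≃ₗ[ℂ] E n) (e i₀) : E n) i₀ = 0 := by
      change (e i₀ - e i₀ : E n) i₀ = 0
      simp
    rw [h2] at h1
    simp [hi₀, e_apply] at h1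
  obtain ⟨g, hg, hgr, hgv⟩ := hst v ⟨flip S, hSG, hne, by rwa [hsub]⟩
  have htM : ∀ i, t i ∈ M := hM t ht
  have hmix : ∀ i ∈ S, ∀ j, j ∉ S → ∀ c : ℂˣ, c ^ 2 = 1 → v i - c * v j ∉ M := by
    intro i hi j hj c hc h
    have h1 := M.add_mem h h
    have h2 := unit_mul_mem hc (M.sub_mem (htM i) h1)
    apply h2q j
    have hcc : (c : ℂ) * c = 1 := by rw [← sq, ← Units.val_pow_eq_pow_val, hc, Units.val_one]
    convert h2 using 1
    rw [← hvS i hi, ← hvS' j hj]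
    linear_combination -(2 * v j) * hcc
  obtain ⟨i, j, hij, c, hc, rfl⟩ | ⟨i, c, hc, hc2, hcp, rfl⟩ := hgr.cases_of_mem_G hg
  · rw [sub_exchange hij] at hgv
    have hmem : v i - c * v j ∈ M := by
      simpa [e_apply, hij] using hM _ hgv i
    by_cases hi : i ∈ S <;> by_cases hj : j ∈ S
    · apply hdist i hi j hj hij
      have h1 := two_mul_mem_double hmem
      rcases units_sq_eq_one hc with rfl | rfl
      · convert h1 using 1
        rw [← hvS i hi, ← hvS j hj, Units.val_one]; ring
      · convert (double M).sub_mem h1 (two_mul_mem_double (htM j)) using 1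
        rw [← hvS i hi, ← hvS j hj, Units.val_neg, Units.val_one]; ring
    · exact hmix i hi j hj c hc hmem
    · apply hmix j hj i hi c hc
      have h1 := unit_mul_mem hc (M.neg_mem hmem)
      have hcc : (c : ℂ) * c = 1 := by rw [← sq, ← Units.val_pow_eq_pow_val, hc, Units.val_one]
      convert h1 using 1
      linear_combination -(v j) * hcc
    · rw [hvS' i hi, hvS' j hj] at hmem
      have b1 := hq0 i
      have b2 := hq0 j
      have b3 := hq1 i
      have b4 := hq1 j
      rcases units_sq_eq_one hc with rfl | rfl
      · have h1 := hfrac (q i - q j) (by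
          convert hmem using 1
          push_cast; ring) (by linarith) (by linarith)
        exact hij (hqinj i j (sub_eq_zero.1 h1))
      · have h1 := hfrac (q i + q j) (by
          convert hmem using 1
          push_cast; ring) (by linarith) (by linarith)
        linarith
  · obtain rfl := (units_sq_eq_one hc2).resolve_left hc
    rw [sub_scaleCoord] at hgv
    have hone : (1 - ((-1 : ℂˣ) : ℂ)) = 2 := by rw [Units.val_neg, Units.val_one]; norm_num
    rw [hone] at hgv
    by_cases hi : i ∈ S
    · rw [hvS i hi] at hgv
      exact hL hcp i hi hgv
    · apply h2q i
      rw [← hvS' i hi]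
      simpa [e_apply] using hM _ hgv i

/-- A scaled copy of `ℤ + ℤα`: the lattice `M` written in the basis `ω, ωα`. -/
theorem mem_of_basis {M : AddSubgroup ℂ} {ω α : ℂ} (hω : ω ≠ 0)
    (hM : ∀ z, z ∈ M ↔ ω⁻¹ * z ∈ zPlus α) (a b : ℤ) : ω * (a + b * α) ∈ M := by
  rw [hM, inv_mul_cancel_left₀ hω]
  exact mem_zPlus.2 ⟨a, b, rfl⟩

theorem int_coords_of_mem {M : AddSubgroup ℂ} {ω α : ℂ} (hω : ω ≠ 0) (hα : α.im ≠ 0)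
    (hM : ∀ z, z ∈ M ↔ ω⁻¹ * z ∈ zPlus α) {x y : ℝ} (h : ω * (x + y * α) ∈ M) :
    ∃ a b : ℤ, x = a ∧ y = b := by
  rw [hM, inv_mul_cancel_left₀ hω] at h
  exact int_coords_of_mem_zPlus hα h

theorem two_dvd_of_mem_double {M : AddSubgroup ℂ} {ω α : ℂ} (hω : ω ≠ 0) (hα : α.im ≠ 0)
    (hM : ∀ z, z ∈ M ↔ ω⁻¹ * z ∈ zPlus α) {a b : ℤ} (h : ω * (a + b * α) ∈ double M) :
    2 ∣ a ∧ 2 ∣ b := by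
  obtain ⟨m, hm, hmz⟩ := mem_double.1 h
  have h1 : ω * (((a / 2 : ℝ) : ℂ) + ((b / 2 : ℝ) : ℂ) * α) ∈ M := by
    convert hm using 1
    push_cast
    linear_combination -(1 / 2 : ℂ) * hmz
  obtain ⟨k, l, hk, hl⟩ := int_coords_of_mem hω hα hM h1
  refine ⟨⟨k, ?_⟩, ⟨l, ?_⟩⟩
  · have : (a : ℝ) = 2 * k := by linarith
    exact_mod_cast this
  · have : (b : ℝ) = 2 * l := by linarith
    exact_mod_cast this

theorem int_of_smul_mem {M : AddSubgroup ℂ} {ω α : ℂ} (hω : ω ≠ 0) (hα : α.im ≠ 0)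
    (hM : ∀ z, z ∈ M ↔ ω⁻¹ * z ∈ zPlus α) (x : ℝ) (h : x * ω ∈ M) : ∃ k : ℤ, x = k := by
  obtain ⟨k, -, hk, -⟩ := int_coords_of_mem hω hα hM (x := x) (y := 0)
    (by convert h using 1; push_cast; ring)
  exact ⟨k, hk⟩

/-- The vector `(ω, ωα, ω(1+α), 0, …, 0)`: its first four coordinates represent the four classes
of `M` modulo `2M`. -/
def halvesVector (n : ℕ) (ω α : ℂ) : E n :=
  WithLp.toLp 2 fun i => ω * ((if (i : ℕ) = 0 ∨ (i : ℕ) = 2 then (1 : ℤ) else 0 : ℤ) +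
    (if (i : ℕ) = 1 ∨ (i : ℕ) = 2 then (1 : ℤ) else 0 : ℤ) * α)

theorem halvesVector_mem {M : AddSubgroup ℂ} {ω α : ℂ} (hn : 3 ≤ n) (hω : ω ≠ 0)
    (hM : ∀ z, z ∈ M ↔ ω⁻¹ * z ∈ zPlus α) : halvesVector n ω α ∈ sumLattice n M (double M) := by
  refine ⟨fun i => mem_of_basis hω hM _ _, ?_⟩
  obtain ⟨k, rfl⟩ := Nat.exists_eq_add_of_le' hn
  have h1 : ∑ i, halvesVector (k + 3) ω α i = 2 * (ω * ((1 : ℤ) + (1 : ℤ) * α)) := by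
    rw [Fin.sum_univ_succ, Fin.sum_univ_succ, Fin.sum_univ_succ]
    simp [halvesVector]
    ring
  rw [h1]
  exact two_mul_mem_double (mem_of_basis hω hM _ _)

theorem halvesVector_sub_notMem {M : AddSubgroup ℂ} {ω α : ℂ} (hω : ω ≠ 0) (hα : α.im ≠ 0)
    (hM : ∀ z, z ∈ M ↔ ω⁻¹ * z ∈ zPlus α) {i j : Fin n} (hi : (i : ℕ) < 4) (hj : (j : ℕ) < 4)
    (hij : i ≠ j) : halvesVector n ω α i - halvesVector n ω α j ∉ double M := by
  intro h
  have hij' : (i : ℕ) ≠ j := fun h => hij (Fin.ext h)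
  rw [halvesVector, PiLp.toLp_apply, PiLp.toLp_apply] at h
  obtain ⟨h1, h2⟩ := two_dvd_of_mem_double hω hα hM
    (a := (if (i : ℕ) = 0 ∨ (i : ℕ) = 2 then (1 : ℤ) else 0) -
      (if (j : ℕ) = 0 ∨ (j : ℕ) = 2 then (1 : ℤ) else 0))
    (b := (if (i : ℕ) = 1 ∨ (i : ℕ) = 2 then (1 : ℤ) else 0) -
      (if (j : ℕ) = 1 ∨ (j : ℕ) = 2 then (1 : ℤ) else 0))
    (by convert h using 1; push_cast; ring)
  generalize (i : ℕ) = x at *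
  generalize (j : ℕ) = y at *
  interval_cases x <;> interval_cases y <;> simp_all

theorem halvesVector_notMem_double {M : AddSubgroup ℂ} {ω α : ℂ} (hω : ω ≠ 0) (hα : α.im ≠ 0)
    (hM : ∀ z, z ∈ M ↔ ω⁻¹ * z ∈ zPlus α) {i : Fin n} (hi : (i : ℕ) < 3) :
    halvesVector n ω α i ∉ double M := by
  intro h
  rw [halvesVector, PiLp.toLp_apply] at h
  obtain ⟨h1, h2⟩ := two_dvd_of_mem_double hω hα hM h
  generalize (i : ℕ) = x at *
  interval_cases x <;> simp_all

theorem halvesVector_eq_zero {ω α : ℂ} {i : Fin n} (hi : 3 ≤ (i : ℕ)) :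
    halvesVector n ω α i = 0 := by
  have h0 : (i : ℕ) ≠ 0 := by omega
  have h1 : (i : ℕ) ≠ 1 := by omega
  have h2 : (i : ℕ) ≠ 2 := by omega
  simp [halvesVector, h0, h1, h2]

/-- No lattice of type `D_n` with `n ≥ 4` has the Steinberg property. -/
theorem not_isSteinbergLattice_typeD (hn : 4 ≤ n) {M : AddSubgroup ℂ} {ω α : ℂ} (hω : ω ≠ 0)
    (hα : α.im ≠ 0) (hM : ∀ z, z ∈ M ↔ ω⁻¹ * z ∈ zPlus α) :
    ¬ IsSteinbergLattice (G 2 2 n) (sumLattice n M (double M)) := by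
  have hcard : (Finset.univ.filter fun i : Fin n => (i : ℕ) < 4).card = 4 := by
    rw [Fin.card_filter_val_lt, min_eq_right hn]
  refine not_isSteinbergLattice (fun v hv => hv.1) (int_of_smul_mem hω hα hM)
    (S := Finset.univ.filter fun i : Fin n => (i : ℕ) < 4) ⟨⟨0, by omega⟩, by simp⟩
    (flip_mem_G (by rw [hcard, Even.neg_one_pow (by decide), one_pow]))
    (halvesVector_mem (by omega) hω hM)
    (fun i hi => halvesVector_eq_zero (by simp at hi; omega)) (fun i hi j hj hij => ?_)
    (fun h => ?_)
  · simp only [Finset.mem_filter, Finset.mem_univ, true_and] at hi hj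
    exact halvesVector_sub_notMem hω hα hM hi hj hij
  · simp at h

/-- For `n ≥ 3` the lattice of type `B_n` with `L = 2M` does not have the Steinberg property. -/
theorem not_isSteinbergLattice_typeB_double (hn : 3 ≤ n) {M : AddSubgroup ℂ} {ω α : ℂ} (hω : ω ≠ 0)
    (hα : α.im ≠ 0) (hM : ∀ z, z ∈ M ↔ ω⁻¹ * z ∈ zPlus α) :
    ¬ IsSteinbergLattice (G 2 1 n) (sumLattice n M (double M)) := by
  refine not_isSteinbergLattice (fun v hv => hv.1) (int_of_smul_mem hω hα hM)
    (S := Finset.univ.filter fun i : Fin n => (i : ℕ) < 3) ⟨⟨0, by omega⟩, by simp⟩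
    (flip_mem_G (by rw [← pow_mul, mul_comm, pow_mul]; simp)) (halvesVector_mem (by omega) hω hM)
    (fun i hi => halvesVector_eq_zero (by simp at hi; omega)) (fun i hi j hj hij => ?_)
    (fun _ i hi h => ?_)
  · simp only [Finset.mem_filter, Finset.mem_univ, true_and] at hi hj
    exact halvesVector_sub_notMem hω hα hM (by omega) (by omega) hij
  · simp only [Finset.mem_filter, Finset.mem_univ, true_and] at hi
    refine halvesVector_notMem_double hω hα hM hi ?_
    simpa [e_apply] using h.2

/-- A lattice of type `B_n` with `2M < L < M` does not have the Steinberg property: for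
`l ∈ L ∖ 2M` and `m ∈ M ∖ L` the point `(m/2, (l-m)/2, …)` lies on no reflecting hyperplane. -/
theorem not_isSteinbergLattice_typeB_between (hn : 2 ≤ n) {M L : AddSubgroup ℂ} {ω α : ℂ}
    (hω : ω ≠ 0) (hα : α.im ≠ 0) (hM : ∀ z, z ∈ M ↔ ω⁻¹ * z ∈ zPlus α) (hLM : L ≤ M)
    {l m : ℂ} (hl : l ∈ L) (hl' : l ∉ double M) (hm : m ∈ M) (hm' : m ∉ L) :
    ¬ IsSteinbergLattice (G 2 1 n) (sumLattice n M L) := by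
  set i : Fin n := ⟨0, by omega⟩ with hi
  set j : Fin n := ⟨1, by omega⟩ with hj
  have hij : i ≠ j := by simp [hi, hj]
  have ht : m • e i + (l - m) • e j ∈ sumLattice n M L := by
    refine ⟨fun k => ?_, ?_⟩
    · have := M.sub_mem (hLM hl) hm
      simp only [PiLp.add_apply, PiLp.smul_apply, e_apply, smul_eq_mul]
      refine M.add_mem ?_ ?_ <;> split_ifs <;> simp [hm, this]
    · simpa [e_apply, Finset.sum_add_distrib] using hl
  have hti : (m • e i + (l - m) • e j : E n) i = m := by simp [e_apply, hij]
  have htj : (m • e i + (l - m) • e j : E n) j = l - m := by simp [e_apply, hij.symm]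
  have hd : m - (l - m) ∉ double M := fun h => hl' (by
    convert (double M).sub_mem (two_mul_mem_double hm) h using 1
    ring)
  refine not_isSteinbergLattice (fun v hv => hv.1) (int_of_smul_mem hω hα hM)
    (S := {i, j}) ⟨i, by simp⟩ (flip_mem_G (by rw [← pow_mul, mul_comm, pow_mul]; simp)) ht
    (fun k hk => ?_) (fun k hk k' hk' hkk' => ?_) (fun _ k hk h => ?_)
  · simp only [Finset.mem_insert, Finset.mem_singleton, not_or] at hk
    simp [e_apply, hk]
  · simp only [Finset.mem_insert, Finset.mem_singleton] at hk hk'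
    rcases hk with rfl | rfl <;> rcases hk' with rfl | rfl
    · exact absurd rfl hkk'
    · rwa [hti, htj]
    · rw [hti, htj]
      exact fun h => hd (by simpa using (double M).neg_mem h)
    · exact absurd rfl hkk'
  · simp only [Finset.mem_insert, Finset.mem_singleton] at hk
    have h2 := h.2
    rcases hk with rfl | rfl
    · rw [hti] at h2
      exact hm' (by simpa [e_apply] using h2)
    · rw [htj] at h2
      have h3 : l - m ∈ L := by simpa [e_apply] using h2
      exact hm' (by simpa using L.sub_mem hl h3)

end NonSteinberg

section Listing

variable {n : ℕ}

theorem isListed_typeB (hn : 1 ≤ n) {M : AddSubgroup ℂ} {ω α : ℂ} (hω : ω ≠ 0)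
    (hα : α ∈ modularStrip) (hM : ∀ z, z ∈ M ↔ ω⁻¹ * z ∈ zPlus α) :
    IsListed (semidirect (G 2 1 n) (sumLattice n M M)) := by
  refine Or.inr (Or.inl ⟨n, hn, α, hα, ?_⟩)
  rw [latticeB_eq hn]
  refine equivalent_smul (isInvariant_sumLattice (double_le _))
    (isInvariant_sumLattice (double_le _)) hω fun t => ?_
  rw [mem_sumLattice_self, mem_sumLattice_self]
  exact forall_congr' fun i => hM _

theorem isListed_typeD3 {M : AddSubgroup ℂ} {ω α : ℂ} (hω : ω ≠ 0)
    (hα : α ∈ modularStrip) (hM : ∀ z, z ∈ M ↔ ω⁻¹ * z ∈ zPlus α) :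
    IsListed (semidirect (G 2 2 3) (sumLattice 3 M (double M))) := by
  refine Or.inr (Or.inr ⟨α, hα, ?_⟩)
  rw [latticeD3_eq]
  refine equivalent_smul (isInvariant_sumLattice le_rfl)
    (isInvariant_sumLattice le_rfl) hω fun t => ?_
  have hd : ∀ z, z ∈ double M ↔ ω⁻¹ * z ∈ double (zPlus α) := by
    intro z
    rw [mem_double, mem_double]
    constructor
    · rintro ⟨m, hm, rfl⟩
      exact ⟨ω⁻¹ * m, (hM m).1 hm, by ring⟩
    · rintro ⟨m, hm, h⟩
      refine ⟨ω * m, (hM _).2 (by rwa [inv_mul_cancel_left₀ hω]), ?_⟩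
      rw [eq_inv_mul_iff_mul_eq₀ hω] at h
      rw [← h]; ring
  rw [mem_sumLattice, mem_sumLattice, hd, Finset.mul_sum]
  exact and_congr (forall_congr' fun i => hM _) Iff.rfl

/-- The linear map `(x, y) ↦ ((x+y)/2, (x-y)/2)`, which normalizes `G(2,1,2)` and exchanges its
two classes of reflections. -/
def rotateB2 : E 2 ≃ₗ[ℂ] E 2 where
  toFun v := !₂[(v 0 + v 1) / 2, (v 0 - v 1) / 2]
  invFun v := !₂[v 0 + v 1, v 0 - v 1]
  map_add' u v := by ext i; fin_cases i <;> simp <;> ring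
  map_smul' a v := by ext i; fin_cases i <;> simp <;> ring
  left_inv v := by ext i; fin_cases i <;> simp <;> ring
  right_inv v := by ext i; fin_cases i <;> simp

theorem perm_fin_two (σ : Equiv.Perm (Fin 2)) : σ = 1 ∨ σ = Equiv.swap 0 1 := by
  revert σ
  decide

theorem mem_G212 {g : E 2 ≃ₗ[ℂ] E 2} : g ∈ G 2 1 2 ↔
    ∃ c d : ℂ, (c = 1 ∨ c = -1) ∧ (d = 1 ∨ d = -1) ∧
      ((∀ v, g v 0 = c * v 0 ∧ g v 1 = d * v 1) ∨ (∀ v, g v 0 = c * v 1 ∧ g v 1 = d * v 0)) := by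
  constructor
  · intro hg
    obtain ⟨σ, c, hc, -, rfl⟩ := mem_G.1 hg
    have hc' : ∀ i, (c i : ℂ) = 1 ∨ (c i : ℂ) = -1 := fun i => by
      rcases units_sq_eq_one (hc i) with h | h <;> simp [h]
    refine ⟨c 0, c 1, hc' 0, hc' 1, ?_⟩
    rcases perm_fin_two σ with rfl | rfl
    · exact Or.inl fun v => ⟨rfl, rfl⟩
    · exact Or.inr fun v => ⟨rfl, rfl⟩
  · rintro ⟨c, d, hc, hd, h⟩
    have hunit : ∀ {x : ℂ}, x = 1 ∨ x = -1 → ∃ u : ℂˣ, u ^ 2 = 1 ∧ (u : ℂ) = x := by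
      rintro x (rfl | rfl)
      · exact ⟨1, by simp, rfl⟩
      · exact ⟨-1, by simp, by simp⟩
    obtain ⟨u, hu, rfl⟩ := hunit hc
    obtain ⟨w, hw, rfl⟩ := hunit hd
    have hprod : (∏ i, ![u, w] i) ^ (2 / 1) = 1 := by simp [Fin.prod_univ_two, mul_pow, hu, hw]
    have hpow : ∀ i, ![u, w] i ^ 2 = 1 := fun i => by fin_cases i <;> simp [hu, hw]
    rcases h with h | h
    · refine mem_G.2 ⟨1, ![u, w], hpow, hprod, ?_⟩
      ext v i
      fin_cases i
      · exact (h v).1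
      · exact (h v).2
    · refine mem_G.2 ⟨Equiv.swap 0 1, ![u, w], hpow, hprod, ?_⟩
      ext v i
      fin_cases i
      · exact (h v).1
      · exact (h v).2

theorem rotateB2_conj_mem {g : E 2 ≃ₗ[ℂ] E 2} (hg : g ∈ G 2 1 2) :
    (rotateB2.symm.trans g).trans rotateB2 ∈ G 2 1 2 := by
  obtain ⟨c, d, hc, hd, h⟩ := mem_G212.1 hg
  have e0 : ∀ v, (rotateB2.symm.trans g).trans rotateB2 v 0 =
      (g (!₂[v 0 + v 1, v 0 - v 1]) 0 + g (!₂[v 0 + v 1, v 0 - v 1]) 1) / 2 := fun v => rfl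
  have e1 : ∀ v, (rotateB2.symm.trans g).trans rotateB2 v 1 =
      (g (!₂[v 0 + v 1, v 0 - v 1]) 0 - g (!₂[v 0 + v 1, v 0 - v 1]) 1) / 2 := fun v => rfl
  rw [mem_G212]
  rcases h with h | h
  · rcases hc with rfl | rfl <;> rcases hd with rfl | rfl
    · refine ⟨1, 1, by simp, by simp, Or.inl fun v => ?_⟩
      rw [e0, e1, (h _).1, (h _).2]; constructor <;> simp
    · refine ⟨1, 1, by simp, by simp, Or.inr fun v => ?_⟩
      rw [e0, e1, (h _).1, (h _).2]; constructor <;> simp <;> ring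
    · refine ⟨-1, -1, by simp, by simp, Or.inr fun v => ?_⟩
      rw [e0, e1, (h _).1, (h _).2]; constructor <;> simp <;> ring
    · refine ⟨-1, -1, by simp, by simp, Or.inl fun v => ?_⟩
      rw [e0, e1, (h _).1, (h _).2]; constructor <;> simp <;> ring
  · rcases hc with rfl | rfl <;> rcases hd with rfl | rfl
    · refine ⟨1, -1, by simp, by simp, Or.inl fun v => ?_⟩
      rw [e0, e1, (h _).1, (h _).2]; constructor <;> simp; ring
    · refine ⟨-1, 1, by simp, by simp, Or.inr fun v => ?_⟩
      rw [e0, e1, (h _).1, (h _).2]; constructor <;> simp <;> ring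
    · refine ⟨1, -1, by simp, by simp, Or.inr fun v => ?_⟩
      rw [e0, e1, (h _).1, (h _).2]; constructor <;> simp <;> ring
    · refine ⟨-1, 1, by simp, by simp, Or.inl fun v => ?_⟩
      rw [e0, e1, (h _).1, (h _).2]; constructor <;> simp <;> ring

theorem rotateB2_conj (g : E 2 ≃ₗ[ℂ] E 2) :
    g ∈ G 2 1 2 ↔ (rotateB2.symm.trans g).trans rotateB2 ∈ G 2 1 2 := by
  refine ⟨rotateB2_conj_mem, fun h => ?_⟩
  -- conjugating twice is the identity, since `rotateB2` is an involution up to the factor `1/2`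
  have hsq : ∀ v, rotateB2 (rotateB2 v) = (1 / 2 : ℂ) • v := fun v => by
    ext i
    fin_cases i <;> simp [rotateB2] <;> ring
  convert rotateB2_conj_mem h using 1
  ext1 v
  simp only [LinearEquiv.trans_apply]
  rw [hsq, ← map_smul, ← hsq, LinearEquiv.apply_symm_apply, LinearEquiv.apply_symm_apply]

/-- Type `B_2` with `L = 2M` is, after exchanging long and short roots, the case `L = M`. -/
theorem mem_sumLattice_double_iff {M : AddSubgroup ℂ} (v : E 2) :
    v ∈ sumLattice 2 M (double M) ↔ rotateB2 v ∈ sumLattice 2 M M := by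
  have h0 : rotateB2 v 0 = (v 0 + v 1) / 2 := rfl
  have h1 : rotateB2 v 1 = (v 0 - v 1) / 2 := rfl
  rw [mem_sumLattice_self, mem_sumLattice, Fin.forall_fin_two, Fin.forall_fin_two, h0, h1,
    Fin.sum_univ_two]
  constructor
  · rintro ⟨⟨hx, hy⟩, m, hm, hs⟩
    change 2 * m = _ at hs
    have e1 : (v 0 + v 1) / 2 = m := by rw [← hs]; ring
    refine ⟨by rwa [e1], ?_⟩
    convert M.sub_mem hm hy using 1
    rw [← e1]; ring
  · rintro ⟨hx, hy⟩
    refine ⟨⟨?_, ?_⟩, _, hx, ?_⟩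
    · convert M.add_mem hx hy using 1
      ring
    · convert M.sub_mem hx hy using 1
      ring
    · change (2 : ℂ) * ((v 0 + v 1) / 2) = v 0 + v 1
      ring

theorem isListed_of_typeB (hn : 1 ≤ n) {Λ : AddSubgroup (E n)}
    (h : IsReflectionLattice (G 2 1 n) Λ) (hs : IsSteinbergLattice (G 2 1 n) Λ) :
    IsListed (semidirect (G 2 1 n) Λ) := by
  rcases hn.eq_or_lt with rfl | hn2
  · have hM : IsPlaneLattice (coeff Λ (e 0)) :=
      h.isPlaneLattice_coeff (scaleCoord_mem_G 0 (c := -1) (by simp) (by simp)) (e_ne_zero 0)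
        (coordMul_ne_zero 0 (by rw [Units.val_neg, Units.val_one]; norm_num))
        (sub_scaleCoord 0 (-1))
    obtain ⟨ω, hω, α, hα, hz⟩ := hM.exists_modularStrip
    have hΛ : Λ = sumLattice 1 (coeff Λ (e 0)) (coeff Λ (e 0)) := by
      ext v
      have hv : v = v 0 • e 0 := by
        ext i
        fin_cases i
        simp [e_apply]
      rw [mem_sumLattice_self, Fin.forall_fin_one, mem_coeff, ← hv]
    rw [hΛ]
    exact isListed_typeB le_rfl hω hα hz
  · set i : Fin n := ⟨0, by omega⟩ with hi
    set j : Fin n := ⟨1, by omega⟩ with hj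
    have hij : i ≠ j := by simp [hi, hj]
    have hM : IsPlaneLattice (coeff Λ (e i - e j)) :=
      h.isPlaneLattice_coeff (exchange_mem_G hij (one_pow 2))
        (by simpa using e_sub_ne_zero hij 1) (coordSub_ne_zero hij 1)
        (fun v => by rw [sub_exchange hij]; simp [coordSub_apply])
    obtain ⟨ω, hω, α, hα, hz⟩ := hM.exists_modularStrip
    have hα0 := im_ne_zero_of_mem_modularStrip hα
    obtain ⟨h2M, hLM, hΛ⟩ := h.eq_sumLattice_typeB hij
    set M := coeff Λ (e i - e j)
    set L := coeff Λ (e i)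
    rw [hΛ] at hs ⊢
    by_cases hL : L = M
    · rw [hL]
      exact isListed_typeB hn hω hα hz
    · by_cases hL2 : L = double M
      · rw [hL2] at hs ⊢
        by_cases hn3 : 3 ≤ n
        · exact absurd hs (not_isSteinbergLattice_typeB_double hn3 hω hα0 hz)
        · obtain rfl : n = 2 := by omega
          refine IsListed.of_equivalent (equivalent_semidirect (isInvariant_sumLattice le_rfl)
            (isInvariant_sumLattice (double_le _)) rotateB2 rotateB2_conj
            mem_sumLattice_double_iff) ?_
          exact isListed_typeB hn hω hα hz
      · obtain ⟨l, hl, hl'⟩ := SetLike.exists_of_lt (lt_of_le_of_ne h2M (Ne.symm hL2))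
        obtain ⟨m, hm, hm'⟩ := SetLike.exists_of_lt (lt_of_le_of_ne hLM hL)
        exact absurd hs (not_isSteinbergLattice_typeB_between hn2 hω hα0 hz hLM hl hl' hm hm')

theorem isListed_of_typeD (hn : 3 ≤ n) {Λ : AddSubgroup (E n)}
    (h : IsReflectionLattice (G 2 2 n) Λ) (hs : IsSteinbergLattice (G 2 2 n) Λ) :
    IsListed (semidirect (G 2 2 n) Λ) := by
  set i : Fin n := ⟨0, by omega⟩ with hi
  set j : Fin n := ⟨1, by omega⟩ with hj
  have hij : i ≠ j := by simp [hi, hj]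
  have hM : IsPlaneLattice (coeff Λ (e i - e j)) :=
    h.isPlaneLattice_coeff (exchange_mem_G hij (one_pow 2))
      (by simpa using e_sub_ne_zero hij 1) (coordSub_ne_zero hij 1)
      (fun v => by rw [sub_exchange hij]; simp [coordSub_apply])
  obtain ⟨ω, hω, α, hα, hz⟩ := hM.exists_modularStrip
  have hα0 := im_ne_zero_of_mem_modularStrip hα
  rw [h.eq_sumLattice_typeD hn hij] at hs ⊢
  rcases hn.eq_or_lt with rfl | hn4
  · exact isListed_typeD3 hω hα hz
  · exact absurd hs (not_isSteinbergLattice_typeD hn4 hω hα0 hz)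

end Listing

/-! ### The dihedral groups `G(3,3,2)` and `G(4,4,2)` -/

section Dihedral

theorem conj_mem_iff {V V' : Type*} [NormedAddCommGroup V] [InnerProductSpace ℂ V]
    [NormedAddCommGroup V'] [InnerProductSpace ℂ V'] {G : Subgroup (V ≃ₗ[ℂ] V)}
    {G' : Subgroup (V' ≃ₗ[ℂ] V')} (φ : V ≃ₗ[ℂ] V')
    (h : ∀ g ∈ G, ∃ g' ∈ G', ∀ v, φ (g v) = g' (φ v))
    (h' : ∀ g' ∈ G', ∃ g ∈ G, ∀ v, φ (g v) = g' (φ v)) (g : V ≃ₗ[ℂ] V) :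
    g ∈ G ↔ (φ.symm.trans g).trans φ ∈ G' := by
  constructor
  · intro hg
    obtain ⟨g', hg', hv⟩ := h g hg
    convert hg' using 1
    ext v
    simp [hv]
  · intro hg
    obtain ⟨k, hk, hv⟩ := h' _ hg
    convert hk using 1
    ext1 v
    apply φ.injective
    rw [hv]
    simp

/-- The elements of the dihedral group `G(r,r,2)`. -/
theorem mem_G_dihedral {r : ℕ} (hr : 1 ≤ r) {g : E 2 ≃ₗ[ℂ] E 2} :
    g ∈ G r r 2 ↔ ∃ (σ : Equiv.Perm (Fin 2)) (c : ℂˣ), c ^ r = 1 ∧ g = monomial σ ![c, c⁻¹] := by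
  rw [mem_G]
  constructor
  · rintro ⟨σ, c, hc, hc', rfl⟩
    refine ⟨σ, c 0, hc 0, ?_⟩
    rw [Nat.div_self hr, pow_one, Fin.prod_univ_two] at hc'
    congr 1
    ext1 i
    fin_cases i
    · rfl
    · exact eq_inv_of_mul_eq_one_right hc'
  · rintro ⟨σ, c, hc, rfl⟩
    refine ⟨σ, _, fun i => ?_, ?_, rfl⟩
    · fin_cases i <;> simp [hc]
    · simp [Fin.prod_univ_two]

theorem monomial_dihedral_one (c d : ℂˣ) (v : E 2) :
    monomial 1 ![c, d] v = !₂[(c : ℂ) * v 0, (d : ℂ) * v 1] := by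
  ext i
  fin_cases i <;> rfl

theorem monomial_dihedral_swap (c d : ℂˣ) (v : E 2) :
    monomial (Equiv.swap 0 1) ![c, d] v = !₂[(c : ℂ) * v 1, (d : ℂ) * v 0] := by
  ext i
  fin_cases i <;> rfl

section Three

variable {ζ : ℂ}

/-- The linear map `(x, y) ↦ (x + y, ζx + ζ²y, ζ²x + ζy)` identifying `G(3,3,2)` with `W(A_2)`,
for `ζ` a primitive third root of unity. -/
def dihedralThree (hζ : ζ ^ 2 + ζ + 1 = 0) : E 2 ≃ₗ[ℂ] sumZero 3 where
  toFun v := ⟨!₂[v 0 + v 1, ζ * v 0 + ζ ^ 2 * v 1, ζ ^ 2 * v 0 + ζ * v 1], by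
    change ∑ i, (!₂[v 0 + v 1, ζ * v 0 + ζ ^ 2 * v 1, ζ ^ 2 * v 0 + ζ * v 1] : E 3) i = 0
    rw [Fin.sum_univ_three]
    simp
    linear_combination (v 0 + v 1) * hζ⟩
  invFun v := !₂[((v : E 3) 0 + ζ ^ 2 * (v : E 3) 1 + ζ * (v : E 3) 2) / 3,
    ((v : E 3) 0 + ζ * (v : E 3) 1 + ζ ^ 2 * (v : E 3) 2) / 3]
  map_add' u v := by ext i; fin_cases i <;> simp <;> ring
  map_smul' a v := by ext i; fin_cases i <;> simp <;> ring
  left_inv v := by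
    ext i
    fin_cases i <;> simp
    · linear_combination ((v 0 * (2 * ζ - 2) + v 1 * (ζ ^ 2 - ζ + 1)) / 3) * hζ
    · linear_combination ((v 1 * (2 * ζ - 2) + v 0 * (ζ ^ 2 - ζ + 1)) / 3) * hζ
  right_inv v := by
    have hs : (v : E 3) 0 + (v : E 3) 1 + (v : E 3) 2 = 0 := by
      have : ∑ i, (v : E 3) i = 0 := v.2
      rwa [Fin.sum_univ_three] at this
    ext i
    fin_cases i <;> simp
    · linear_combination (((v : E 3) 1 + (v : E 3) 2) / 3) * hζ - hs / 3
    · linear_combination (((v : E 3) 0 + 2 * (ζ - 1) * (v : E 3) 1 + (v : E 3) 2 +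
        ζ * (ζ - 1) * (v : E 3) 2) / 3) * hζ - hs / 3
    · linear_combination (((v : E 3) 0 + 2 * (ζ - 1) * (v : E 3) 2 + (v : E 3) 1 +
        ζ * (ζ - 1) * (v : E 3) 1) / 3) * hζ - hs / 3

theorem perm_fin_three (σ : Equiv.Perm (Fin 3)) :
    ∃ j : Fin 3, σ = (Equiv.addRight j).symm ∨ σ = Equiv.subLeft (-j) := by
  revert σ
  decide

theorem dihedralThree_conj (hζ : ζ ^ 2 + ζ + 1 = 0) (g : E 2 ≃ₗ[ℂ] E 2) :
    g ∈ G 3 3 2 ↔ ((dihedralThree hζ).symm.trans g).trans (dihedralThree hζ) ∈ weylA 3 := by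
  have h3 : ζ ^ 3 = 1 := by linear_combination (ζ - 1) * hζ
  have hζ0 : ζ ≠ 0 := by rintro rfl; simp at h3
  let u : ℂˣ := Units.mk0 ζ hζ0
  have hu : (u : ℂ) = ζ := rfl
  have hu3 : u ^ 3 = 1 := Units.ext (by simpa [hu] using h3)
  have huv : ∀ k : ℕ, ((u ^ k : ℂˣ) : ℂ) = ζ ^ k := fun k => by simp [hu]
  have huv' : ∀ k : ℕ, (((u ^ k)⁻¹ : ℂˣ) : ℂ) = (ζ ^ 2) ^ k := fun k => by
    rw [Units.val_inv_eq_inv_val, huv, ← inv_pow]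
    congr 1
    exact inv_eq_of_mul_eq_one_right (by rw [← h3]; ring)
  have hφ : ∀ v : E 2, (dihedralThree hζ v : E 3) =
      !₂[v 0 + v 1, ζ * v 0 + ζ ^ 2 * v 1, ζ ^ 2 * v 0 + ζ * v 1] := fun v => rfl
  have hpow : ∀ j : Fin 3, (u ^ (j : ℕ)) ^ 3 = 1 := fun j => by rw [pow_right_comm, hu3, one_pow]
  have k1 : (-1 + -1 : Fin 3) = 1 := rfl
  have k2 : (-1 + -2 : Fin 3) = 0 := rfl
  have k3 : (-2 + -1 : Fin 3) = 0 := rfl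
  have k4 : (-2 + -2 : Fin 3) = 2 := rfl
  -- diagonal elements correspond to cyclic shifts, the others to the transpositions
  have hrot : ∀ (j : Fin 3) v, dihedralThree hζ (monomial 1 ![u ^ (j : ℕ), (u ^ (j : ℕ))⁻¹] v) =
      permute (Equiv.addRight j).symm (dihedralThree hζ v) := by
    intro j v
    rw [monomial_dihedral_one, huv, huv']
    ext i
    rw [permute_apply]
    fin_cases j <;> fin_cases i <;> simp [hφ] <;> grind only
  have hrefl : ∀ (j : Fin 3) v,
      dihedralThree hζ (monomial (Equiv.swap 0 1) ![u ^ (j : ℕ), (u ^ (j : ℕ))⁻¹] v) =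
      permute (Equiv.subLeft (-j)) (dihedralThree hζ v) := by
    intro j v
    rw [monomial_dihedral_swap, huv, huv']
    ext i
    rw [permute_apply]
    fin_cases j <;> fin_cases i <;> simp [hφ, k1, k2, k3, k4] <;> grind only
  refine conj_mem_iff (V' := sumZero 3) (dihedralThree hζ) (fun g hg => ?_) (fun g' hg' => ?_) g
  · obtain ⟨σ, c, hc, rfl⟩ := (mem_G_dihedral (by norm_num)).1 hg
    obtain ⟨j, rfl⟩ : ∃ j : Fin 3, c = u ^ (j : ℕ) := by
      have hc' : (c : ℂ) ^ 3 = 1 := by rw [← Units.val_pow_eq_pow_val, hc, Units.val_one]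
      have hprod : ((c : ℂ) - 1) * ((c - ζ) * (c - ζ ^ 2)) = 0 := by
        linear_combination hc' - ((c : ℂ) ^ 2 - c) * hζ + (c - 1 : ℂ) * h3
      rcases mul_eq_zero.1 hprod with h | h
      · exact ⟨0, Units.ext (by simpa using sub_eq_zero.1 h)⟩
      rcases mul_eq_zero.1 h with h | h
      · exact ⟨1, Units.ext (by simpa [hu] using sub_eq_zero.1 h)⟩
      · exact ⟨2, Units.ext (by simpa [hu] using sub_eq_zero.1 h)⟩
    rcases perm_fin_two σ with rfl | rfl
    · exact ⟨_, mem_weylA.2 ⟨_, rfl⟩, hrot j⟩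
    · exact ⟨_, mem_weylA.2 ⟨_, rfl⟩, hrefl j⟩
  · obtain ⟨σ, rfl⟩ := mem_weylA.1 hg'
    obtain ⟨j, rfl | rfl⟩ := perm_fin_three σ
    · exact ⟨_, (mem_G_dihedral (by norm_num)).2 ⟨_, _, hpow j, rfl⟩, hrot j⟩
    · exact ⟨_, (mem_G_dihedral (by norm_num)).2 ⟨_, _, hpow j, rfl⟩, hrefl j⟩

theorem isListed_dihedral_three {Λ : AddSubgroup (E 2)} (h : IsReflectionLattice (G 3 3 2) Λ) :
    IsListed (semidirect (G 3 3 2) Λ) := by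
  have hp := Complex.isPrimitiveRoot_exp 3 (by norm_num)
  have hζ := hp.geom_sum_eq_zero (by norm_num)
  set ζ := Complex.exp (2 * Real.pi * Complex.I / (3 : ℕ))
  have hζ' : ζ ^ 2 + ζ + 1 = 0 := by
    rw [Finset.sum_range_succ, Finset.sum_range_succ, Finset.sum_range_one] at hζ
    linear_combination hζ
  have hφ : ∀ t, t ∈ Λ ↔ dihedralThree hζ' t ∈
      Λ.map (dihedralThree hζ').toLinearMap.toAddMonoidHom := fun t =>
    ⟨fun ht => ⟨t, ht, rfl⟩, fun ⟨s, hs, hst⟩ => by rwa [← (dihedralThree hζ').injective hst]⟩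
  have h' := h.transfer (V' := sumZero 3) _ (dihedralThree_conj hζ') hφ
  exact (isListed_weylA (by norm_num) h').of_equivalent (V' := sumZero 3)
    (equivalent_semidirect (V' := sumZero 3) h.inv h'.inv _ (dihedralThree_conj hζ') hφ)

end Three

section Four

/-- The linear map `(x, y) ↦ (x + y, i(x - y))` identifying `G(4,4,2)` with `G(2,1,2)`. -/
def dihedralFour : E 2 ≃ₗ[ℂ] E 2 where
  toFun v := !₂[v 0 + v 1, Complex.I * (v 0 - v 1)]
  invFun v := !₂[(v 0 - Complex.I * v 1) / 2, (v 0 + Complex.I * v 1) / 2]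
  map_add' u v := by ext i; fin_cases i <;> simp <;> ring
  map_smul' a v := by ext i; fin_cases i <;> simp <;> ring
  left_inv v := by
    ext i
    fin_cases i <;> simp
    · linear_combination (-(v 0 - v 1) / 2) * Complex.I_mul_I
    · linear_combination ((v 0 - v 1) / 2) * Complex.I_mul_I
  right_inv v := by
    ext i
    fin_cases i <;> simp
    · ring
    · linear_combination (-(v 1)) * Complex.I_mul_I

theorem units_pow_four {c : ℂˣ} (hc : c ^ 4 = 1) :
    (c : ℂ) = 1 ∨ (c : ℂ) = -1 ∨ (c : ℂ) = Complex.I ∨ (c : ℂ) = -Complex.I := by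
  have h : (c : ℂ) ^ 4 = 1 := by rw [← Units.val_pow_eq_pow_val, hc, Units.val_one]
  have h1 : ((c : ℂ) - 1) * ((c + 1) * ((c - Complex.I) * (c + Complex.I))) = 0 := by
    linear_combination h - ((c : ℂ) ^ 2 - 1) * Complex.I_mul_I
  rcases mul_eq_zero.1 h1 with h1 | h1
  · exact Or.inl (sub_eq_zero.1 h1)
  rcases mul_eq_zero.1 h1 with h1 | h1
  · exact Or.inr (Or.inl (eq_neg_of_add_eq_zero_left h1))
  rcases mul_eq_zero.1 h1 with h1 | h1
  · exact Or.inr (Or.inr (Or.inl (sub_eq_zero.1 h1)))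
  · exact Or.inr (Or.inr (Or.inr (eq_neg_of_add_eq_zero_left h1)))

theorem dihedralFour_conj (g : E 2 ≃ₗ[ℂ] E 2) :
    g ∈ G 4 4 2 ↔ (dihedralFour.symm.trans g).trans dihedralFour ∈ G 2 1 2 := by
  let u : ℂˣ := Units.mk0 Complex.I Complex.I_ne_zero
  have hu : (u : ℂ) = Complex.I := rfl
  have hu' : ((u⁻¹ : ℂˣ) : ℂ) = -Complex.I := by rw [Units.val_inv_eq_inv_val, hu, Complex.inv_I]
  have hu2 : u ^ 2 = -1 := Units.ext (by simp [hu])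
  have hu4 : u ^ 4 = 1 := by rw [show 4 = 2 * 2 from rfl, pow_mul, hu2]; simp
  have hmem : ∀ (σ : Equiv.Perm (Fin 2)) (c d : ℂˣ), c ^ 2 = 1 → d ^ 2 = 1 →
      monomial σ ![c, d] ∈ G 2 1 2 := fun σ c d hc hd =>
    mem_G.2 ⟨σ, _, fun i => by fin_cases i <;> simp [hc, hd],
      by simp [Fin.prod_univ_two, mul_pow, hc, hd], rfl⟩
  have h1 : (1 : ℂˣ) ^ 2 = 1 := one_pow 2
  have h2 : (-1 : ℂˣ) ^ 2 = 1 := by simp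
  have hφ : ∀ v, dihedralFour v = !₂[v 0 + v 1, Complex.I * (v 0 - v 1)] := fun v => rfl
  have hI := Complex.I_mul_I
  -- the correspondence between the eight elements of the two groups
  have t1 : ∀ v, dihedralFour (monomial 1 ![1, 1⁻¹] v) =
    monomial 1 ![1, 1] (dihedralFour v) := fun v => by
    rw [monomial_dihedral_one, monomial_dihedral_one, hφ]
    ext i
    fin_cases i <;> simp [hφ]
  have t2 : ∀ v, dihedralFour (monomial 1 ![-1, (-1)⁻¹] v) =
    monomial 1 ![-1, -1] (dihedralFour v) := fun v => by
    rw [monomial_dihedral_one, monomial_dihedral_one, hφ]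
    ext i
    fin_cases i <;> simp [hφ] <;> grind only
  have t3 : ∀ v, dihedralFour (monomial 1 ![u, u⁻¹] v) =
    monomial (Equiv.swap 0 1) ![1, -1] (dihedralFour v) := fun v => by
    rw [monomial_dihedral_one, monomial_dihedral_swap, hφ]
    ext i
    fin_cases i <;> simp [hφ, hu, hu'] <;> grind only
  have t4 : ∀ v, dihedralFour (monomial 1 ![-u, (-u)⁻¹] v) =
    monomial (Equiv.swap 0 1) ![-1, 1] (dihedralFour v) := fun v => by
    rw [monomial_dihedral_one, monomial_dihedral_swap, hφ]
    ext i
    fin_cases i <;> simp [hφ, hu, hu'] <;> grind only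
  have t5 : ∀ v, dihedralFour (monomial (Equiv.swap 0 1) ![1, 1⁻¹] v) =
    monomial 1 ![1, -1] (dihedralFour v) := fun v => by
    rw [monomial_dihedral_swap, monomial_dihedral_one, hφ]
    ext i
    fin_cases i <;> simp [hφ] <;> grind only
  have t6 : ∀ v, dihedralFour (monomial (Equiv.swap 0 1) ![-1, (-1)⁻¹] v) =
    monomial 1 ![-1, 1] (dihedralFour v) := fun v => by
    rw [monomial_dihedral_swap, monomial_dihedral_one, hφ]
    ext i
    fin_cases i <;> simp [hφ]
    grind only
  have t7 : ∀ v, dihedralFour (monomial (Equiv.swap 0 1) ![u, u⁻¹] v) =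
    monomial (Equiv.swap 0 1) ![-1, -1] (dihedralFour v) := fun v => by
    rw [monomial_dihedral_swap, monomial_dihedral_swap, hφ]
    ext i
    fin_cases i <;> simp [hφ, hu, hu'] <;> grind only
  have t8 : ∀ v, dihedralFour (monomial (Equiv.swap 0 1) ![-u, (-u)⁻¹] v) =
    monomial (Equiv.swap 0 1) ![1, 1] (dihedralFour v) := fun v => by
    rw [monomial_dihedral_swap, monomial_dihedral_swap, hφ]
    ext i
    fin_cases i <;> simp [hφ, hu, hu'] <;> grind only
  refine conj_mem_iff dihedralFour (fun g hg => ?_) (fun g' hg' => ?_) g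
  · obtain ⟨σ, c, hc, rfl⟩ := (mem_G_dihedral (by norm_num)).1 hg
    obtain rfl | rfl | rfl | rfl : c = 1 ∨ c = -1 ∨ c = u ∨ c = -u := by
      rcases units_pow_four hc with h | h | h | h
      · exact Or.inl (Units.ext h)
      · exact Or.inr (Or.inl (Units.ext (by rw [h, Units.val_neg, Units.val_one])))
      · exact Or.inr (Or.inr (Or.inl (Units.ext (by rw [h, hu]))))
      · exact Or.inr (Or.inr (Or.inr (Units.ext (by rw [h, Units.val_neg, hu]))))
    all_goals rcases perm_fin_two σ with rfl | rfl
    · exact ⟨_, hmem _ _ _ h1 h1, t1⟩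
    · exact ⟨_, hmem _ _ _ h1 h2, t5⟩
    · exact ⟨_, hmem _ _ _ h2 h2, t2⟩
    · exact ⟨_, hmem _ _ _ h2 h1, t6⟩
    · exact ⟨_, hmem _ _ _ h1 h2, t3⟩
    · exact ⟨_, hmem _ _ _ h2 h2, t7⟩
    · exact ⟨_, hmem _ _ _ h2 h1, t4⟩
    · exact ⟨_, hmem _ _ _ h1 h1, t8⟩
  · have hmem' : ∀ (σ : Equiv.Perm (Fin 2)) (c : ℂˣ), c ^ 4 = 1 → monomial σ ![c, c⁻¹] ∈ G 4 4 2 :=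
      fun σ c hc => (mem_G_dihedral (by norm_num)).2 ⟨σ, c, hc, rfl⟩
    have k1 : (1 : ℂˣ) ^ 4 = 1 := one_pow 4
    have k2 : (-1 : ℂˣ) ^ 4 = 1 := Even.neg_one_pow (by decide)
    have k4 : (-u) ^ 4 = 1 := by rw [Even.neg_pow (by decide), hu4]
    obtain ⟨σ, c, hc, -, rfl⟩ := mem_G.1 hg'
    obtain ⟨a, b, rfl⟩ : ∃ a b, c = ![a, b] := ⟨c 0, c 1, by ext1 i; fin_cases i <;> rfl⟩
    obtain rfl | rfl := units_sq_eq_one (hc 0) <;> obtain rfl | rfl := units_sq_eq_one (hc 1)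
    all_goals rcases perm_fin_two σ with rfl | rfl
    · exact ⟨_, hmem' _ _ k1, t1⟩
    · exact ⟨_, hmem' _ _ k4, t8⟩
    · exact ⟨_, hmem' _ _ k1, t5⟩
    · exact ⟨_, hmem' _ _ hu4, t3⟩
    · exact ⟨_, hmem' _ _ k2, t6⟩
    · exact ⟨_, hmem' _ _ k4, t4⟩
    · exact ⟨_, hmem' _ _ k2, t2⟩
    · exact ⟨_, hmem' _ _ hu4, t7⟩

theorem isListed_dihedral_four {Λ : AddSubgroup (E 2)} (h : IsReflectionLattice (G 4 4 2) Λ)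
    (hs : IsSteinbergLattice (G 4 4 2) Λ) : IsListed (semidirect (G 4 4 2) Λ) := by
  have hφ : ∀ t, t ∈ Λ ↔ dihedralFour t ∈ Λ.map dihedralFour.toLinearMap.toAddMonoidHom := fun t =>
    ⟨fun ht => ⟨t, ht, rfl⟩, fun ⟨s, hs, hst⟩ => by rwa [← dihedralFour.injective hst]⟩
  have h' := h.transfer _ dihedralFour_conj hφ
  exact (isListed_of_typeB (by norm_num) h' (hs.transfer _ dihedralFour_conj hφ)).of_equivalent
    (equivalent_semidirect h.inv h'.inv _ dihedralFour_conj hφ)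

end Four

end Dihedral

/-! ### The crystallographic restriction and the dihedral group `G(6,6,2)` -/

section Six

theorem two_dvd_of_half_mem {M : AddSubgroup ℂ} {ω α : ℂ} (hω : ω ≠ 0) (hα : α.im ≠ 0)
    (hM : ∀ z, z ∈ M ↔ ω⁻¹ * z ∈ zPlus α) {z : ℂ} (hz : z ∈ M) {a b : ℤ}
    (h : 2 * z = ω * (a + b * α)) : 2 ∣ a ∧ 2 ∣ b :=
  two_dvd_of_mem_double hω hα hM (h ▸ two_mul_mem_double hz)

/-- The action of the rotation `diag(c, c⁻¹)` on multiples of the roots `e_0 - a e_1`. -/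
theorem smul_root_mem_of_rotate {r : ℕ} (hr : 1 ≤ r) {Λ : AddSubgroup (E 2)}
    (hΛ : IsInvariant (G r r 2) Λ) {c : ℂˣ} (hc : c ^ r = 1) {x a : ℂ}
    (h : x • (e 0 - a • e 1) ∈ Λ) :
    (c * x) • (e 0 - (((c⁻¹ : ℂˣ) : ℂ) ^ 2 * a) • e 1) ∈ Λ := by
  have h1 := hΛ _ ((mem_G_dihedral hr).2 ⟨1, c, hc, rfl⟩) _ h
  convert h1 using 1
  rw [monomial_dihedral_one]
  have hcc := c.mul_inv
  ext i
  fin_cases i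
  · simp [e_apply]
  · simp [e_apply]
    field_simp

/-- Applying `1 - g` for the reflection `g` exchanging the two coordinates up to `c`. -/
theorem smul_root_mem_of_reflect {r : ℕ} {Λ : AddSubgroup (E 2)}
    (hΛ : IsInvariant (G r r 2) Λ) {c : ℂˣ} (hc : c ^ r = 1) {x a : ℂ}
    (h : x • (e 0 - a • e 1) ∈ Λ) :
    (x * (1 + c * a)) • (e 0 - ((c⁻¹ : ℂˣ) : ℂ) • e 1) ∈ Λ := by
  have h1 := Λ.sub_mem h (hΛ _ (exchange_mem_G (p := r) (show (0 : Fin 2) ≠ 1 by decide) hc) _ h)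
  rw [sub_exchange (by decide)] at h1
  convert h1 using 2
  simp [e_apply]
  ring

theorem isPlaneLattice_dihedral {r : ℕ} {Λ : AddSubgroup (E 2)}
    (h : IsReflectionLattice (G r r 2) Λ) : IsPlaneLattice (coeff Λ (e 0 - e 1)) :=
  h.isPlaneLattice_coeff (exchange_mem_G zero_ne_one (one_pow r))
    (by simpa using e_sub_ne_zero (show (0 : Fin 2) ≠ 1 by decide) 1)
    (coordSub_ne_zero (show (0 : Fin 2) ≠ 1 by decide) 1)
    (fun v => by rw [sub_exchange zero_ne_one]; simp [coordSub_apply])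

/-- The crystallographic restriction: composing two reflections of `G(r,r,2)` shows that
multiplication by `2 + ζ + ζ⁻¹` preserves a lattice in `ℂ`, so this real number is an integer. -/
theorem dihedral_order {r : ℕ} (hr : 3 ≤ r) {Λ : AddSubgroup (E 2)}
    (h : IsReflectionLattice (G r r 2) Λ) : r = 3 ∨ r = 4 ∨ r = 6 := by
  obtain ⟨ω, hω, α, hα, hM⟩ := (isPlaneLattice_dihedral h).exists_modularStrip
  have hα0 := im_ne_zero_of_mem_modularStrip hα
  have hp := Complex.isPrimitiveRoot_exp r (by omega)
  set ζ := Complex.exp (2 * Real.pi * Complex.I / r)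
  have hζr := hp.pow_eq_one
  have hζ0 : ζ ≠ 0 := hp.ne_zero (by omega)
  have hn : ‖ζ‖ = 1 := Complex.norm_eq_one_of_pow_eq_one hζr (by omega)
  let u : ℂˣ := Units.mk0 ζ hζ0
  have hu : (u : ℂ) = ζ := rfl
  have hur : u ^ r = 1 := Units.ext (by simpa [hu] using hζr)
  have h1 : ω • (e 0 - (1 : ℂ) • e 1) ∈ Λ := by
    have := mem_of_basis hω hM 1 0
    simpa [mem_coeff] using this
  have h2 := smul_root_mem_of_reflect h.inv (one_pow r)
    (smul_root_mem_of_reflect h.inv hur h1)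
  have hinv : ζ⁻¹ = (starRingEnd ℂ) ζ := Complex.inv_eq_conj hn
  have hreal : ζ + ζ⁻¹ = ((2 * ζ.re : ℝ) : ℂ) := by rw [hinv, Complex.add_conj]
  obtain ⟨k, hk⟩ := int_of_smul_mem hω hα0 hM (2 + 2 * ζ.re) (by
    have h3 : (ω * (1 + (u : ℂ) * 1) * (1 + ((1 : ℂˣ) : ℂ) * ((u⁻¹ : ℂˣ) : ℂ))) ∈
        coeff Λ (e 0 - e 1) := by simpa [mem_coeff] using h2
    convert h3 using 1
    rw [Complex.ofReal_add, ← hreal, Units.val_inv_eq_inv_val, hu, Units.val_one]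
    push_cast
    field_simp
    ring)
  have hre := abs_le.1 ((Complex.abs_re_le_norm ζ).trans hn.le)
  have hk0 : (0 : ℝ) ≤ k := by rw [← hk]; linarith
  have hk4 : (k : ℝ) ≤ 4 := by rw [← hk]; linarith
  have hk0' : 0 ≤ k := by exact_mod_cast hk0
  have hk4' : k ≤ 4 := by exact_mod_cast hk4
  have hquad : ζ ^ 2 - (k - 2) * ζ + 1 = 0 := by
    have h5 : ζ + ζ⁻¹ = k - 2 := by
      rw [hreal, show 2 * ζ.re = (k : ℝ) - 2 by linarith]
      push_cast
      rfl
    rw [← h5]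
    field_simp
    ring
  have hdvd : ∀ m : ℕ, ζ ^ m = 1 → r ∣ m := fun m => hp.dvd_of_pow_eq_one m
  interval_cases k
  · have : ζ ^ 2 = 1 := by
      have h6 : (ζ + 1) ^ 2 = 0 := by
        push_cast at hquad
        linear_combination hquad
      rw [eq_neg_of_add_eq_zero_left (pow_eq_zero_iff two_ne_zero |>.1 h6)]
      norm_num
    have := Nat.le_of_dvd (by norm_num) (hdvd 2 this)
    omega
  · have := hdvd 3 (by push_cast at hquad; linear_combination (ζ - 1) * hquad)
    have := Nat.le_of_dvd (by norm_num) this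
    omega
  · have := hdvd 4 (by push_cast at hquad; linear_combination (ζ ^ 2 - 1) * hquad)
    have h7 := Nat.le_of_dvd (by norm_num) this
    interval_cases r <;> simp_all
  · have := hdvd 6 (by
      push_cast at hquad
      linear_combination (ζ ^ 3 - 1) * (ζ + 1) * hquad)
    have h7 := Nat.le_of_dvd (by norm_num) this
    interval_cases r <;> simp_all
  · have : ζ ^ 1 = 1 := by
      have h6 : (ζ - 1) ^ 2 = 0 := by
        push_cast at hquad
        linear_combination hquad
      rw [sub_eq_zero.1 (pow_eq_zero_iff two_ne_zero |>.1 h6)]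
      norm_num
    have := Nat.le_of_dvd (by norm_num) (hdvd 1 this)
    omega

/-- No lattice for the Weyl group `G(6,6,2)` of type `G_2` has the Steinberg property: with
`M = ω(ℤ + ℤα)` the coefficients of the root `e_0 - e_1`, half the lattice vector
`ω(e_0 - e_1) + ωα(ζe_0 - ζ⁻¹e_1)` is fixed by a point inversion but by no reflection. -/
theorem not_isSteinbergLattice_dihedral_six {Λ : AddSubgroup (E 2)}
    (h : IsReflectionLattice (G 6 6 2) Λ) : ¬ IsSteinbergLattice (G 6 6 2) Λ := by
  intro hs
  obtain ⟨ω, hω, α, hα, hM⟩ := (isPlaneLattice_dihedral h).exists_modularStrip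
  have hα0 := im_ne_zero_of_mem_modularStrip hα
  have hp := Complex.isPrimitiveRoot_exp 6 (by norm_num)
  set ζ := Complex.exp (2 * Real.pi * Complex.I / (6 : ℕ))
  have hζ : ζ ^ 2 = ζ - 1 := by
    have h3 : ζ ^ 3 = -1 := by
      have h3' := hp.pow_ne_one_of_pos_of_lt (l := 3) (by norm_num) (by norm_num)
      have : (ζ ^ 3 - 1) * (ζ ^ 3 + 1) = 0 := by linear_combination hp.pow_eq_one
      exact eq_neg_of_add_eq_zero_left ((mul_eq_zero.1 this).resolve_left (sub_ne_zero.2 h3'))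
    have h1 : ζ + 1 ≠ 0 := fun h1 => by
      refine hp.pow_ne_one_of_pos_of_lt (l := 2) (by norm_num) (by norm_num) ?_
      rw [eq_neg_of_add_eq_zero_left h1]
      norm_num
    have : (ζ + 1) * (ζ ^ 2 - ζ + 1) = 0 := by linear_combination h3
    linear_combination (mul_eq_zero.1 this).resolve_left h1
  have hζ0 : ζ ≠ 0 := hp.ne_zero (by norm_num)
  let u : ℂˣ := Units.mk0 ζ hζ0
  have hu : (u : ℂ) = ζ := rfl
  have hui : ((u⁻¹ : ℂˣ) : ℂ) = 1 - ζ := by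
    rw [Units.val_inv_eq_inv_val, hu]
    refine inv_eq_of_mul_eq_one_right ?_
    linear_combination -hζ
  have hu6 : u ^ 6 = 1 := Units.ext (by simpa [hu] using hp.pow_eq_one)
  have hu6' : (u⁻¹) ^ 6 = 1 := by rw [inv_pow, hu6, inv_one]
  have h1 : ω • (e 0 - (1 : ℂ) • e 1) ∈ Λ := by
    simpa [mem_coeff] using mem_of_basis hω hM 1 0
  have h2 : (ω * α) • (e 0 - (1 : ℂ) • e 1) ∈ Λ := by
    simpa [mem_coeff] using mem_of_basis hω hM 0 1
  have h2' := smul_root_mem_of_rotate (by norm_num) h.inv hu6 h2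
  let v : E 2 := !₂[ω * (1 + α * ζ) / 2, -(ω * (1 + α * (1 - ζ))) / 2]
  have hv0 : v 0 = ω * (1 + α * ζ) / 2 := rfl
  have hv1 : v 1 = -(ω * (1 + α * (1 - ζ))) / 2 := rfl
  obtain ⟨g, hg, hgr, hgv⟩ := hs v ⟨monomial 1 ![-1, (-1)⁻¹],
    (mem_G_dihedral (by norm_num)).2 ⟨1, -1, Even.neg_one_pow (by decide), rfl⟩, fun hone => by
      have := congrArg (fun k : E 2 ≃ₗ[ℂ] E 2 => k (e 0) 0) hone
      rw [monomial_dihedral_one] at this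
      simp [e_apply] at this
      norm_num at this, by
      convert Λ.add_mem h1 h2' using 1
      rw [monomial_dihedral_one, hui, hu]
      ext i
      fin_cases i
      · simp [e_apply, hv0]; ring
      · simp [e_apply, hv1]
        linear_combination (ω * α * (ζ - 1)) * hζ⟩
  -- every reflection exchanges the coordinates up to some `c = ζ^k`
  obtain ⟨c, hc, hcv⟩ : ∃ c : ℂˣ, c ^ 6 = 1 ∧
      (v 0 - c * v 1) • (e 0 - ((c⁻¹ : ℂˣ) : ℂ) • e 1) ∈ Λ := by
    obtain ⟨i, j, hij, c, hc, rfl⟩ | ⟨i, c, hc, -, hc', -⟩ := hgr.cases_of_mem_G hg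
    · rw [sub_exchange hij] at hgv
      have hij' : (i = 0 ∧ j = 1) ∨ (i = 1 ∧ j = 0) := by omega
      rcases hij' with ⟨rfl, rfl⟩ | ⟨rfl, rfl⟩
      · exact ⟨c, hc, hgv⟩
      · refine ⟨c⁻¹, by rw [inv_pow, hc, inv_one], ?_⟩
        convert hgv using 1
        have hcc := c.mul_inv
        ext i
        fin_cases i
        · simp [e_apply]; field_simp; ring
        · simp [e_apply]; field_simp; ring
    · exact absurd (by simpa using hc') hc
  obtain ⟨k, hk6, hck⟩ := hp.eq_pow_of_pow_eq_one (ξ := (c : ℂ))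
    (by rw [← Units.val_pow_eq_pow_val, hc, Units.val_one])
  obtain rfl : c = u ^ k := Units.ext (by rw [← hck]; simp [hu])
  have hz1 : ζ * (1 - ζ) = 1 := by linear_combination -hζ
  have hz2 : ζ ^ 2 * (1 - ζ) ^ 2 = 1 := by rw [← mul_pow, hz1, one_pow]
  have hrefl : ∀ {x a : ℂ}, x • (e 0 - a • e 1) ∈ Λ → x * (1 + a) ∈ coeff Λ (e 0 - e 1) := by
    intro x a hx
    simpa [mem_coeff] using smul_root_mem_of_reflect h.inv (one_pow 6) hx
  have hrot : ∀ {x a : ℂ}, x • (e 0 - a • e 1) ∈ Λ →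
      ((1 - ζ) * x) • (e 0 - (ζ ^ 2 * a) • e 1) ∈ Λ := by
    intro x a hx
    have := smul_root_mem_of_rotate (by norm_num) h.inv hu6' hx
    rwa [inv_inv, hui, hu] at this
  have hone : ∀ {x : ℂ}, x • (e 0 - (1 : ℂ) • e 1) ∈ Λ → x ∈ coeff Λ (e 0 - e 1) := by
    intro x hx
    rwa [one_smul] at hx
  have hci : (((u ^ k)⁻¹ : ℂˣ) : ℂ) = (1 - ζ) ^ k := by
    rw [← inv_pow, Units.val_pow_eq_pow_val, hui]
  rw [hci, ← hck, hv0, hv1] at hcv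
  interval_cases k
  · have := two_dvd_of_half_mem hω hα0 hM (hone (by simpa using hcv)) (a := 2) (b := 1)
      (by push_cast; ring)
    omega
  · have := two_dvd_of_half_mem hω hα0 hM (hrefl hcv) (a := 3) (b := 3)
      (by push_cast; grind only)
    omega
  · have hcv' := hrot hcv
    rw [hz2] at hcv'
    have := two_dvd_of_half_mem hω hα0 hM (hone hcv') (a := 1) (b := 2)
      (by push_cast; grind only)
    omega
  · have hcv' := hrot hcv
    have := two_dvd_of_half_mem hω hα0 hM (hrefl hcv') (a := 0) (b := 3)
      (by push_cast; grind only)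
    omega
  · have hcv' := hrot (hrot hcv)
    rw [show ζ ^ 2 * (ζ ^ 2 * (1 - ζ) ^ 4) = (ζ ^ 2 * (1 - ζ) ^ 2) ^ 2 by ring, hz2,
      one_pow] at hcv'
    have := two_dvd_of_half_mem hω hα0 hM (hone hcv') (a := -1) (b := 1)
      (by push_cast; grind only)
    omega
  · have := two_dvd_of_half_mem hω hα0 hM (hrefl hcv) (a := 3) (b := 0)
      (by push_cast; grind only)
    omega

end Six

/-! ### Real monomial groups -/

section Reality

/-- The trace does not depend on the basis, and in a suitable basis the matrix of `g` is real. -/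
theorem trace_im_eq_zero {V : Type*} [NormedAddCommGroup V] [InnerProductSpace ℂ V]
    {G : Subgroup (V ≃ₗ[ℂ] V)} (h : IsCoxeterComplexification G) {g : V ≃ₗ[ℂ] V} (hg : g ∈ G) :
    (LinearMap.trace ℂ V (g : V →ₗ[ℂ] V)).im = 0 := by
  obtain ⟨m, C, b, -, -, hC⟩ := h
  obtain ⟨A, -, hA⟩ := (hC g).1 hg
  rw [LinearMap.trace_eq_matrix_trace ℂ b, hA, Matrix.trace, Complex.im_sum]
  exact Finset.sum_eq_zero fun i _ => by simp

variable {n : ℕ}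

theorem trace_monomial (σ : Equiv.Perm (Fin n)) (c : Fin n → ℂˣ) :
    LinearMap.trace ℂ (E n) (monomial σ c : E n →ₗ[ℂ] E n) =
      ∑ i, if σ.symm i = i then (c i : ℂ) else 0 := by
  rw [LinearMap.trace_eq_matrix_trace ℂ (EuclideanSpace.basisFun (Fin n) ℂ).toBasis, Matrix.trace]
  refine Finset.sum_congr rfl fun i _ => ?_
  have h1 : (EuclideanSpace.basisFun (Fin n) ℂ).toBasis i = e i := by
    simp [e]
  rw [Matrix.diag_apply, LinearMap.toMatrix_apply, h1]
  change monomial σ c (e i) i = _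
  rw [monomial_apply, e_apply]
  split_ifs <;> simp

theorem sq_eq_one_of_im_eq_zero {r : ℕ} (hr : 1 ≤ r) {c : ℂˣ} (hc : c ^ r = 1)
    (him : (c : ℂ).im = 0) : c ^ 2 = 1 := by
  have hn : ‖(c : ℂ)‖ = 1 := Complex.norm_eq_one_of_pow_eq_one (n := r)
    (by rw [← Units.val_pow_eq_pow_val, hc, Units.val_one]) (by omega)
  have h1 : (c : ℂ) ^ 2 = 1 := by
    have h2 : (starRingEnd ℂ) (c : ℂ) = c := Complex.conj_eq_iff_im.2 him
    have h3 := Complex.mul_conj (c : ℂ)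
    rw [h2, Complex.normSq_eq_norm_sq, hn] at h3
    rw [sq, h3]
    norm_num
  exact Units.ext (by rw [Units.val_pow_eq_pow_val, h1, Units.val_one])

theorem exists_primitive_unit {r : ℕ} (hr : 1 ≤ r) :
    ∃ u : ℂˣ, u ^ r = 1 ∧ ∀ m, u ^ m = 1 → r ∣ m := by
  have hp := Complex.isPrimitiveRoot_exp r (by omega)
  refine ⟨Units.mk0 _ (hp.ne_zero (by omega)), Units.ext ?_, fun m hm => ?_⟩
  · simpa using hp.pow_eq_one
  · apply hp.dvd_of_pow_eq_one
    simpa using congrArg Units.val hm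

/-- If all elements of `G` preserve the line spanned by `(1, …, 1)` then `G` is reducible. -/
theorem not_actsIrreducibly_of_ones (hn : 2 ≤ n) {G : Subgroup (E n ≃ₗ[ℂ] E n)}
    (h : ∀ g ∈ G, ∃ a : ℂ, g (WithLp.toLp 2 fun _ => 1) = a • (WithLp.toLp 2 fun _ => 1 : E n)) :
    ¬ ActsIrreducibly G := by
  rintro ⟨-, hG⟩
  set w : E n := WithLp.toLp 2 fun _ => 1
  have hw : ∀ i, w i = 1 := fun i => rfl
  rcases hG (Submodule.span ℂ {w}) (fun g hg v hv => by
    obtain ⟨x, rfl⟩ := Submodule.mem_span_singleton.1 hv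
    obtain ⟨a, ha⟩ := h g hg
    rw [map_smul, ha]
    exact Submodule.smul_mem _ _ (Submodule.smul_mem _ _ (Submodule.mem_span_singleton_self w)))
    with h1 | h1
  · have h2 := Submodule.span_singleton_eq_bot.1 h1
    have h3 := hw ⟨0, by omega⟩
    rw [h2] at h3
    simp at h3
  · have h2 : e ⟨0, by omega⟩ ∈ Submodule.span ℂ {w} := by rw [h1]; trivial
    obtain ⟨x, hx⟩ := Submodule.mem_span_singleton.1 h2
    have h3 := congrArg (fun v : E n => v ⟨0, by omega⟩) hx
    have h4 := congrArg (fun v : E n => v ⟨1, by omega⟩) hx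
    simp [hw, e_apply] at h3 h4
    rw [h4] at h3
    simp at h3

theorem not_actsIrreducibly_one (hn : 2 ≤ n) {p : ℕ} : ¬ ActsIrreducibly (G 1 p n) := by
  refine not_actsIrreducibly_of_ones hn fun g hg => ⟨1, ?_⟩
  obtain ⟨σ, c, hc, -, rfl⟩ := mem_G.1 hg
  ext i
  rw [monomial_apply, ← pow_one (c i), hc i]
  simp

theorem not_actsIrreducibly_klein : ¬ ActsIrreducibly (G 2 2 2) := by
  refine not_actsIrreducibly_of_ones le_rfl fun g hg => ?_
  obtain ⟨σ, c, hc, rfl⟩ := (mem_G_dihedral (by norm_num)).1 hg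
  refine ⟨c, ?_⟩
  have hcc : c⁻¹ = c := inv_eq_of_mul_eq_one_right (by rw [← sq, hc])
  ext i
  rw [monomial_apply]
  fin_cases i <;> simp [hcc]

/-- A real irreducible `G(r,p,n)` with `n ≥ 2` is `G(r,r,2)`, `G(2,1,n)` or `G(2,2,n)`: traces of
suitable elements must be real. -/
theorem real_cases {r p : ℕ} (hr : 1 ≤ r) (hp : p ∣ r) (hn : 2 ≤ n)
    (h : IsCoxeterComplexification (G r p n)) (hi : ActsIrreducibly (G r p n)) :
    (r = 2 ∧ p = 1) ∨ (3 ≤ n ∧ r = 2 ∧ p = 2) ∨ (n = 2 ∧ 3 ≤ r ∧ p = r) := by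
  have hr1 : r ≠ 1 := by
    rintro rfl
    exact not_actsIrreducibly_one hn hi
  have hp0 : 0 < p := Nat.pos_of_dvd_of_pos hp (by omega)
  obtain ⟨u, hu, hdvd⟩ := exists_primitive_unit hr
  by_cases hr2 : r = 2
  · subst hr2
    rcases (Nat.dvd_prime Nat.prime_two).1 hp with rfl | rfl
    · exact Or.inl ⟨rfl, rfl⟩
    · refine Or.inr (Or.inl ⟨?_, rfl, rfl⟩)
      by_contra hn3
      obtain rfl : n = 2 := by omega
      exact not_actsIrreducibly_klein hi
  · have hr3 : 3 ≤ r := by omega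
    have hu2 : (u : ℂ).im ≠ 0 := by
      intro him
      have := Nat.le_of_dvd (by norm_num) (hdvd 2 (sq_eq_one_of_im_eq_zero hr hu him))
      omega
    by_cases hn2 : n = 2
    · subst hn2
      refine Or.inr (Or.inr ⟨rfl, hr3, ?_⟩)
      obtain ⟨q, rfl⟩ := hp
      have hq : p * q / p = q := Nat.mul_div_cancel_left q hp0
      have hmem : scaleCoord 0 (u ^ p) ∈ G (p * q) p 2 := by
        refine scaleCoord_mem_G 0 ?_ ?_
        · rw [pow_right_comm, hu, one_pow]
        · rw [hq, ← pow_mul, hu]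
      have him := trace_im_eq_zero h hmem
      rw [scaleCoord, trace_monomial, Fin.sum_univ_two] at him
      simp only [one_symm_apply, if_true, Function.update_self, ne_eq, one_ne_zero,
        not_false_eq_true, Function.update_of_ne, Pi.one_apply, Units.val_one, Complex.add_im,
        Complex.one_im, add_zero] at him
      have h2 := sq_eq_one_of_im_eq_zero (r := p * q) hr
        (by rw [pow_right_comm, hu, one_pow]) him
      rw [← pow_mul] at h2
      have hq2 : q ∣ 2 := Nat.dvd_of_mul_dvd_mul_left hp0 (hdvd _ h2)
      rcases (Nat.dvd_prime Nat.prime_two).1 hq2 with rfl | rfl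
      · rw [mul_one]
      · exfalso
        have hup : u ^ p = -1 := by
          refine (units_sq_eq_one (by rw [← pow_mul, hu])).resolve_left fun h1 => ?_
          have := Nat.le_of_dvd hp0 (hdvd p h1)
          omega
        have hmem : monomial 1 ![u, -u⁻¹] ∈ G (p * 2) p 2 := by
          refine mem_G.2 ⟨1, _, fun i => ?_, ?_, rfl⟩
          · fin_cases i
            · exact hu
            · change (-u⁻¹) ^ (p * 2) = 1
              rw [Even.neg_pow (by simp), inv_pow, hu, inv_one]
          · rw [hq, Fin.prod_univ_two]
            change (u * -u⁻¹) ^ 2 = 1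
            simp
        have him := trace_im_eq_zero h hmem
        rw [trace_monomial, Fin.sum_univ_two] at him
        have hn : ‖(u : ℂ)‖ = 1 := Complex.norm_eq_one_of_pow_eq_one (n := p * 2)
          (by rw [← Units.val_pow_eq_pow_val, hu, Units.val_one]) (by omega)
        simp only [one_symm_apply, if_true, Matrix.cons_val_zero, Matrix.cons_val_one,
          Units.val_neg, Units.val_inv_eq_inv_val, Complex.inv_eq_conj hn, Complex.add_im,
          Complex.neg_im, Complex.conj_im, neg_neg] at him
        exact hu2 (by linarith)
    · exfalso
      have hn3 : 3 ≤ n := by omega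
      let i₀ : Fin n := ⟨0, by omega⟩
      let i₁ : Fin n := ⟨1, by omega⟩
      let i₂ : Fin n := ⟨2, by omega⟩
      have h01 : i₀ ≠ i₁ := by simp [i₀, i₁]
      have h02 : i₀ ≠ i₂ := by simp [i₀, i₂]
      have h12 : i₁ ≠ i₂ := by simp [i₁, i₂]
      let c : Fin n → ℂˣ := Function.update (Function.update 1 i₁ u⁻¹) i₀ u
      have hc0 : c i₀ = u := Function.update_self _ _ _
      have hcs : ∀ i, i ≠ i₀ → i ≠ i₁ → c i = 1 := fun i h0 h1 => by simp [c, h0, h1]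
      have hmem : monomial (Equiv.swap i₁ i₂) c ∈ G r p n := by
        refine mem_G.2 ⟨_, _, fun i => ?_, ?_, rfl⟩
        · by_cases h0 : i = i₀
          · rw [h0, hc0, hu]
          · by_cases h1 : i = i₁
            · simp [c, h1, h01.symm, hu]
            · rw [hcs i h0 h1, one_pow]
        · simp only [c]
          rw [Finset.prod_update_of_mem (Finset.mem_univ _),
            Finset.prod_update_of_mem (by simp [h01.symm])]
          simp
      have him := trace_im_eq_zero h hmem
      rw [trace_monomial, Complex.im_sum, Finset.sum_eq_single i₀] at him
      · rw [Equiv.symm_swap, Equiv.swap_apply_of_ne_of_ne h01 h02, if_pos rfl, hc0] at him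
        exact hu2 him
      · intro i _ h0
        by_cases h1 : i = i₁
        · rw [h1, Equiv.symm_swap, Equiv.swap_apply_left, if_neg h12.symm, Complex.zero_im]
        · rw [hcs i h0 h1]
          split_ifs <;> simp
      · simp

/-- In dimension one, a real `G(r,p,1)` with a relatively dense reflection lattice is `{±1}`. -/
theorem real_cases_one {r p : ℕ} (hr : 1 ≤ r) (hp : p ∣ r)
    (h : IsCoxeterComplexification (G r p 1)) {Λ : AddSubgroup (E 1)}
    (hΛ : IsReflectionLattice (G r p 1) Λ) : G r p 1 = G 2 1 1 := by
  obtain ⟨q, rfl⟩ := hp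
  have hp0 : 0 < p := Nat.pos_of_mul_pos_right hr
  have hq0 : 1 ≤ q := Nat.pos_of_mul_pos_left hr
  have hq : p * q / p = q := Nat.mul_div_cancel_left q hp0
  have hmemG : ∀ {r' p' : ℕ}, r' / p' ∣ r' → ∀ g : E 1 ≃ₗ[ℂ] E 1, g ∈ G r' p' 1 ↔
      ∃ c : ℂˣ, c ^ (r' / p') = 1 ∧ g = scaleCoord 0 c := by
    intro r' p' hd g
    rw [mem_G]
    constructor
    · rintro ⟨σ, c, hc, hc', rfl⟩
      refine ⟨c 0, by simpa using hc', ?_⟩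
      rw [scaleCoord, Subsingleton.elim σ 1]
      congr 1
      ext1 i
      rw [Subsingleton.elim i 0, Function.update_self]
    · rintro ⟨c, hc, rfl⟩
      obtain ⟨k, hk⟩ := hd
      have hcr : c ^ r' = 1 := by rw [hk, pow_mul, hc, one_pow]
      refine ⟨1, _, fun i => ?_, ?_, rfl⟩
      · rw [Subsingleton.elim i 0, Function.update_self, hcr]
      · simpa using hc
  have hd : p * q / p ∣ p * q := by rw [hq]; exact Dvd.intro_left p rfl
  obtain ⟨u, hu, hdvd⟩ := exists_primitive_unit hq0
  have hmem : scaleCoord 0 u ∈ G (p * q) p 1 := (hmemG hd _).2 ⟨u, by rw [hq, hu], rfl⟩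
  have him := trace_im_eq_zero h hmem
  rw [scaleCoord, trace_monomial] at him
  simp [one_symm_apply] at him
  have hq2 := hdvd 2 (sq_eq_one_of_im_eq_zero hq0 hu him)
  rcases (Nat.dvd_prime Nat.prime_two).1 hq2 with rfl | rfl
  · exfalso
    have htriv : ∀ g ∈ G (p * 1) p 1, g = 1 := by
      intro g hg
      obtain ⟨c, hc, rfl⟩ := (hmemG hd g).1 hg
      rw [hq, pow_one] at hc
      subst hc
      ext v i
      simp [scaleCoord, monomial_apply, one_symm_apply]
    have hbot := hΛ.gen ⊥ (fun g _ t ht => by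
        rw [AddSubgroup.mem_bot] at ht ⊢
        rw [ht, map_zero])
      (fun g hg hgr => absurd (htriv g hg) hgr.1)
    obtain ⟨R, hR⟩ := hΛ.dense
    obtain ⟨t, ht, htR⟩ := hR (((|R| + 1 : ℝ) : ℂ) • e 0)
    rw [AddSubgroup.mem_bot.1 (hbot ht), sub_zero, norm_smul, Complex.norm_real,
      Real.norm_of_nonneg (by positivity)] at htR
    have he : ‖(e 0 : E 1)‖ = 1 := by simp [e]
    rw [he] at htR
    linarith [le_abs_self R]
  · ext g
    rw [hmemG hd, hmemG (by norm_num), hq]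

end Reality

/-! ### The classification -/

theorem isListed_of_isSteinbergLattice {r p n : ℕ} (hr : 1 ≤ r) (hp : p ∣ r) (hn : 1 ≤ n)
    (hc : IsCoxeterComplexification (G r p n)) (hi : ActsIrreducibly (G r p n))
    {Λ : AddSubgroup (E n)} (h : IsReflectionLattice (G r p n) Λ)
    (hs : IsSteinbergLattice (G r p n) Λ) : IsListed (semidirect (G r p n) Λ) := by
  rcases hn.eq_or_lt with rfl | hn2
  · have heq := real_cases_one hr hp hc h
    rw [heq] at h hs ⊢
    exact isListed_of_typeB hn h hs
  · obtain ⟨rfl, rfl⟩ | ⟨hn3, rfl, rfl⟩ | ⟨rfl, hr3, rfl⟩ := real_cases hr hp hn2 hc hi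
    · exact isListed_of_typeB hn h hs
    · exact isListed_of_typeD hn3 h hs
    · obtain rfl | rfl | rfl := dihedral_order hr3 h
      · exact isListed_dihedral_three h
      · exact isListed_dihedral_four h hs
      · exact absurd hs (not_isSteinbergLattice_dihedral_six h)

theorem hasSteinbergProperty_of_isListed {V : Type*} [NormedAddCommGroup V]
    [InnerProductSpace ℂ V] {W : Subgroup (V ≃ᵃ[ℂ] V)}
    (hW : ∀ w ∈ W, Isometry w) (h : IsListed W) : HasSteinbergProperty W := by
  obtain ⟨n, hn, α, -, h⟩ | ⟨n, hn, α, -, h⟩ | ⟨α, -, h⟩ := h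
  · refine HasSteinbergProperty.of_equivalent (V' := sumZero n) h hW ?_
    rw [latticeA_eq hn]
    exact (hasSteinbergProperty_iff (V := sumZero n) actsIsometrically_weylA
      (isInvariant_coordLatticeA _)).2 (isSteinbergLattice_coordLatticeA _)
  · refine HasSteinbergProperty.of_equivalent h hW ?_
    rw [latticeB_eq hn]
    exact (hasSteinbergProperty_iff (actsIsometrically_G (by norm_num))
      (isInvariant_sumLattice (double_le _))).2 (isSteinbergLattice_typeB _)
  · refine HasSteinbergProperty.of_equivalent h hW ?_
    rw [latticeD3_eq]
    exact (hasSteinbergProperty_iff (actsIsometrically_G (by norm_num))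
      (isInvariant_sumLattice le_rfl)).2 (isSteinbergLattice_typeD3 _)

end CrystRefl

end

theorem mainTheorem2 :
    (∀ n : ℕ, 2 ≤ n →
      ∀ Λ : AddSubgroup (CrystRefl.sumZero n),
        CrystRefl.IsInvariant (CrystRefl.weylA n) Λ →
        CrystRefl.IsCrystallographic (CrystRefl.semidirect (CrystRefl.weylA n) Λ) →
        (CrystRefl.HasSteinbergProperty (CrystRefl.semidirect (CrystRefl.weylA n) Λ) ↔
          CrystRefl.IsListed (CrystRefl.semidirect (CrystRefl.weylA n) Λ))) ∧
    (∀ r p n : ℕ, 1 ≤ r → p ∣ r → 1 ≤ n →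
      CrystRefl.IsCoxeterComplexification (CrystRefl.G r p n) →
      CrystRefl.ActsIrreducibly (CrystRefl.G r p n) →
      ∀ Λ : AddSubgroup (CrystRefl.E n),
        CrystRefl.IsInvariant (CrystRefl.G r p n) Λ →
        CrystRefl.IsCrystallographic (CrystRefl.semidirect (CrystRefl.G r p n) Λ) →
        (CrystRefl.HasSteinbergProperty (CrystRefl.semidirect (CrystRefl.G r p n) Λ) ↔
          CrystRefl.IsListed (CrystRefl.semidirect (CrystRefl.G r p n) Λ))) := by
  open CrystRefl in
  refine ⟨fun n hn Λ hΛ hW => ?_, fun r p n hr hp hn hc hi Λ hΛ hW => ?_⟩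
  · refine ⟨fun _ => isListed_weylA hn (isReflectionLattice_of_isCrystallographic
      (V := sumZero n) actsIsometrically_weylA hΛ hW),
      hasSteinbergProperty_of_isListed (V := sumZero n) fun w hw => ?_⟩
    exact (actsIsometrically_weylA (n := n)).isometry_of_mem hΛ hw
  · refine ⟨fun hs => isListed_of_isSteinbergLattice hr hp hn hc hi
      (isReflectionLattice_of_isCrystallographic (actsIsometrically_G hr) hΛ hW)
      ((hasSteinbergProperty_iff (actsIsometrically_G hr) hΛ).1 hs),
      hasSteinbergProperty_of_isListed fun w hw => ?_⟩
    exact (actsIsometrically_G hr).isometry_of_mem hΛ hw
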